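/- A *triangulation of the closed connected orientable surface of genus $g$* is a finite abstract simplicial complex that is pure of dimension $2$, connected, such that the link of every vertex is a cycle, whose triangles can be coherently oriented, and whose Euler characteristic is $2-2g$. It is *vertex-minimal* if no triangulation of the same surface has fewer vertices. Two triangulations have the same *combinatorial type* if some bijection of their vertex sets carries the faces of one exactly onto the faces of the other. A triangulation $K$ with vertex set $V$ is *geometrically realizable in $\mathbb{R}^3$* if there is a map $x\colon V\to\mathbb{R}^3$ such that the vertices of every triangle of $K$ are sent to affinely independent points, any two distinct triangles $s,t$ of $K$ satisfy $\operatorname{conv}x(s)\cap\operatorname{conv}x(t)=\operatorname{conv}x(s\cap t)$, and any two triangles with a common edge are not coplanar. **Theorem.** The smallest number of vertices of a triangulation of the orientable surface of genus $3$ is $10$, and there are exactly $20$ combinatorial types of vertex-minimal ($10$-vertex) triangulations of this surface. Every one of them is geometrically realizable in $\mathbb{R}^3$; moreover, the realization can be chosen with integer vertex coordinates in general position (distinct points, no three on a line, no four on a plane). -/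

import Mathlib

/-- The number of faces with `k` vertices of an abstract simplicial complex. -/
noncomputable def AbstractSimplicialComplex.faceCount {V : Type*}
    (K : AbstractSimplicialComplex V) (k : ℕ) : ℕ :=
  {s : Finset V | s ∈ K ∧ s.card = k}.ncard

/-- The Euler characteristic `f₀ - f₁ + f₂` of a two-dimensional complex. -/
noncomputable def AbstractSimplicialComplex.eulerChar {V : Type*}
    (K : AbstractSimplicialComplex V) : ℤ :=
  (K.faceCount 1 : ℤ) - K.faceCount 2 + K.faceCount 3

/-- The graph formed by the vertices and edges of the complex. -/
def AbstractSimplicialComplex.edgeGraph {V : Type*} [DecidableEq V]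
    (K : AbstractSimplicialComplex V) : SimpleGraph V where
  Adj a b := a ≠ b ∧ ({a, b} : Finset V) ∈ K
  symm := ⟨fun a b h => ⟨h.1.symm, by rw [Finset.pair_comm]; exact h.2⟩⟩
  loopless := ⟨fun _ h => h.1 rfl⟩

/-- The link of the vertex `v` in a two-dimensional complex, as a graph: its vertices are the
neighbours of `v`, and two of them are adjacent when they span a triangle together with `v`. -/
def AbstractSimplicialComplex.linkGraph {V : Type*} [DecidableEq V]
    (K : AbstractSimplicialComplex V) (v : V) :
    SimpleGraph {w : V // w ≠ v ∧ ({v, w} : Finset V) ∈ K} where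
  Adj a b := a ≠ b ∧ ({v, a.1, b.1} : Finset V) ∈ K
  symm := ⟨fun a b h => ⟨h.1.symm, by rw [Finset.pair_comm]; exact h.2⟩⟩
  loopless := ⟨fun _ h => h.1 rfl⟩

/-- A finite abstract simplicial complex with vertex set `V` is a triangulated closed connected
surface: it is pure of dimension two, it is connected, and the link of every vertex is a cycle,
i.e. a (finite) connected graph all of whose vertices have exactly two neighbours. (The last
condition at the vertex `w` of the link of `v` says that the edge `vw` is in exactly two
triangles.) -/
structure AbstractSimplicialComplex.IsClosedSurface {V : Type*} [Fintype V] [DecidableEq V]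
    (K : AbstractSimplicialComplex V) : Prop where
  card_le_three : ∀ s ∈ K, s.card ≤ 3
  pure : ∀ s ∈ K, ∃ t ∈ K, s ⊆ t ∧ t.card = 3
  connected : K.edgeGraph.Connected
  link_connected : ∀ v, (K.linkGraph v).Connected
  link_two_regular : ∀ v w, ((K.linkGraph v).neighborSet w).ncard = 2

/-- The triangles can be oriented coherently: `O a b c` says that the cyclic order `(a, b, c)` is
the chosen one of the two cyclic orders of the triangle `abc`, and two triangles that share an
edge induce opposite directions on it. -/
def AbstractSimplicialComplex.Orientable {V : Type*} [DecidableEq V]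
    (K : AbstractSimplicialComplex V) : Prop :=
  ∃ O : V → V → V → Prop,
    (∀ a b c, O a b c → O b c a) ∧
    (∀ a b c, ({a, b, c} : Finset V) ∈ K → ({a, b, c} : Finset V).card = 3 →
      (O a b c ↔ ¬ O b a c)) ∧
    (∀ a b c d, ({a, b, c} : Finset V) ∈ K → ({a, b, c} : Finset V).card = 3 →
      ({a, b, d} : Finset V) ∈ K → ({a, b, d} : Finset V).card = 3 → c ≠ d →
      (O a b c ↔ O b a d))

/-- `K` is a triangulation, with vertex set `V`, of the closed connected orientable surface of
genus `g`, whose Euler characteristic is `2 - 2 g`. -/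
structure AbstractSimplicialComplex.Triangulates {V : Type*} [Fintype V] [DecidableEq V]
    (K : AbstractSimplicialComplex V) (g : ℕ) : Prop where
  isClosedSurface : K.IsClosedSurface
  orientable : K.Orientable
  eulerChar_eq : K.eulerChar = 2 - 2 * (g : ℤ)

/-- `K` is a triangulation of the orientable surface of genus `g` with the smallest number of
vertices that a triangulation of this surface can have. -/
def AbstractSimplicialComplex.IsVertexMinimal {V : Type*} [Fintype V] [DecidableEq V]
    (K : AbstractSimplicialComplex V) (g : ℕ) : Prop :=
  K.Triangulates g ∧
    ∀ (m : ℕ) (L : AbstractSimplicialComplex (Fin m)), L.Triangulates g → Fintype.card V ≤ m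

/-- Two complexes have the same combinatorial type: a bijection of their vertex sets takes the
faces of one exactly to the faces of the other. -/
def AbstractSimplicialComplex.Isomorphic {V W : Type*}
    (K : AbstractSimplicialComplex V) (L : AbstractSimplicialComplex W) : Prop :=
  ∃ e : V ≃ W, ∀ s : Finset V, s ∈ K ↔ s.map e.toEmbedding ∈ L

/-- The positions `x` of the vertices give a geometric (polyhedral) realization of the
triangulated surface `K` in `ℝ³`: every triangle spans a nondegenerate triangle; any two distinct
triangles meet exactly in the convex hull of their common vertices, so that they are disjoint or
meet in a common vertex only or in a common edge; and in the last case they are not coplanar. -/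
structure AbstractSimplicialComplex.IsGeometricRealization {V : Type*} [DecidableEq V]
    (K : AbstractSimplicialComplex V) (x : V → EuclideanSpace ℝ (Fin 3)) : Prop where
  nondegenerate : ∀ s ∈ K, s.card = 3 → AffineIndependent ℝ (fun v : s => x v)
  inter_eq : ∀ s ∈ K, ∀ t ∈ K, s.card = 3 → t.card = 3 → s ≠ t →
    convexHull ℝ (x '' (s : Set V)) ∩ convexHull ℝ (x '' (t : Set V)) =
      convexHull ℝ (x '' ((s : Set V) ∩ (t : Set V)))
  not_coplanar : ∀ s ∈ K, ∀ t ∈ K, s.card = 3 → t.card = 3 → (s ∩ t).card = 2 →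
    ¬ Coplanar ℝ (x '' ((s : Set V) ∪ (t : Set V)))

/-- `K` is geometrically realizable in `ℝ³`. -/
def AbstractSimplicialComplex.GeometricallyRealizable {V : Type*} [DecidableEq V]
    (K : AbstractSimplicialComplex V) : Prop :=
  ∃ x : V → EuclideanSpace ℝ (Fin 3), K.IsGeometricRealization x

/-- The points `x v` are distinct, no three of them are on a line and no four are on a plane. -/
def InGeneralPosition {V : Type*} (x : V → EuclideanSpace ℝ (Fin 3)) : Prop :=
  Function.Injective x ∧
    (∀ s : Finset V, s.card = 3 → ¬ Collinear ℝ (x '' (s : Set V))) ∧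
    (∀ s : Finset V, s.card = 4 → ¬ Coplanar ℝ (x '' (s : Set V)))

/-- The point of `ℝ³` with given integer coordinates. -/
noncomputable def integerPoint (z : Fin 3 → ℤ) : EuclideanSpace ℝ (Fin 3) :=
  WithLp.toLp 2 (fun i => (z i : ℝ))

/-! Lower bound. Every edge of a closed triangulated surface lies in two triangles, so Euler
characteristic `-4` with `n` vertices forces `3n + 12` edges. For `n ≤ 9` this exceeds `n(n-1)/2`;
for `n = 10` it is 42 out of 45, so exactly three pairs are not edges.

Enumeration. Three non-edges meet at most six vertices, hence some vertex is adjacent to all nine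
others. Label it 0 and label its link, a 9-cycle, by 1, …, 9 in cyclic order. The non-edges are then
three of the 27 chords of this cycle, and up to the dihedral group of the cycle (reflections reverse
the orientation) it is enough to treat the triples in `certificates`. An oriented surface amounts to
a rotation system: a partial map that sends a directed edge `ab` to the third vertex of the triangle
in which `ab` is positively directed, is compatible with cyclic rotation of triangles, and turns the
neighbours of each vertex in a single cycle. For a fixed set of non-edges all such systems extending
the nine triangles at 0 are found by backtracking: pick a directed edge without a triangle, try
every third vertex, and drop a branch in which a link closes up before it has reached all
neighbours. A certificate records only which edge is picked, or where a link closes, at each node of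
the tree. By `search_sound` a successful replay proves that each completion is listed in `leafData`,
and `leafCheck_leafData` matches every leaf with one of twenty tables.

The twenty types. `tableCheck` and an edge count show that the tables are triangulations of genus 3.
The isomorphism invariant `oppositeMoment` takes twenty different values on them, so the types are
distinct.

Realization. Explicit integer coordinates are given. Nonzero determinants show general position. For
any two distinct triangles there is a plane through three of their vertices that strictly separates
the remaining vertices; the intersection of the triangles lies in that plane, and affine
independence there reduces it to the common face (`FourIndependent.inter_subset_of_separated`). -/

/-! ### Oriented triangle relations on ten labels -/

/-- `T a b c` says that `abc` is a positively oriented triangle of a closed oriented surface with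
vertices labelled by numbers less than ten. -/
structure OrientedRel (T : ℕ → ℕ → ℕ → Prop) : Prop where
  lt : ∀ {a b c}, T a b c → a < 10
  rot : ∀ {a b c}, T a b c → T b c a
  unique : ∀ {a b c d}, T a b c → T a b d → c = d
  -- The link of `a` is one cycle, stated as an induction principle: a property of one neighbour
  -- that is passed on by the rotation at `a` holds for all neighbours.
  link_trans : ∀ {a b c} (P : ℕ → Prop), T a b c → P b → (∀ x y, T a x y → P x → P y) →
    ∀ {x y}, T a x y → P x

/-- The `i`-th hexadecimal digit of `S`. -/
def entry (S i : ℕ) : ℕ := (S >>> (4 * i)) &&& 15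

/-- Write `c + 1` into the (empty) `i`-th hexadecimal digit of `S`. -/
def putEntry (S i c : ℕ) : ℕ := S ||| ((c + 1) <<< (4 * i))

/-- Record the oriented triangle `abc` in the table `S`. -/
def addTri (S a b c : ℕ) : ℕ :=
  putEntry (putEntry (putEntry S (10 * a + b) c) (10 * b + c) a) (10 * c + a) b

/-- The directed edges of the oriented triangle `abc`. -/
def triBits (a b c : ℕ) : ℕ := 2 ^ (10 * a + b) ||| 2 ^ (10 * b + c) ||| 2 ^ (10 * c + a)

/-- Application of `k` to `n` that evaluates `n` first. -/
def force {α : Type} (n : ℕ) (k : ℕ → α) : α := Nat.rec (k 0) (fun m _ => k (Nat.succ m)) n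

/-- In proofs `force` is plain application. Recursion on `n` obliges the kernel to reduce `n` to a
numeral before `k` receives it, so that the large computations do not evaluate a shared argument
again and again. -/
theorem force_eq {α : Type} (n : ℕ) (k : ℕ → α) : force n k = k n := by cases n <;> rfl

/-- The orbit (as a bit set) of `b` under the rotation at `a` recorded in `S`; zero if the recorded
part of the rotation does not close up. -/
def orbit (S a b : ℕ) : ℕ → ℕ → ℕ → ℕ
  | 0, _, _ => 0
  | n + 1, x, O =>
    match entry S (10 * a + x) with
    | 0 => 0
    | e + 1 => bif e.beq b then O else orbit S a b n e (O ||| 2 ^ e)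

/-- Thread `f` through the elements of the bit set `m`. -/
def eachBit (f : ℕ → ℕ → ℕ) : ℕ → ℕ → ℕ → ℕ
  | 0, _, _ => 0
  | n + 1, m, ct => Nat.rec ct (fun m' _ => force (Nat.log2 (Nat.succ m')) fun c =>
      eachBit f n (Nat.succ m' ^^^ 2 ^ c) (f c ct)) m

/-- Check a certificate `ct` (read in base 100) for the claim that every completion of the partial
surface `S` is in the list `leaves`. The bit sets `U` and `V` hold the directed edges without a
triangle and their reversals, and `N` holds all directed edges. A digit of the certificate is a
directed edge: one in `U` is branched on, and for others the link has closed up too early. The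
value is the rest of the certificate, or zero if the check fails. -/
def search (leaves : List ℕ) (N : ℕ) : ℕ → ℕ → ℕ → ℕ → ℕ → ℕ
  | 0, _, _, _, _ => 0
  | n + 1, S, U, V, ct =>
    force ct fun ct =>
    bif ct.beq 0 then 0 else
    bif U.beq 0 then bif leaves.any (fun L => L.beq S) then ct else 0 else
      force (ct % 100 / 10) fun a => force (ct % 10) fun b =>
      bif U.testBit (10 * a + b) then
        eachBit (fun c ct =>
          force (addTri S a b c) fun S' => force (U ^^^ triBits a b c) fun U' =>
          force (V ^^^ triBits c b a) fun V' => search leaves N n S' U' V' ct)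
          10 ((U >>> (10 * b)) &&& (V >>> (10 * a)) &&& 1023) (ct / 100)
      else force (orbit S a b 10 b (2 ^ b)) fun O =>
        bif O.beq 0 || O.beq ((N >>> (10 * a)) &&& 1023) then 0 else ct / 100

/-! ### Bits and hexadecimal digits of the tables -/

theorem testBit_and_1023 (x i : ℕ) :
    (x &&& 1023).testBit i = (x.testBit i && decide (i < 10)) := by
  rw [Nat.testBit_and, show 1023 = 2 ^ 10 - 1 from rfl, Nat.testBit_two_pow_sub_one]

theorem testBit_entry (S i j : ℕ) :
    (entry S i).testBit j = (decide (j < 4) && S.testBit (4 * i + j)) := by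
  rw [entry, Nat.testBit_and, show 15 = 2 ^ 4 - 1 from rfl, Nat.testBit_two_pow_sub_one,
    Nat.testBit_shiftRight, Bool.and_comm]

/-- As `c + 1 < 16`, the new value fits into one hexadecimal digit; that digit was zero, so the
bitwise or writes it without carrying into any other digit. Digit zero stands for "no triangle
known", whence the shift by one. -/
theorem entry_putEntry {S i c : ℕ} (hc : c < 10) (hS : entry S i = 0) (j : ℕ) :
    entry (putEntry S i c) j = if j = i then c + 1 else entry S j := by
  apply Nat.eq_of_testBit_eq
  intro k
  rw [testBit_entry, putEntry, Nat.testBit_or, Nat.testBit_shiftLeft]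
  split_ifs with h
  · subst h
    by_cases hk : k < 4
    · have : S.testBit (4 * j + k) = false := by
        have := testBit_entry S j k
        rw [hS] at this
        simpa [hk] using this.symm
      simp [this, hk]
    · have : (c + 1).testBit k = false := by
        apply Nat.testBit_lt_two_pow
        calc c + 1 < 2 ^ 4 := by omega
          _ ≤ 2 ^ k := Nat.pow_le_pow_right (by omega) (by omega)
      simp [this, hk]
  · rw [testBit_entry]
    by_cases hk : k < 4
    · by_cases hij : 4 * i ≤ 4 * j + k
      · have : (c + 1).testBit (4 * j + k - 4 * i) = false := by
          apply Nat.testBit_lt_two_pow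
          calc c + 1 < 2 ^ 4 := by omega
            _ ≤ _ := Nat.pow_le_pow_right (by omega) (by omega)
        simp [this]
      · simp [hij]
    · simp [hk]

/-! ### Partial surfaces: adding a triangle and closing a link -/

/-- The table `S` and the bit sets `U`, `V` describe a part of the surface `T`. -/
structure PartOf (T : ℕ → ℕ → ℕ → Prop) (S U V : ℕ) : Prop where
  sound : ∀ {a b c}, a < 10 → b < 10 → entry S (10 * a + b) = c + 1 → T a b c
  covers : ∀ {a b c}, T a b c → U.testBit (10 * a + b) = false → entry S (10 * a + b) = c + 1
  vacant : ∀ {a b}, a < 10 → b < 10 → U.testBit (10 * a + b) = true → entry S (10 * a + b) = 0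
  exists_tri : ∀ {a b}, a < 10 → b < 10 → U.testBit (10 * a + b) = true → ∃ c, T a b c
  cyc : ∀ {a b c}, a < 10 → b < 10 → entry S (10 * a + b) = c + 1 → entry S (10 * b + c) = a + 1
  swap : ∀ {a b}, a < 10 → b < 10 → V.testBit (10 * a + b) = U.testBit (10 * b + a)

namespace OrientedRel

variable {T : ℕ → ℕ → ℕ → Prop} {S U V : ℕ}

theorem lt₂ (hT : OrientedRel T) {a b c : ℕ} (h : T a b c) : b < 10 := hT.lt (hT.rot h)

theorem lt₃ (hT : OrientedRel T) {a b c : ℕ} (h : T a b c) : c < 10 := hT.lt₂ (hT.rot h)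

end OrientedRel

theorem index_inj {a b c d : ℕ} (hb : b < 10) (hd : d < 10) :
    10 * a + b = 10 * c + d ↔ a = c ∧ b = d := by omega

theorem testBit_triBits {a b c : ℕ} (i : ℕ) :
    (triBits a b c).testBit i =
      decide (i = 10 * a + b ∨ i = 10 * b + c ∨ i = 10 * c + a) := by
  simp only [triBits, Nat.testBit_or, Nat.testBit_two_pow]
  rw [Bool.eq_iff_iff]
  simp only [Bool.or_eq_true, decide_eq_true_eq]
  omega

namespace PartOf

variable {T : ℕ → ℕ → ℕ → Prop} {S U V : ℕ}

/-- Only triangles all of whose directed edges are free can be added. -/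
theorem testBit_of_tri (h : PartOf T S U V) (hT : OrientedRel T) {a b c : ℕ} (ht : T a b c)
    (hU : U.testBit (10 * a + b) = true) :
    U.testBit (10 * b + c) = true ∧ U.testBit (10 * c + a) = true := by
  have h0 := h.vacant (hT.lt ht) (hT.lt₂ ht) hU
  constructor
  -- If `bc` were already used, two applications of `cyc` would fill the digit of `ab`, which is
  -- vacant; for `ca` one application is enough.
  · by_contra h1
    have h2 := h.covers (hT.rot ht) (by simpa using h1)
    have h3 := h.cyc (hT.lt₃ ht) (hT.lt ht) (h.cyc (hT.lt₂ ht) (hT.lt₃ ht) h2)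
    omega
  · by_contra h1
    have h2 := h.covers (hT.rot (hT.rot ht)) (by simpa using h1)
    have h3 := h.cyc (hT.lt₃ ht) (hT.lt ht) h2
    omega

/-- By `testBit_of_tri` the three directed edges of the triangle are all free, so exclusive or
deletes them from `U`; the triangle `cba` has the reversed edges and deletes those from `V`.
Distinctness of the vertices keeps the three digits of the table apart. -/
theorem add (h : PartOf T S U V) (hT : OrientedRel T) {a b c : ℕ} (ht : T a b c)
    (hne : a ≠ b ∧ b ≠ c ∧ c ≠ a) (hU : U.testBit (10 * a + b) = true) :
    PartOf T (addTri S a b c) (U ^^^ triBits a b c) (V ^^^ triBits c b a) := by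
  obtain ⟨hU2, hU3⟩ := h.testBit_of_tri hT ht hU
  have ha := hT.lt ht
  have hb := hT.lt₂ ht
  have hc := hT.lt₃ ht
  obtain ⟨hab, hbc, hca⟩ := hne
  have e1 := h.vacant ha hb hU
  have e2 := h.vacant hb hc hU2
  have e3 := h.vacant hc ha hU3
  have f1 : ∀ j, entry (putEntry S (10 * a + b) c) j = _ := entry_putEntry hc e1
  have f2 : ∀ j, entry (putEntry (putEntry S (10 * a + b) c) (10 * b + c) a) j = _ :=
    entry_putEntry ha (by rw [f1, if_neg (by omega), e2])
  have f3 : ∀ j, entry (addTri S a b c) j = _ :=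
    entry_putEntry hb (by rw [f2, if_neg (by omega), f1, if_neg (by omega), e3])
  have key : ∀ x y, x < 10 → y < 10 → entry (addTri S a b c) (10 * x + y) =
      if x = c ∧ y = a then b + 1 else if x = b ∧ y = c then a + 1 else
        if x = a ∧ y = b then c + 1 else entry S (10 * x + y) := by
    intro x y hx hy
    rw [f3, f2, f1]
    simp only [index_inj hy ha, index_inj hy hb, index_inj hy hc]
  have keyU : ∀ x y, x < 10 → y < 10 → (U ^^^ triBits a b c).testBit (10 * x + y) =
      (U.testBit (10 * x + y) ^^ decide (x = a ∧ y = b ∨ x = b ∧ y = c ∨ x = c ∧ y = a)) := by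
    intro x y hx hy
    rw [Nat.testBit_xor, testBit_triBits]
    simp only [index_inj hy ha, index_inj hy hb, index_inj hy hc]
  have keyV : ∀ x y, x < 10 → y < 10 → (V ^^^ triBits c b a).testBit (10 * x + y) =
      (V.testBit (10 * x + y) ^^ decide (x = c ∧ y = b ∨ x = b ∧ y = a ∨ x = a ∧ y = c)) := by
    intro x y hx hy
    rw [Nat.testBit_xor, testBit_triBits]
    simp only [index_inj hy ha, index_inj hy hb, index_inj hy hc]
  have t2 := hT.rot ht
  have t3 := hT.rot t2
  have free : ∀ x y, x < 10 → y < 10 → (U ^^^ triBits a b c).testBit (10 * x + y) = true →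
      U.testBit (10 * x + y) = true ∧ ¬ (x = a ∧ y = b) ∧ ¬ (x = b ∧ y = c) ∧
        ¬ (x = c ∧ y = a) := by
    intro x y hx hy hxy
    rw [keyU x y hx hy] at hxy
    by_cases hh : x = a ∧ y = b ∨ x = b ∧ y = c ∨ x = c ∧ y = a
    · have : U.testBit (10 * x + y) = true := by
        rcases hh with ⟨rfl, rfl⟩ | ⟨rfl, rfl⟩ | ⟨rfl, rfl⟩ <;> assumption
      simp [this, hh] at hxy
    · simp only [hh, decide_false, Bool.xor_false] at hxy
      tauto
  refine ⟨?_, ?_, ?_, ?_, ?_, ?_⟩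
  · intro x y z hx hy hxy
    rw [key x y hx hy] at hxy
    split_ifs at hxy with h1 h2 h3
    · obtain ⟨rfl, rfl⟩ := h1
      obtain rfl : b = z := by omega
      exact t3
    · obtain ⟨rfl, rfl⟩ := h2
      obtain rfl : a = z := by omega
      exact t2
    · obtain ⟨rfl, rfl⟩ := h3
      obtain rfl : c = z := by omega
      exact ht
    · exact h.sound hx hy hxy
  · intro x y z hxyz hxy
    have hx := hT.lt hxyz
    have hy := hT.lt₂ hxyz
    rw [key x y hx hy]
    rw [keyU x y hx hy] at hxy
    split_ifs with h1 h2 h3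
    · obtain ⟨rfl, rfl⟩ := h1
      rw [hT.unique hxyz t3]
    · obtain ⟨rfl, rfl⟩ := h2
      rw [hT.unique hxyz t2]
    · obtain ⟨rfl, rfl⟩ := h3
      rw [hT.unique hxyz ht]
    · apply h.covers hxyz
      simpa [h1, h2, h3] using hxy
  · intro x y hx hy hxy
    obtain ⟨h0, h1, h2, h3⟩ := free x y hx hy hxy
    rw [key x y hx hy, if_neg h3, if_neg h2, if_neg h1]
    exact h.vacant hx hy h0
  · intro x y hx hy hxy
    exact h.exists_tri hx hy (free x y hx hy hxy).1
  · intro x y z hx hy hxy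
    rw [key x y hx hy] at hxy
    split_ifs at hxy with h1 h2 h3
    · obtain ⟨rfl, rfl⟩ := h1
      obtain rfl : b = z := by omega
      rw [key _ _ ha hb, if_neg (by omega), if_neg (by omega), if_pos ⟨rfl, rfl⟩]
    · obtain ⟨rfl, rfl⟩ := h2
      obtain rfl : a = z := by omega
      rw [key _ _ hc ha, if_pos ⟨rfl, rfl⟩]
    · obtain ⟨rfl, rfl⟩ := h3
      obtain rfl : c = z := by omega
      rw [key _ _ hb hc, if_neg (by omega), if_pos ⟨rfl, rfl⟩]
    · have hxyz := h.sound hx hy hxy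
      have hz := hT.lt₃ hxyz
      have hyz := h.cyc hx hy hxy
      rw [key _ _ hy hz]
      split_ifs with g1 g2 g3
      · obtain ⟨rfl, rfl⟩ := g1; omega
      · obtain ⟨rfl, rfl⟩ := g2; omega
      · obtain ⟨rfl, rfl⟩ := g3; omega
      · exact hyz
  · intro x y hx hy
    rw [keyU y x hy hx, keyV x y hx hy, h.swap hx hy]
    congr 2
    apply propext
    tauto

/-- A closed walk around `a` has visited all neighbours, because the link of `a` is a single cycle.
The loop invariant is that each visited label is the current one or has its successor among the
visited ones. At closing time the visited set is therefore stable under the rotation, and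
`link_trans` makes it the whole neighbourhood. A shorter closed orbit thus refutes a branch of the
search. -/
theorem orbit_eq_zero_or (h : PartOf T S U V) (hT : OrientedRel T) {N a b : ℕ} (ha : a < 10)
    (hN : ∀ {x}, x < 10 → (N.testBit (10 * a + x) = true ↔ ∃ c, T a x c)) :
    ∀ (n x O : ℕ), x < 10 → O.testBit b = true → O.testBit x = true →
      (∀ u, O.testBit u = true → u = x ∨ ∃ v, T a u v ∧ O.testBit v = true) →
      orbit S a b n x O = 0 ∨ orbit S a b n x O = (N >>> (10 * a)) &&& 1023 := by
  intro n
  induction n with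
  | zero => intro x O _ _ _ _; exact Or.inl rfl
  | succ n ih =>
    intro x O hx hb hOx hO
    rw [orbit]
    split
    · exact Or.inl rfl
    · rename_i e he
      have hxe := h.sound ha hx he
      by_cases heb : e = b
      · subst heb
        have hbeq : (e.beq e) = true := by simp
        rw [hbeq, cond_true]
        right
        have hall : ∀ u, O.testBit u = true → ∃ v, T a u v ∧ O.testBit v = true := by
          intro u hu
          rcases hO u hu with rfl | h'
          · exact ⟨e, hxe, hb⟩
          · exact h'
        apply Nat.eq_of_testBit_eq
        intro u
        rw [testBit_and_1023, Nat.testBit_shiftRight, Bool.eq_iff_iff, Bool.and_eq_true,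
          decide_eq_true_eq]
        constructor
        · intro hu
          obtain ⟨v, huv, _⟩ := hall u hu
          exact ⟨(hN (hT.lt₂ huv)).2 ⟨v, huv⟩, hT.lt₂ huv⟩
        · rintro ⟨hu, hu10⟩
          obtain ⟨v, huv⟩ := (hN hu10).1 hu
          obtain ⟨w, hbw, _⟩ := hall e hb
          refine hT.link_trans (fun z => O.testBit z = true) hbw hb ?_ huv
          intro y z hyz hy
          obtain ⟨z', hyz', hz'⟩ := hall y hy
          rwa [hT.unique hyz hyz']
      · have hbeq : (e.beq b) = false := by
          rw [← Bool.not_eq_true, Nat.beq_eq]; exact heb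
        rw [hbeq, cond_false]
        have hbit : ∀ u, (O ||| 2 ^ e).testBit u = true ↔ O.testBit u = true ∨ u = e := by
          intro u
          rw [Nat.testBit_or, Nat.testBit_two_pow, Bool.or_eq_true, decide_eq_true_eq, @eq_comm _ e]
        apply ih e
        · exact hT.lt₃ hxe
        · exact (hbit b).2 (Or.inl hb)
        · exact (hbit e).2 (Or.inr rfl)
        · intro u hu
          rcases (hbit u).1 hu with hu | rfl
          · rcases hO u hu with rfl | ⟨v, huv, hv⟩
            · exact Or.inr ⟨e, hxe, (hbit e).2 (Or.inr rfl)⟩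
            · exact Or.inr ⟨v, huv, (hbit v).2 (Or.inl hv)⟩
          · exact Or.inl rfl

end PartOf

/-! ### Soundness of the search -/

theorem eachBit_succ (f : ℕ → ℕ → ℕ) (n m ct : ℕ) (hm : m ≠ 0) :
    eachBit f (n + 1) m ct = eachBit f n (m ^^^ 2 ^ Nat.log2 m) (f (Nat.log2 m) ct) := by
  obtain ⟨k, rfl⟩ := Nat.exists_eq_succ_of_ne_zero hm
  rw [eachBit]
  simp only [force_eq]

/-- The remaining certificate is threaded through the calls and a zero stays zero, so a nonzero
final value means that every call succeeded. The input `ct'` of a call depends on the earlier ones,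
but only its existence matters. -/
theorem eachBit_sound {f : ℕ → ℕ → ℕ} (hf : ∀ c, f c 0 = 0) :
    ∀ {n m ct}, eachBit f n m ct ≠ 0 →
      ct ≠ 0 ∧ ∀ c, m.testBit c = true → ∃ ct', f c ct' ≠ 0 := by
  intro n
  induction n with
  | zero => intro m ct h; exact absurd rfl h
  | succ n ih =>
    intro m ct h
    by_cases hm : m = 0
    · subst hm
      exact ⟨h, by simp⟩
    · rw [eachBit_succ _ _ _ _ hm] at h
      obtain ⟨h1, h2⟩ := ih h
      refine ⟨fun h0 => h1 (by rw [h0, hf]), fun c hc => ?_⟩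
      by_cases hcm : c = Nat.log2 m
      · subst hcm; exact ⟨ct, h1⟩
      · apply h2 c
        rw [Nat.testBit_xor, hc, Nat.testBit_two_pow]
        simp [Ne.symm hcm]

theorem search_zero (leaves : List ℕ) (N n S U V : ℕ) : search leaves N n S U V 0 = 0 := by
  cases n <;> rfl

/-- Soundness of `search`: the surface is one of the listed ones. -/
theorem search_sound {T : ℕ → ℕ → ℕ → Prop} (hT : OrientedRel T)
    (hne : ∀ {a b c}, T a b c → a ≠ b) {leaves : List ℕ} {N : ℕ}
    (hN : ∀ {a x}, a < 10 → x < 10 → (N.testBit (10 * a + x) = true ↔ ∃ c, T a x c)) :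
    ∀ {n S U V ct}, search leaves N n S U V ct ≠ 0 → PartOf T S U V →
      ∃ L ∈ leaves, ∀ a b c, T a b c ↔ a < 10 ∧ b < 10 ∧ entry L (10 * a + b) = c + 1 := by
  intro n
  induction n with
  | zero => intro S U V ct h; exact absurd rfl h
  | succ n ih =>
    intro S U V ct h hS
    rw [search, force_eq] at h
    cases h0 : ct.beq 0
    swap
    · simp [h0] at h
    rw [h0, cond_false] at h
    cases hU : U.beq 0
    · rw [hU, cond_false] at h
      simp only [force_eq] at h
      -- A base-100 digit is a pair of decimal digits, so any digit names a directed pair of labels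
      -- and nothing has to be validated.
      have ha : ct % 100 / 10 < 10 := by omega
      have hb : ct % 10 < 10 := by omega
      generalize ct % 100 / 10 = a at h ha
      generalize ct % 10 = b at h hb
      cases hbit : U.testBit (10 * a + b)
      · rw [hbit, cond_false] at h
        -- In a genuine surface the orbit is zero or the full neighbourhood, and in both cases the
        -- check returns zero. A nonzero value is therefore impossible here, and the branch is
        -- empty.
        have := hS.orbit_eq_zero_or hT (N := N) (a := a) (b := b) ha (fun hx => hN ha hx) 10 b
          (2 ^ b) hb (by simp) (by simp) (by
            intro u hu
            rw [Nat.testBit_two_pow] at hu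
            left
            simpa [eq_comm] using hu)
        rcases this with h1 | h1 <;> simp [h1] at h
      · rw [hbit, cond_true] at h
        -- The true third vertex `c` passes the candidate mask, since `bc` and `ca` are free as
        -- well; the recursive call for this `c` describes a larger part of the same surface.
        obtain ⟨c, hc⟩ := hS.exists_tri ha hb hbit
        have hc10 := hT.lt₃ hc
        obtain ⟨h2, h3⟩ := hS.testBit_of_tri hT hc hbit
        obtain ⟨_, h4⟩ := eachBit_sound (by intro c; exact search_zero _ _ _ _ _ _) h
        obtain ⟨ct', h5⟩ := h4 c (by
          rw [testBit_and_1023, Nat.testBit_and, Nat.testBit_shiftRight, Nat.testBit_shiftRight,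
            h2, hS.swap ha hc10, h3]
          simpa using hc10)
        exact ih h5 (hS.add hT hc ⟨hne hc, hne (hT.rot hc), hne (hT.rot (hT.rot hc))⟩ hbit)
    · rw [hU, cond_true] at h
      -- With no free directed edge left, the table records exactly the surface.
      have hU0 : U = 0 := by simpa using hU
      subst hU0
      cases hl : leaves.any (fun L => L.beq S)
      · simp [hl] at h
      · obtain ⟨L, hL, hLS⟩ := List.any_eq_true.1 hl
        obtain rfl : L = S := by simpa using hLS
        refine ⟨L, hL, fun a b c => ⟨fun habc => ⟨hT.lt habc, hT.lt₂ habc, ?_⟩, fun h => ?_⟩⟩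
        · exact hS.covers habc (by simp)
        · exact hS.sound h.1 h.2.1 h.2.2

/-! ### Data -/

/-- The rotation systems of the twenty surfaces. -/
def surfaceTables : List ℕ := [
  0x3508426191065437a0861049a3507041039825638a1029745873210a96456792108a39546a81072400357610a2a98765430,
  0x6548327191036a4750861054a3907341098a25697a10280458372109a6475692108a3584a091072400357610a2a98765430,
  0x6548327191036a4750861053a0907341098a25697a10238458372109a6475092106a3586a491072400357610a2a98765430,
  0x3568427191065437a0861049a35073410a9825678a1029045873210a96456792108a3954a081072400357610a2a98765430,
  0x6548327191046a7350861034a9257351094a80697a10280458329107a6478652109a3547a091082403058610a2a98765430,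
  0x6548720191036a4750861023a0957541093a28697a1023845832a10976475092106a30865491072407358610a2a98765430,
  0x6548327191036a4750861024a3957341090a28697a10280458320109a6475692108a3584a091072407358610a2a98765430,
  0x6548327191036a4750861023a0957341090a28697a10238458320109a6475092106a3586a491072407358610a2a98765430,
  0x6053427191046a73508010243965735109a02869731028a45732910a86458602109a3645a891072407358610a2a98765430,
  0x6043027191046a735080102439657351094a2869731028a45032910786478652109a3645a891072407358610a2a98765430,
  0x6358427191046a735086102439a5735109a028697a1028045732910a86458602109a3845a091072407358610a2a98765430,
  0x3568427191062437a5861049a35073410a0829678a1029045823010a96456792108a3954a081072470359610a2a98765430,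
  0x3645728191056347a083102a90567541093a28687210a3945683a10970475092106a396a5481072407380610a2a98765430,
  0x3645728191046307a083102a49567541093a28687210a3945603a10870478592106a396a5481072407380610a2a98765430,
  0x3645728191056347a083102a90567541092a08687210a3945683a10927475092106a396a0481052407583610a2a98765430,
  0x3645728191043007a083102a49567541032a98680210a3745603a10827478592106a397a6481052407583610a2a98765430,
  0x6435728191032a47568310400a9075410328a9692010a3745630a10927485792106a378a6491052470593610a2a98765430,
  0x746382519105a246078510349a6079210a038467431028a9538a010926485629107a360748a1052460953710a2a98765430,
  0x6745820191040a23568510a239647801034a25692310a078563a210789478250109a30456891072456397810a2a98765430,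
  0x57483261910325a6748610a403907831024a59634a10982759603107a0472659108a35849a71062470630910a2a98765430]

/-- The completions found by the search. An entry `(L, i, p)` says that the digits of `p` give an
isomorphism of `L` with the surface number `i`. -/
def leafData : List (ℕ × ℕ × ℕ) := [
  (0x432578619106324a5784105936a0752104839a638410a7295637a10980495a68107038754a91062760930010a2a98765430, 16, 8912345670),
  (0x54628371910345a6278510243a9673210a4958674210980a596a31078048765910a03485a071092637980010a2a98765430, 0, 2345678910),
  (0x3245786191053246a7841020935a7521043a98634010a7295683a10970475a69108039745a81062867930010a2a98765430, 0, 4062978315),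
  (0x3264785191054326a7841025936a75210a49086743108a905386a10729467a591080396408a1052857903010a2a98765430, 0, 5039728614),
  (0x6243785191036a4725841025369a7541092a0869741083a05326a10987475a981060368504a1092837509010a2a98765430, 3, 9402768513),
  (0x3254876191064523a7851029460a742103a9586384109a70576a3108294675a8109039406a71052857903010a2a98765430, 4, 4953806217),
  (0x463527819102634a5783104a062974210938a5687410a390563021097a4957a81060376a5491082583907010a2a98765430, 1, 3624758019),
  (0x764283519104a3762585103a49607951043a80684310279a532a91087647856910a0346758a1092630059010a2a98765430, 15, 615924387),
  (0x763248519104a3762584105a396079510483a0684310279a5327910a86458a691070376548a1092630059010a2a98765430, 16, 3814925076),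
  (0x436278519105432a7684103596a075310a4980672410839a5386a10729497a581060386794a1052650093010a2a98765430, 15, 7654321980),
  (0x726483519104a37625851032496a79510a30806743102a98532a91087646850910a0346758a1092836059010a2a98765430, 13, 7058394216),
  (0x436278519102534a7684103526a975310a9080672410839a5376a10928495a081060386794a1052685093010a2a98765430, 13, 7654321980),
  (0x3548267191026473a5861032a0597351094a80647a103928582391076a47605a10903947a581062586039010a2a98765430, 2, 9283051674),
  (0x3258467191064273a5861039205a735104a980648a1037295723910a6845706a10903947a581062865039010a2a98765430, 2, 5038297614),
  (0x56427381910324a76583105a46907541038a29683410297a5927a1080647659810a0348a6901072670359010a2a98765430, 1, 9684027513),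
  (0x3624875191053246a785104a9360742103089a6843102a79538a0109264657a91080397468a1052760953010a2a98765430, 3, 3475628019),
  (0x453278619106534a27841029a60575210493a8638410279a5872a10906495a68107037604a01092637958010a2a98765430, 9, 2345678910),
  (0x764523819104a2367583102a49567931040a28684210a709562301089a47856910a0345a9081072567389010a2a98765430, 14, 596127834),
  (0x53284671910234a75686104523a9734102089a642a1089075936010a2845679a10803874a091052785693010a2a98765430, 14, 497132865),
  (0x56324781910264a35783104a062974210938a5687410290a5930210a764567a81090374a5091082683957010a2a98765430, 11, 8013475629),
  (0x465237819102634a5783104a0629742109a805687410239a57302109a64957a81060356a0491082683957010a2a98765430, 8, 517286934),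
  (0x57324861910264a3578410a3062978210930a5637410298a5930210a76456a08109037465a91082683957010a2a98765430, 9, 287519643),
  (0x57234681910462a3758310a40926783109205a64721038a95920310a6745860a1090364a9571082763589010a2a98765430, 4, 4028751963),
  (0x3245867191056273a4851034926a7351094a80647310a829568a91070047265a10983947a801062864030910a2a98765430, 2, 6543219870),
  (0x6745328191042a73568310a409607851034a29692310a87456309107a0478652109a354a6891072470390610a2a98765430, 13, 3286049715),
  (0x436278519106534a2784103906a075210a9384678410329a5370a10960495a281076386745a1092630940710a2a98765430, 13, 682317945),
  (0x53284671910653a72486104903a0734102985a648a1032975970310a6045279a10863864a571092730640910a2a98765430, 19, 2345678910),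
  (0x57483261910325a6748610a403907831024a59634a10982759603107a0472659108a35849a71062470630910a2a98765430, 19, 9876543210),
  (0x724536819106a47350831059426a7951028a04648310a92756379108a047652a1098354a0891062804630710a2a98765430, 12, 827546319),
  (0x764283519105a3427685102a96047931040a28682410379a538a01096047526810a9346095a1072647390810a2a98765430, 12, 5678912340),
  (0x726483519105a34276851042960a79310a08246724103a98538a01096046572810a9346095a1072846390710a2a98765430, 9, 584392176),
  (0x6745328191042a73568310a209647851034a29692310a07856309107a0478250109a354a6891072476390810a2a98765430, 12, 6049713285),
  (0x436278519106534a2784103902a675210a9384678210309a5370a10960495a201078386745a1092634980710a2a98765430, 12, 682317945),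
  (0x3248765191063527a4861059420a7541038a90648a1093705367a1082947259a1068397064a1052854003910a2a98765430, 4, 7928630514),
  (0x425837619106357a24861049235a745103a890638a10907057639102a84927a0108535746a81092835004910a2a98765430, 2, 6948753012),
  (0x764523819103a4726583105a46907951038a24683410a970562791080a47652810a9348a6901072540309710a2a98765430, 0, 374895612),
  (0x724536819106a47350831059206a7951038a24648310a97056379102a847602a1095354a6891072805304710a2a98765430, 12, 6479853012),
  (0x6543728191036a4725831025a6947541092a0869741083a05826a10907475298106a368a0401092437509810a2a98765430, 3, 397286154),
  (0x472583619103647a258510a32694785109420a637410a980562a91070849625810a734860a01092735409810a2a98765430, 0, 4027685193),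
  (0x6724835191036a70258510a32694785109420a6974103a80532a91076846025810a7348605a1092735409810a2a98765430, 11, 491586723),
  (0x6438275191054a36278610259a0474210309a8694a108370538601029a4872a91065375064a1092537904810a2a98765430, 11, 924163578),
  (0x3645287191056473a084103a92657351094a80687310a924568291070a476a5210983947a801062504038610a2a98765430, 3, 4837059216),
  (0x753842619104a37625861052a90479510483a0634a1027985827910a06458269107a37604a01092436059810a2a98765430, 1, 382976154),
  (0x52487361910634a725861059420a7541038a90638a1029745927a1080647659210a834706a01092834059610a2a98765430, 9, 6041372985),
  (0x52487361910435a726861054290a7541038a90632a1098745967a1020847869210a534706a01092835094610a2a98765430, 12, 583942176),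
  (0x3758426191043276a58610a52904785104a390634a1087295726910a08458269107a39704a01062465039810a2a98765430, 1, 9385074126),
  (0x3645287191056273a484103a92657351094a80687310a029568291070a472a5010983947a801062564038910a2a98765430, 5, 6543219870),
  (0x435287619106357a2485104923a6745103a890638210907a576a9102084927a0108538746a01092635084910a2a98765430, 5, 4567891230),
  (0x745283619106a537248510492a06794103a850638210907a576a31029848279010a534506a71092635084910a2a98765430, 8, 413729865),
  (0x54628371910653a7248510492a0673410a9850678210309a597a31026848279010a53460a571092635084910a2a98765430, 14, 4567891230),
  (0x54387261910263a7548610524a0975410983a0637a1020985937a10826482590107a37604a91052486053910a2a98765430, 5, 517962834),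
  (0x52487361910632a754861059420a7541038a90638a1020795937a1082647259010a834706a91052864053910a2a98765430, 5, 5038269714),
  (0x3758426191046237a58610a52904784109a350637a1080295726310a98458290107a39504a71062465039810a2a98765430, 8, 4068927315),
  (0x57483261910462a3758610a529047831094a50637a10802959263107a8478250109a35409a71062465039810a2a98765430, 14, 5432198760),
  (0x56427381910364a27583105a46907531098a24687410290a5927a1080647652810a9348a9001072640359710a2a98765430, 1, 3456789120),
  (0x456273819103542a76831045a69075310a9824672410890a5876a1020949672810a5348a9001072650394710a2a98765430, 3, 3456789120),
  (0x764523819103a4726583105a46907951028a04683410a927562791080a47652810a9348a0901062540639710a2a98765430, 4, 3456789120),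
  (0x6358427191053a276486104593a0734102a895693a1080275786210a09452790108a3874a901062450637910a2a98765430, 8, 5432198760),
  (0x735482619106a5237485103946a0793102a0856384109a27576a210809462508109a38479a01062450637910a2a98765430, 11, 8912345670),
  (0x57428361910364a2758510a346907831090a24637410298a592a01080647652810a934869a01072640359710a2a98765430, 4, 7426310859),
  (0x56248371910463a72585103a4960734109028a6873102a94592a01080646859210a73467a801092730459610a2a98765430, 4, 4758013629),
  (0x3568427191065237a4861049a35073410a9825678a1020095873210a96452790108a3954a081072460357910a2a98765430, 9, 3016957482),
  (0x3452867191056347a08510309a24734109a285647010239a578a21090648529a10673967a401082603457810a2a98765430, 18, 1987654320),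
  (0x745283619105a346708510309a24793104a285634010279a578a21090648526910a734679a01082603457810a2a98765430, 10, 857264319),
  (0x57348261910345a6708510a0239478310249a56340109a27596a210708467259108a37849a01062405637810a2a98765430, 10, 134627589),
  (0x52347861910345a670841050239a75310289a46340109a275967a10208467a29108537849a01062805634710a2a98765430, 18, 937584621),
  (0x6524387191046a7350841035a926735109208a6972108a0458369102a7468a0210953547a091082703584610a2a98765430, 8, 5748301692),
  (0x6354287191046a735084102539a6735109a0286972108a04573691028a468a0210953845a091072507384610a2a98765430, 17, 5432198760),
  (0x6358427191046a735086102439a5735109a028697a1028045732910a86458602109a3845a091072407358610a2a98765430, 10, 9876543210),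
  (0x6548327191036a4750861024a3957341090a28697a10280458320109a6475692108a3584a091072407358610a2a98765430, 6, 9876543210),
  (0x764328519104a5736084105a39267951028a0468321090a7536791028a478a201095364509a1082503684710a2a98765430, 7, 857426319)]

/-- Certificates for `search`, for each set of missing edges up to symmetry. -/
def certificates : List (ℕ × ℕ) := [
  (0x802008000e000, 118432652364343272726845843277383474349283842322729942769262884844854764885395737642636988462461918432939943292576558373249953629277398842736925757374754863263284949286326922549393692246246191818179881),
  (0x2000020080016000, 1185465836247792724634868394885855297743747833959527697766379545252253732977452363237254324242552486842766262266848283938655719184374324225685338743779987953433276272579373885857279732884282763375453533298692429987965795735191818179881),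
  (0x800000020080026000, 15892494939698262583837352725493929744864629884636262264654658665191818988118435468253232653976684668835226244824362659528328284827542576683854988798463254855446396979242965573519184354845447463938687668854998493946287664288526293226933638288368488583868452292528988639835485351918181615),
  (0x60081006000, 1548773942726267283822625838261171698814363579639353783364943498449489661733849434374484746),
  (0x10020082006000, 1322448487428533865795719181818711817988118768498844662686842287662485485851918988161174995533959865858191818174938362629282739478662545353599859657558191818171516),
  (0x4000020084006000, 118836436368328988654484832438443646447684619189881611754183898844864825858363864482819183725323237833565636363285883498235596463361918181775637458878764638665521918181732488748282498879865755819181817154616),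
  (0x1000000020088006000, 1183825323238933573795448585736374998497676377657544647191843399557375446483837375747191818179881174362242625367448374239962536597529544647657558191818988117327647465928247453386579571918181618711865161715),
  (0x20020880006000, 118577659588658595719185886577957581918181798813821548665191717951818842117755818188463178773839881325228545424248229522879273865795719181818711817182752762737384985597319185761171615),
  (0x8000021080006000, 1185465644746544865191854654624499584494862465458824964462665191818179881642737745873422869646254877929484264624654866519181817385998594729544637323238325448549227373238383965755819181817988168599664496976681918181871181718768662462654486976191861171615),
  (0x10000420080006000, 118432884282536263848579883269376577247191828282948433747589882276339635936261918181798817562793739494873696232599347252426524362277339736362653536191818178632265252542459985965755862191818179881682993656363697668191818187118171876638447432538632662685448191861171615),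
  (0x8000200020080006000, 16558329882472749252646393638274862824737865819181816174318711817182737549554473837837692275253257319186117163515),
  (0x200800008001a000, 118322832633736292884844347658659654947433838582649964927265425258258383828685442433228638686264743429882462419186329799463698452287258543243863285284924268643463228422559294925263586587538862828933696799583434242477947247668191818179881),
  (0x80000800008002a000, 1326232497449482427636226489898286338766969494846469448659887982643496274742428633874488664191818988183645735353636835832766363533686585838439884643232838365574342424998494232638686264342764724481918189881185484461918693885377492723865652698695469464676681918181614),
  (0x804008100a000, 1184398846448191847794764481918181798815419322762792749484826646418171719469881548426438443686868264619181818711817544643196119494347461614),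
  (0x1800008200a000, 16847728728922785821918181871181798811838848442285446694619188428388484289329296358726546264668191818179881324848182836322643393263322996193936799487795459385393379383545385595865435443653597393936355337531987388729193673395953329773633758535335545716),
  (0x400800008400a000, 15446196117638424594737282925247374498465631817197668469881541876646498841918475939383537252928274724748664641819174618499849424264484382298224859884656363866947191828936969434928477947644819181817541979924949246464744218171719461416),
  (0x100000800008800a000, 132548468438443766846241918189881187632266926284749626485644764382629838254944684191832477947644824191818141416167339732987797449745446191647844698844774191614194339639839464953367457373238494839382865698248242575373757471614149819711817),
  (0x2800088000a000, 15484683284437668461918181871181798811865432769942738374757191892265832383974744757374668191818179881762118611726586557373636633836199884611937363873529552265947586557373837211921482648851738373687738316),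
  (0x800800108000a000, 1186884766817761718988118657442424784496965546946191717184676689881187632546565288484641918862559296969265446466419181817182742762737427442474864488498846448381918433242699849424747433864481918181746544943353575926562624686641918181769986954499849965446191818171416),
  (0x200000800208000a000, 1433898829659592628598798655739385787977181922659592557986117481626197617811619188798523938383632386519177298195446529682292892573938546596653938383293265484643684383836466319181818711817988118653939252976274757191828853238849232254668741918181798813282626248586262955226393276722927185228575839323238586117691917144818185848853932323282256117498485393238361635),
  (0x1000840008000a000, 11863472424326226389437288449572928656598834363384836191863799474382929275449656262622548433943284859636226361918181716266532832932243626633282744242484824621918181732428779726243427448241918181798816832428438272824697668191818187118171614),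
  (0x400000880008000a000, 1163259372527283929365865574342424998494364433864482419164232839898284342844954466946191614197171482669269336434924326296622643244686481618164335328443427285355843538539535827353746681816147117),
  (0x800020800008000a000, 15484683243844376684619181818711817988118272469369869492437762773191847433239392627373558466819181817988143184754542428262573721918482487729227821918181718277449984937277347191886698649862847794764481918181774272763798559488787191818173298847272278443482972287449743754461918181714325226278225393273383752927987793984286117398339385452633758363516),
  (0x802000000080032000, 1435448377973733727494894244859392927253537385268484343244685541918189881182832833983292849845843374338272626728728827668545832364343873826252562276557275838289224824619188443322885532824254779434384433247372729394739372927263869595935243229323857259885322479253838359887983676681918181514),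
  (0x2000040081012000, 143548554191818175428435735358543327373434828873883461918181798815458278328922773877282191818435773574943471918171843862998822536859885583865571918329263737357274347491918181743755419171737352879274943434374434758878719171718153279925883722563392649434319181871154141624337438332636268623841922719178482656225194997711517586362622636474614),
  (0x2010000082012000, 11847243884262428272772655719185348854879373865795719181817988143548554191818173265544998496576685443322872282748434242462419181817988118438276272624687694242774285938586557191818437637373535953243744347587687871918154354755419181815433858583585799519181815151714),
  (0x6000000084012000, 154182547242425524343834948382819171718988117328528284227241917181898813227411997197449292525272119211939942543833538272529192128747415411741155998592797291815711942414743744363386943859419189835877965636336642414324384436464633284418598851915842825424287288224988165646463766846),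
  (0x1002000000088012000, 118322652529829259476764737522829257539377965571918534885487937386579571918181798811732438548484385287668542885266328978346241918189881177539322542944225249575477998796543355935763757731918185236434394462429247668352924265243547554191818151838253232389335737939957457374719187998795779577419181815151714),
  (0x2020000880012000, 11854484849794854383994767627764737655719185485799252526557541918181798816557191818173264428498846485488648283838397668542864363687385983462419181817988147877539733857765775953719181818953838285858259519188517186557191843288452287957385819181817184776473274424736323783395876878719185898862684495958547554988519181817171514),
  (0xa000001080012000, 11854485438434775655948242646393238524727723537191854654385545465766819181817988148768787655719181817324332288572282743247668191818179881326296622454192993173792496565466965434229153537944769655446466428863252262524281732434262296279494242262443191732835996282524191717151828254739372919171525926562622686865886281532434379241915583225833282191515171838766814),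
  (0x2002000002080012000, 143852828411518646376683819529885215779577574151936323232628779624692269636323938988118279652285229944727976557191854247927246557547419181817988132324262272624766885488543191818487687871818171775988125584939384624262928275757255853531918181832585749462726252947363239391918851718655719184328833983387458191818171858768787183286653638983928325475541918181717151435),
  (0x12000400080012000, 118854396524743382868494384844819184885472449244748191818179881487687876557191818173242844252852952424248766824191818179881324225589225427992824342424919181818434257765725794942439579928243424249851918177957382858491917439443354919171715766819217995434242191818177443747417154218597598596557191882214342153676685226434242181571194141472414),
  (0x4002000800080012000, 1488524465446462448191818988117185976322932682437279859439839849879522538586557191818324332764228426842423235792463435876878719181518574336844339572727733239952457273772191843586868625258733873733226322868275757353719181815151714),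
  (0x8002200000080012000, 179987973733843847247363638422847273537171515718198811527748449274349599252383776274773171571434747273725181773983948747449877918171714358151),
  (0x800000040081022000, 11916836868181668814948484874484798846476438398699849434748161515158548433779737337274743494816151898195446694619181818844619181618847238363528262559632929794943434746191851161514),
  (0x800010000082022000, 1511958329773633758359565586516141498192842287259481416185858988565575143184654684993629246191843378774293954595348854837375338191818165348988659538554191818163249963238389869879895397668191818161465534336866419141441393697733754535151573515),
  (0x804000000084022000, 1188483422742289884645886588428824819189881544669461918181884461918161451648686988419181846644376324283986998434224644819181814161854686385535763397668461918324343636376684619181816166485598549492474844984696449967668191818161415),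
  (0x800020000880022000, 1198658581618981932189885975947181616192414955285521914165118195198198559581846546838383926283646191848858559473636374885484846833938191818165232826474424224595285541918181632599859952419181816141565363275266582262772393236321994194972363283393864492426157592255425485416492847273239874259592829757547743932323673383757),
  (0x808000001080022000, 151485832944624285793838294462829573974843865586519181816186254694662855268766819188549929252646262699869766819181816151865864992626262544998496462266519186432599642353283393876866284497647374819181815656998696519161618189881766854652559494947296969264669466519181818433729695869264796844619181618688476681851161514),
  (0x810000400080022000, 11832438259253857494349248449846254473997478442636268683619181614512863632825293673394943434732823937362926252759582843478449481918181618326857353538287569692676684343599619185116144885244743699869855947432448191818161415),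
  (0x8800200000080022000, 143514898823686386227535252591918181615186484426442382848822529962625499849744847191864328498767627792459985948191818159881438438383954535359191818186868478446191816186884766818511615143239266969727916546448162994655854467676472736323283397232211929965895521638328372477987797373194118181915498449949526424249292994691474738779393665363932854885655838328373727227473735),
  (0x200010000400080042000, 11749986987989459966874481917151461544775244386988676684943492447151414416116),
  (0x10040083002000, 11921488537365465648439363738799329212982292838755935378738631884689661636336292121722827199554957559655793688329212121814848698438373783736993292128286119616986638397732928389869989554866573388663292828212692),
  (0x4000040085002000, 119432138798779393853537993292129822928354395534394191939159535292828499637175458581636468514577929282127436868694383282518381748376541184998494174481647542118611883941761171818169881151725597559292518171643545217645215151617656581259357657676981946434373389516177474175116153754435882853717588758291737252552155416471492),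
  (0x1000000040089002000, 119432986632628163936191617584846714981153828262621953943395226952937757537741558261558153818743798191754832928266186196126838251161546148779265461868646988129266936389776973938573693292621653937753739935729262626811636292621283558488748871881544683292121215961178116946393292128284319539595757119711787799663352928985987987668292828212592),
  (0x20040881002000, 118266868828248281918282848591918181652287927191818161617651627527627171671733837941957251838219529265973648682841848648748848773839881546428398336181828862886184848389881197676763797739392652152984937279819929357465464611961411637263676866127473736366383833896618583494141474338281619988519152632868616152674383839364614),
  (0x8000041081002000, 14328862818183864761818181737474141846448437447191717656571211616388483699881766854484362272625353748432886288618484835389881433217192592926217284948484315766843481916852829171619494843181916622985281716191898812646544119197118746486196141868217761754153818862616437318868635494141433761196119438539494317151519626161164776684614),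
  (0x10000440081002000, 17995171798818115434141419441494176171532686559656828161517614341844948181543533635282737471915711868842894471917754747171715382882847668196119711995854349611757155443191586988676681815711949434141471614),
  (0x8000200040081002000, 143252876376976693636376329282672282725513227282827258482164352261898192527373737274714171547511614849484292816263625153298812583737272471773194118181915498449947473171747371937213696642928281517372571197117372792877935),
  (0x4010000086002000, 1197994541676683919199346718779292828284765535961377617717379292827271838847668714154944116766814282787728232544117761797714693655754411765755817416557934681292828161617399481142928212876471716166869586171977329284741184168474138768715149774292828212492),
  (0x100001000008a002000, 119577957581918181871181751164742689881144748367664288628212698817443547537765339533775585854175198197517797479435442267618174681548779957343542668261416487139958779435996191451161776177687873854653983397637535397735735153217657558171538847668292828433994153587798114292821285484462898814141147668292828212492),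
  (0x8010001082002000, 1688476681818187118179881516585216447395719171714282818399535376117851848195182292827462617575758181714196516822928275446269881435448171718851835436276622862877975822164622635659881435443325185513938383235373219212487877668434335328484241717585151393237355354144338512716761782297154517559393893325447277979179659515154383737328365973939535337573515),
  (0x2000010002082002000, 1659494493938389353531414721717148181515851144747833658515335512626283946181947146114285874484717162757433898689441272682242859879839381992471728699819545151519551593938383632549665766839383832933221829887989819261839328336535319981979745453535119511992269272792996515338191829947676472776175835436543321876873238545151321887977126863932321917741719469239323654515153573515),
  (0x10010400082002000, 1184947373835395727697228685448191898816117722819363637942724376379372928282447242417587228273626164363855958573743356579573938383537263698813243439332263976686557544384266826185116542415577957581918181871181751163243174269383959352729685343421817191942278779534342191818171716544374189336359695191817511654241514),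
  (0x4000010800082002000, 1157624462426372765795772191818151898494682721918151516654646651692192982292863942618183826988173727257573727172743322632358779711971322898851998192928374338593738353658151849191943766829282826242771763242261824372765795771711998191515717217326519751717195727245116435432192738844228271817171918279885372796191817171624541514),
  (0x8000210000082002000, 151182735433635988573644819185858591918181416324742187118651614472732385114819881513938329551593635371743321861966186393237943932611476926117373239365453535182262696393838988384416337545353513515),
  (0x100400000008c002000, 13219284147171616697181988176439884461617165484491716156118292843513995958779352928282192465461981947144242421447174648832928252885282198817668142884289573988615148229282515141418434815284336367676981996611754744847435228253587791546155251644818988235376963974715588385292828251815191754191798292818171919192925211546141624),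
  (0x4020000884002000, 13846544985989881656161467664182827276117163938933279715415146851714772728779724718511815251758684754844624273938383236465498879865616146862192929564163239642182192165645446722839323268367338614619619719722946688768393838699761464668686939383232988197746561615481159881614116976969393838323637),
  (0xc000001084002000, 14865431761611425383565988176688115988161616196616976685429939247844165646461499849481815158551656464614664194194471515155448181517196564494979258771399483194343432835387448929365646469543215541565616119246464461416),
  (0x4004000800084002000, 13215544643722527294943461918181518984919184615151641281943848416151598192871181727435395494939352928282728595815164936193957187338292837499849191576682928282592161825422828191515181617144328768787281996194638184815252121872882536554658272757196378779357151644814162525286814151971821814722857579525437335292521213237172724),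
  (0x8004200000084002000, 18454477242461918189881477947644819181814141665165446191643255353354668191614195117511827534384432725837364485219186558651918187646144337272819181847322532374252191818144617164332515332524951844128295424611732361627866454525239367338521924977392535225655465373515),
  (0x1000020000888002000, 132927669695446169476617617477647793632833976743224481616241439327417473276866939323665573732989665962687988242652669242836323737797114485815158226714765549665411575474717877936323237373873),
  (0x1010000400088002000, 118598559252557526219189881611718625848191898843737191818176557472487738326247441194147932426254365521718285473397363296562198779353615161732152939955424767474743219419819189443247574178779651715933515626183397676377443355935371743653636761615157575933573573218752652682642424719181547322617761787362926256557424141477494799469621918182862261819156117162414),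
  (0x8020001880002000, 128286118211921766872292694191717181821821818629417171481971994547548541992699775596557393232371914421747522998195498815151495485592114819881189774257669587475191518841815859819751797742498494776171421211715472749957165573237833938),
  (0x2000020002880002000, 116491792242668167962426892262768469594617449247919196146262661214949197914614626169632393898164817871852168165955161529226822528698798393838931542545465646458872827626217171528581848648748215419419519496561616464145446766839323232245787794765626246544651199819654161612154174114181676681996211921481416966496766849251587796296647118614995544227822639323836),
  (0x4000020800880002000, 182466926242817922732392172977265591779393232367338215718717158655794692496727575587197711739323232722116169226721757655758574252176518851846582426162739323832387686693938544248988595264665866986248198815149659776393838323637),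
  (0x8000220000880002000, 119432887282937391918186117815951511429966246362619141781165158259551184342263738582564483619185858591918181416192486629226161414981952597118517118681658251751246882824817161671178774873946181772244676623848181717161452518717244948181771249279924919181817611714525151598284186447194686188429822162242448268221611787738354525251189882545252512515),
  (0x4008000801080002000, 143359279877939383835323858161849192925681496627676574995822629194969173938325787799343525858545449755972282739323232582414161929494142655976761772499572172758768739323832385414462841988149546557393857525276697659521565579775393838323537),
  (0x2010000402080002000, 1438571188169616116922639383893323821855498855162616116155719196561611821541518169881263938659665766839383832364887485449686939323232826129982987796261686826393238329821164242194979242669879839383821381961981961966169393816323635),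
  (0x4010000c00080002000, 11918355838933619184948151516653228628728263693371918184948975997877948491819151617943219511885853572199643424251164118511629399532358779159882434242412414),
  (0x200802000001c000, 11843325446297952523937373232422776278628547924687632262627793239463662544858652759985932273747322727286968373236735735191843858537329557249679378548322775254848242876683225655727293683365858253258393936844972523286692468535225588535191818179881),
  (0x80000802000002c000, 12128394292925728299665847338858564636328644853372928325792655486638485324225242849848646988319181898811868833532574728692639323554324885274965693726644787794926636337367668191836482862289237922542495442422624483583398335252552484858693676681918181613),
  (0x806000100c000, 16883262928872829264996499469277668191818187118179881187668364327738347434968486219183665363748493265362627747447681918181798815443199662798779611949434984494821637338134943437448474616),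
  (0x1802000200c000, 16575655337275719181818711817988118365465657662544858191836652828485929363296495729282727242668191818179881211865277373535357432664267929465448355819186575544754373753571918181749959427242429549224294658288663191818172886322732283887385954545353579883191818171316),
  (0x400802000400c000, 13618693283836565369869191864833983656448874865366919181817766898815418323997424347633963191886631918181321376328836564646319181813132128472524298779733973988319181813174616),
  (0x100000802000800c000, 16568837553522664644926287668191818988121376338487537761918181313165721657558733973191818988171163632833669832468181673711317),
  (0x800802100000c000, 16859966449697668191818187118179881214392598227752724285939383835657338977357931918181728322886285739323873389883191818171316),
  (0x200000802200000c000, 165164338633839393519163236693683322983391916131971572171163632754747272724287474479885655357681816711317),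
  (0x2000060001014000, 15448275773376363722972262737179336494893373828262696322996592636494848474348653529281918171525379881636262596576866949482115581757181363722865977649484843949379877963626276688336494848487448479881476321833232633968826326265818588638733836484787748446),
  (0x2010020002014000, 1185998595865571918576579571918181798811843833519185883988335988576687553191818171798812165182748858584929476277319183753539859191818175754485438389357855319181817437335191818171315),
  (0x6000020004014000, 1546432439443645419931939494887486565366965351915571519359337696532439335934324249469646436366321185327736938191853283983693819181817324364828779242819181875171924171829196469363543324343656563139881324384436464633243852825422818544843988165646463766846),
  (0x1002000020008014000, 1654383252828294875374758253557191818185985593635793759659859499576763776574719181757731918181794462928289275534383252443983924292535521918181717152165375353985985525719171743733519171319219881),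
  (0x400002000020010014000, 1184883199343253753351715151983584843533686585848481854874857432553533517151571481858766884211865274886485338388373571918389224293938933853755265571918181319219881),
  (0x2020020800014000, 16554277627487258545758632827575725585919181818577632592529393228273636544639367427274737571918179881211827753292245925259495587573191858322947833959485898855432242754482832242428622754525258251918181717132165571918181728323828852854463938855464544226462828393838329883191818171315),
  (0xa000021000014000, 12454868532434348864632246962544646648421546554644746925732293957191818136519219881324373622727482496877996492652722972728765626226494242422921311525357228696262964842249425497995191818175332185998599749822919185117353237989659599837323219171785181951193735154321531818173832438318751738193253531935431398817668),
  (0x2002000022000014000, 11843833519189881651532965228522925947676277459255985592592742747191551197157214336315485851815153631193654656569193543324328323218182115155343631317),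
  (0x800002000024000014000, 1858537329557249679378548322775254848242819171743733519171376681821652759985932273747322727286968373236735719171713189881),
  (0x800000060001024000, 146432176192993689662372713577957768787494346431998198392255727279732926969727327374643844948722119212626822972573262285929529881735757279337434958838336966168683118966138738787494343467448544348312558162865761563383273811318162839273776866949482113383863187228659776494848434647),
  (0x800010020002024000, 15826766318134363381316595898851921168559581816139819956519211316355439849898543558181613981957216518547548547428533826686337363294262719183654651918181657576557855319181816289883191818161315),
  (0x804000020004024000, 154693227744828656536986919181818327432286337693619181698813873386536938663191818183282292873386339631918133186181698817668462113353243434669369886586319131354433557372825248779327448472524294619131619212136546565191616289883191613192115),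
  (0x1800000020008024000, 12119584787485239323263381615151526766828383885531615189819213863381615151898831938633816151583153885381539189819938779324887482984622932798779793759191818183775582626963783361918161868838254252524522482252583652876681918547669764858191818161513654373323296292946424284494343747337733886381818988115159335757332438252655225424831599858182435593543747373374757),
  (0x800020020800024000, 11838633776373895849883191898816557479537366936191818183283322626963783361918161321385252683854637439973927933863595428655719181816289883191818161315),
  (0x808000021000024000, 1546585542525282646828565191818161825322554722454272558353253433532725474695425573932353719181613211318684364262627943239324959968798853932373559357668191835833983352525524848685819181816132118385337544227694785484639373898831918161315),
  (0x2800000022000024000, 13293298229434242844924767474744843932982294324489442757447194992767575275432434342462787796519134325516513162575753526546532329839533818164335152132166332636316938332699869272525363235181616163669986916631513164932472449947668214332253235161515131839981957),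
  (0x810000420000024000, 15447579363386325855485257228656262263619181898811865869282836962626229988798733863622665191898816998697668366936191818188336191816131868837668183586988668524858191818162113436365574763398686285935389772474242496338481918181398812113656998696519131861181921215285853232853838656363263225377428383732632669191862322959595739696265651918181613766815),
  (0x4800000820000024000, 13684465446287343646554656536387338866319181898811854658687728264435454651918988157877959264836693643329886247275755927833537191818183762242627372532695729262528494862393737323583361918161318436883288787587559753727766835593519183554733249393648292824262579283235855924276337581918181621134363263232243964862859353859463935372726493875724354549885481918181398812118266959494629573224273864546565636554485457393232365373383719186276399493757636546565191818163238698649766843532632273587792419181816289883191818161315),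
  (0x200004000020004044000, 154136973392532323935656536986919133774822973322737573828191313175847493537392527298728874838691913136117161364355474873557643663191361171621365327737337696936651916164332532732283519161319211521655838285739191728849884285474486465191717151632438674497447191717281516864313766846),
  (0x200008000021000044000, 11538758787988353371915548779243557466873381915131961216115357375753529254973766832833229833938571715611316),
  (0x10060003004000, 1542119499594921621636557583947434348644929212982292815656538571596191993191963367118162921217228272619433226366536179663292696622849434984494887382618533658875865815858711759574943437448479246),
  (0x4000060005004000, 154489363383693376969494813819881381518289595352827389337175898816316494848471921174337439316161721655771531886865816396557292121214397696949434848292128279294433115739231176563638379951537316361613683766849434984494896866136167338659649434374484746),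
  (0x1000000060009004000, 1544837769776372669269336626153933673174948933713358359353871379881933573371779794948484743482921658659652821295997855928212129292576866949482171181373731381157118651628659776494848439419433273353998192929798779284943498449489671192928358775794943437448479246),
  (0x8000061001004000, 11961374337271794476961967668211343573579574948484874484743132153395979845319488592193743131546165443952925353792656161218552391813169881494848436283393217286216966173384943437448474654481929971727611772722997626116494893937272521659797949484847432161722587722862611365586549484843944626),
  (0x4010020006004000, 1544793598559737357977549479774272943877379694743484829272421192121322794479429272419212819322197191781158548474779292128849219213743571971156817474374292192322143816339397668484349744929212424274246),
  (0x100001002000a004000, 11954476181617619613818292121622847424226199665962926966242474654435419599695611829212162284342424232211996599679292126434246547421391996599668484343644949942921544632242154986164814337433864366176611896968798462821244292),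
  (0x8010021002004000, 1213751187118178559581613651954866518171719988132211316174747273757731843583519181743353519195398812132434354595843325492798779595437321918183131353553132146541949657558769246176575581718988219544626131654653118711817545353574375858518187517351365218568766828385753191818176117131615),
  (0x2000010022002004000, 165192113355828749263139819177547246559654872472717715732298229424284492476747474484329822924489442757447499276757554434326242928462787791721365319161668851813433535536898817558176521187118173116132151433183313513535715),
  (0x4000010820002004000, 1435432156557212138169527266926434242422663391919163965592669434249622982292887737969292121722827434242423298621616535887388193325993795358381887982643424624423263396321212119981939392821278779264342198328213997396829212892434242463242326868196939272626856882284342244854),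
  (0x100400002000c004000, 132192154194996168598814629282821922187792921822546424264475446464748616197215779138565636317684642427686694642424776647424),
  (0x4020020804004000, 1541836693628191837742873191818173237966439373269191818611716988127837524492427945283738348199636273716584887288319219881136582986536138383393821197487871717641913277317177164643669133713181857611738161538326186869881321338397668211381136139322732611731766857653227373647599257588665572728572565581951216318218518836463747424877973386463636513151646),
  (0x2004000022004004000, 13643366585513969361861651821281817171539323265653661966496693576682154366186863693465338131398811843351918579881766815356946522836355319156163136117542132157115588318186561614361133243641832836564642186863131133643634616),
  (0x800004000024004004000, 15421138243242442824819131616166339631916966186484818821921213236433651168625484824192128988132432161181773171893656113433243648528254228185448656464216161313113364363766846),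
  (0x4004000820004004000, 13219322197595915351619981928212929434921619661212887287668494343469242544319922176866915977528212131511653359881282125924943464265588358955283181863616165766846424264544631193935877965636383189882373163616136837668434242464824),
  (0x1000020020808004000, 1654337361898851371373198197337177474377163381618543228492518161375713731199819187473736816383669361916137371713717475721375847874852393232376338191818988117171868838254252524522482252583652876681918547669764858191818161747794737371773136521822152515125322663283232181816437473731871717575475715),
  (0x1008000021008004000, 13265985987985965262926194996292625424347877949474329252526287668197187878182696161464664472595294626962421132575531918185732642624526276681918181513611721431919573725531515518779132165755818181321322831154313575446476121546526922682626518216116),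
  (0x3000000022008004000, 157656532199292294342424646323221611338689335294342422448747171475771213232982943424284492459985965256553161515511374718779196558161313138113351843549554519819757474574717),
  (0x1010000420008004000, 124139665963625357657573736829898617137795325252959697973174824943243715757737379877949432424421921282868217197716576769249434343571365586576763668522128135939371917591719393613358686182928219881264324483224432619981961182926735997979529262135655782254843244247),
  (0x400008000021010004000, 132432649964926323243327449272626543787793229941919977397434787486961612696247668243247244849616261966169322125542521766117242676682148867553477515611758488385252565571773731719325327355835321917171818151321385448583883324332266929794324248774138416),
  (0x2000020022800004000, 1213816548585167168813938988331161654656598817668393838319318366936833919181672722765593632323258875896363239191818651617323117266598879826681817826284462426181717163231242421257668522625951818426227262494843231313931211886181632318218186119323131368779431513),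
  (0x4000020820800004000, 119985987982828485985595895651798832718173617863838733918171998819331393813161727375752436224482632217575212425877921191748592928275846254948393232633818171998819442254976682775272124254676684831322149952746163932313613372131383839191818176516271887162773271916161765573765434636242829181916395452525976737375758779651949323238484636921984433648929454329886195116245425571315),
  (0x2008000023000004000, 12119981971181715176575581817153182822857191792598227752724285919171715393838319316324354181949968535323217188383181753154618328332291918571826686846522835191853156117164313),
  (0x2010000422000004000, 13243482779494892798779492424474221599292267229181993191828287229637668394942753226988126287527977265574842422494793221611338689335292776177187794948482419971727244724329319192872722947247987748443),
  (0x2008040001018000, 12143547543794787793828322998395486698639394749499649862828383232433676683519181854433887874743461918181717749881184732822773582848478474191847588758684847847994191818171854484376767935768787461918544348323558267679536557494874434619181817171413),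
  (0x2018000002018000, 121324338768787478443191818174398879858589535354338873854578758955385191818179881587664373776635958655753317373635953326339632763375853533595435374683636267448373779545387586543633754535357358513),
  (0x6008000004018000, 1213229982928742419181817686483359883366976684328328779246446833598866319181817988154189292294949249463373619185858735242484819181814143263373629484828181414143242872835854227241814174142488648429879357284241918183243438663488574481414716463864176684613),
  (0x1002008000008018000, 1652113746536933649468339743758392529352836524648753749471918187443355935763749741918181413572143984985987675758779653259596286282487766857351918189881183753393975377943376559656894475737357319184737535226254986283675374879477319181814141317),
  (0x2028000800018000, 1216584547554743938385719181817283238849884393847877949866239383832988319181817988118242762272468285919183276372924191818541476878718286883833719141418544817521928266426288294469227925452855958652732988436322747371819187427763236487419181473244929985952544646274925191818743293322468393719181814184728284892257227471918584948282624259468323639191818141437175713),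
  (0x2002008002000018000, 12165182776279849598559363525323227499224298339191818434876873519181457184332533662499527393668326882435336486828351918476576754848766869393232685824544669845229393232363519181814141713),
  (0x800002008004000018000, 121174328862824954239323232722427598628583676683519171818988113),
  (0x800008040001028000, 154266385484835323264633726263282292826361918486337983929364948191818941698811932166416139819462126654874483536476343394898863935575326267668326557279419161641944184132154475939352629285382698779461918181616474754435446766818186454741314),
  (0x800018000002028000, 121325381169881835328399839981969799487795459385354436898813859545358654354822928274618147339595459354335544398399872722897733758543553575831866298863231933676373759586557531919367339595332977363375853533595435374683636267448373779545387586543633754535357358513),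
  (0x804008000004028000, 1211336181814766813214669461914148618136114658398836536181463614898817668215432436339634319141441461316),
  (0x800028000800028000, 121192163377637381614141898836328838338161414145438252524372769263928384616141898193731644864642672281816168661363196659619161696613631313939395958478661393131366557373121188618163231821961191818323131361883363618183226683219181486659886191414861836361637377313),
  (0x808008001000028000, 1211854254242856524646464322774242864266946191818286585484864646539837668191814186846832824748748766884191848286228923792254249544242262448766819181814141613),
  (0x2800008002000028000, 121431638633816931646766816143881689881381819322832633816141414328443141898193543325298861918183142523232795424687687876536693619141441217669769616323631329269693632191616613226546516363231395758742182827427725757255857765372822927255775324684841628198484191475325898861943141647476575655227572474853513),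
  (0x810008400000028000, 1163232826558583532733863632448436376866935384843249419166998697668366936191613194118688376681898813263657565522757384948483263868626484724988419181813162124432787792949434924844984766819181816161314),
  (0x200008008001000048000, 1211754659579792696353932655232472846733819171743476464862835386448766819171417466562433998393565624648244724866948733868191757277397732757936994755897759532393865574719171714141613),
  (0x202000008002000048000, 121161443652775753232393957351914166958272626393528535742496868263848272465767619141416161713),
  (0x4008040005008000, 11921659557292828213194191996711329212121694636193741397931292148285453535865575727214371373759396557952925252543537494744387741949545375593529252125493619131716395954463854485821282197595953855328212565575292),
  (0x1000008040009008000, 1211975522836535396257547981926682848431318135484461813141971981987795343848414148585811628988331381626592862768787192121531949844974194636471974497419141354133737481441468779176519432138768754535329212835924354532619981961182926397497979329262143633753258239973974492921212658252535545257),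
  (0x2000008042001008000, 121652543545453655464163846262953522757544754633819181884988114438438382632351918181616141743141919326814768787277149844994747114757527176519546539369252317119711716545227532557655254197117485854722827577652295227581992927229545252572553533513),
  (0x4018000006008000, 1193747877995922194433939291331981996438336695453535332746836361637216113638138245453595332748449245453855958276519751446811447717154439335396841461729282828433937595937397154479673173529282727438797733528278772829257),
  (0x100001800000a008000, 137545874329829371769974984495958548779195379948779595359855958929565438776873887384363375954545432213669693229733959545353532143373713139773545321137197713932326337139773545353583557),
  (0x2000018002002008000, 16521879771595454543221146196611686861832324339497132247686696854355813214335544846161414191919711971981917585435135357),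
  (0x2004008002004008000, 1216594191958832429535225635971979792596353275716546343191818291975356564646346161736187669699476646419171718173242747424191718181476681917488748693265685228525736323235181719324343631613),
  (0x800004008004004008000, 1215442488648429879357284241918183243438663488574481414716463864146315417475454175969694665353136365419194632313135355363132113653259473529252827493969654764191717861813411698817668),
  (0x1000028000808008000, 1651921879771819446292828284646191913186476682928219259545454322128763963973968386929282164472454255858644798196986692421212149984919194864472421268229595825543221699396811629212682263873737171688349263718437474245854255257),
  (0x1008008001008008000, 121964953658559533876757553199319397574741787796538598559389353537339833953977335177343933575731747573232426196969541372925252628184374431917171814766819946952481814141717699743533973395329262535525796246576191474487468261814197657286228262419141468187118171613),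
  (0x1010008400008008000, 132211828376576739883191826636219181813411941192128264987982925252628311698817668216197758779252121136216216338611961195997172821252526376559597676374341414825597587799565215897699735292828215825524183395226183681434242417676377617484839361719371416862928288259585886585226292126855328264821293525475724),
  (0x1001000009000008008000, 13241437943351813133126766819412119211836838318141438264229424976263816712171926568181886138787176519432698699826424253543569921921989835292192437554495728218628476576592862161898191829288529644242191847657676191613544363188787169761966247435226682671189662295247424214144652472158766832351353877929525447547424),
  (0x400008008001010008000, 117324343191786189881476576481918187118171832437443191717181413766818611776174314481848988176682117388443545484386986878719181818839883733819181748863275525839353532384819171718183242488648582684241917171818141316),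
  (0x402000008002010008000, 1216571622959257676475819716227253524433939245829355925535257144332263285351914161619433285598539323863383516141498191817438516641617484353368648481876685819217119712192622757525232216262685352322558853513),
  (0x400010008400010008000, 118174384533835191758189881142639631914711886196113766821819881611838137668652474484875874139411747252421192132214221175724265218387338871893836963632118191918616313366554184118713748696517387338171493586936132626526216),
  (0x404000008800010008000, 13219412697292517279569264948484194214218588681494141428484841816481921211863161618137668142165766546461648657629272721522643546558417118171646416219975727292114656227265359975953358779255424),
  (0x2000028002800008000, 1653868988468163938988316633814141619981993188339191869943636699319181814861993265825484718399839631919361613572116399839633818141416193963381614148314811438391879949819932632266832181414833636181414196382181961191836323232188718611414363239161321712732852952686924278787522484492727545285595847719885727147545897972552541425244859255874727271988574714727571317),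
  (0x802000040001030000, 132542853852828388773834619181898811854483258835828484619184115132154382626273887288285461918181528263232872838733849434347469883191818151314),
  (0x802010000002030000, 12165152884438728469285849883191818988118544353733837855419185473328773395954537338371918181415575898864683395958988565571918181418586332283676375958958335191843141513),
  (0x802020000800030000, 12118328258587439323762488686693932328774843619181518495854964949542587583639583229322573273795191841151413),
  (0x812000400000030000, 121194997379415141498191474322453858548151848142442411932488548431518153242844224181514981947657396633286694229683673275365191528421815361943539881757527375342288539965325434236191818819441494373369394732772599637475743988798599859766852982937274925355935191818183287726925434787488335191884151848472527762758254724489884191841151413),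
  (0x200002000040001050000, 1325773572747131713326327544727292937252653277339733736171315413219711913134948484194544147325887586559191515131348474146842154325958494839383829579372282726744346191717156553369427522665262927924657191717151314),
  (0x200002020000800050000, 121172482572794848598832648484939383832622862582639394636191715174932329276696936328339737395191741151413),
  (0x2010040003010000, 1541949599614375831959414383818581314879774412928283641151437386936292821922181576557174864492928282119967449794719311593316313711829212172282726196238853854486564642921287668214984499774656536866329282821269246),
  (0x1002000040009010000, 1541914351318195747381441396969362921219621399636292126216596652921362154475385131441496565369663292125921921364838371517583815174314811349191987796436292126269696924619541317578779171413938663462621212154365749393814191581137583696464693638433743387448656464766846262128929262),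
  (0x2020040801010000, 15462138113711851494141744864622619329696322619383839465417322949952527471917181898813241584828294925191818417939323215132637463621184946372726293928587275487443191817185457655992574619181796494936944387748415132118386979948229623938988354393926463619181754541774431917175719364643474774151314),
  (0x800002000044001010000, 15421852685484939292727262819213535392625211921256564643232199257393213646363268686369881211548859885494874431915171718138527762726258528572964962526868628582182154352151572745482581758865815151728132115435336191717156521171752275785582813181421621585524781936562136363639849879828286462626336766846),
  (0x1002020000808010000, 1216596633286696546463983393131367473734717145832493929263649363926292824582576764739731914151517515765583926292818195839262829191817364649254837475759985952522486652628982948242519181818755875181717731532411759494826286949262854259224191818751717574736323737736518744874181515737474497437191515171751571413),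
  (0x800010040003020000, 12119218229762147539369933975473737292121155359494847393715185958494737391815145361611998197686692921266557271965377543688484494737745728272782929272),
  (0x804000040005020000, 1196597877229572128499648851383497676377657577929282127437341299541434384497473213114131521511951855929212574727257374116593835252928181515631669866146414821961916136846489441492116654646161329957473735757374792),
  (0x800020040801020000, 15858624819181818362646191816411573381954163828272729291816813646949265573721166337644859393729252627284847956436191615329479947387748413213184389326272826262728191616158484382118544638498446161515189883311314),
  (0x808000041001020000, 12119745221822116287574877976762754489881682939954119644616656527157559292626212193811581848283839773329265473229161548382739494793313938274737573258835828481918181832766262282646191816411543394327374332544858732743475849373947292725358728851916283583161615846976681413),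
  (0x810000440001020000, 143211958383628272939591916829265575838393525282729191616181869766813494343144748193253977565571615151313981949489414142186696813577957768787434898494741),
  (0x800030000802020000, 165515819134349482947373926272836141313329883633814131698195958512147545463375151131557),
  (0x808010001002020000, 12165321969925973733847472728833118387339595854431984414782293219833938595415375735973939573785595818581898866884841814141659589885655751431864262632273795833519181451161513),
  (0x804020000804020000, 121546454811528243118641673696376654898816554745959295737696464411663381839386338399883191815411841147668465468399839366563191818183998396437364619181631163227325857281816317668143665586519181814766851161513),
  (0x200008000041001040000, 1577365574719171748176117164115322187727282843932321337322626272841153219611647728229273213378339382193329343135849438484481916544395546416939696924748214776621616494141471328584884697668211517436868587448371917155449543869941917171515161314),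
  (0x208000200040001040000, 1133747172549484746373839352625627372191313611716411541499849417448211949483839353629261615939276727271711721694849363839165425192919212828136558584939292619171615253538374858722868274721211616487448364627266138873887287643949449614859547646694641844961485843744346191717155415549797279225938253313137354615865965435452766894511314),
  (0x200008010001002040000, 12113356574766869415932395848543558381751571365322749242646191417383929278359583757431773322668283838323519171413511621431717477647287437313173395453533821424929191727492729171916265437391468483883594885855338581315),
  (0x202000010002002040000, 1652113165432434346271916167171511357655358192492927227615958535117514317761775755131715721327662823231318328534339433131961939438336699487795459385343766131313854538559584335325447541716161941199539323131354354841919698232313138595435355151531315),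
  (0x200010010400002040000, 132193841194187488429282841212849744994292821151492977241471541322117212795434115144384373737137114196186692921212828218669292128655827482421383854155813168554285421573937151929211417357627493828828584355996515116435484382982868658267668),
  (0x204000010800002040000, 113735762276228584882464926571913988537275719131317511654462843384368292892264624464372282726464324481941413254482636288559586994191717131354733835131327241697593754499541153228543292264249858538282884264242843828587668211594399419152113172126682671135838486929262821272414),
  (0x200004020000804040000, 1216493375485545859396416693776164769594847272924191717575816393131378383387668171432255828383832766819146117576542747419141647599257195165952769936519171765571917171451161513),
  (0x200008020001800040000, 121313998393198847661323183393813),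
  (0x200010020400800040000, 1215843628449591669385832852838584876683994959369361917175116151761171641151413)]

/-- The positions of the vertices of the twenty surfaces, two hexadecimal digits for each
coordinate. -/
def surfacePoints : List ℕ := [
  0x222b1c2e23271632181304310e3538341319211522163a033606141b2522,
  0x3919342d1b2902022837382f2219252e1e072d1b282e2025241923170e20,
  0xf231037313616112e0d15120d0b17063300341f2a3b021121071308360f,
  0x250613173517171e291e1f16161a2e2c2a2d1225343a352f2e0c1f060438,
  0x21141c2a0c121e0d18262f392f330f242b2406090f25083a160f160f1a2b,
  0x26182c170602301f390b0f3a1d091023051b1c0b1c38051831071d160f16,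
  0x1012391b3c01000b0315131215161117171315150f201a140c0e1e290d0f,
  0x2c343410361e083c14210d121633243338181d2922212e2e2d161e00292d,
  0x90d00171b1b392d3b1e2512390a0d0308281514270a3c0213132c151426,
  0x17190c1d13341e16332318180800062e0d170e350e2a302e36250823180f,
  0x3c091e242521261c1926201a29191a261b0d2905220d330e1004122d0327,
  0xf251a2d133b09251102052123142f3217241a0f10042e0d2e0501111b14,
  0x1e1d0e3c0125181f331f22231d211817312c1924081f1f2618212b013130,
  0x250b2b170435092e3a0f2109141b24221b0a3b002e00312b0f262f25142f,
  0x3738351f1e25022b3a1d2426060f311725322015291b2816172b061f1925,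
  0x171a192c2a09072b052a13021126130d240c393b251321170a17211e2a12,
  0x25202229141c340f082c1232291627052f0e2b181c261c1a3327221c1818,
  0x1e241c3002321825011f231923171e3c3a3a0614131d1e2121261d2f202b,
  0x220e16251b191b160237023b1206123a0f121424280e2c2a1e1f212b0e1d,
  0x152e2807361523140d1f1c13162c271326231825200d25391a2f202e3429]

/-! ### The rotation system of an oriented surface -/

theorem Finset.card_triple_eq_three {V : Type*} [DecidableEq V] {a b c : V} :
    ({a, b, c} : Finset V).card = 3 ↔ a ≠ b ∧ a ≠ c ∧ b ≠ c := by
  constructor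
  · intro h
    refine ⟨?_, ?_, ?_⟩ <;> rintro rfl
    · rw [Finset.insert_eq_of_mem (by simp)] at h
      have := Finset.card_le_two (a := a) (b := c); omega
    · rw [Finset.insert_eq_of_mem (by simp)] at h
      have := Finset.card_le_two (a := b) (b := a); omega
    · rw [Finset.pair_eq_singleton] at h
      have := Finset.card_le_two (a := a) (b := b); omega
  · rintro ⟨h1, h2, h3⟩
    exact Finset.card_eq_three.2 ⟨a, b, c, h1, h2, h3, rfl⟩

theorem Finset.triple_rot {V : Type*} [DecidableEq V] (a b c : V) :
    ({b, c, a} : Finset V) = {a, b, c} := by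
  ext x; simp; tauto

theorem Finset.triple_swap {V : Type*} [DecidableEq V] (a b c : V) :
    ({b, a, c} : Finset V) = {a, b, c} := by
  ext x; simp; tauto

/-- `T a b c` says that `abc` is a positively oriented triangle of a closed oriented surface. -/
structure IsRotationSystem {V : Type*} (T : V → V → V → Prop) : Prop where
  ne : ∀ {a b c}, T a b c → a ≠ b
  rot : ∀ {a b c}, T a b c → T b c a
  unique : ∀ {a b c d}, T a b c → T a b d → c = d
  opp : ∀ {a b c}, T a b c → ∃ d, T b a d
  asymm : ∀ {a b c}, T a b c → ¬ T b a c
  link_trans : ∀ {a b c} (P : V → Prop), T a b c → P b → (∀ x y, T a x y → P x → P y) →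
    ∀ {x y}, T a x y → P x

namespace IsRotationSystem

variable {V : Type*} {T : V → V → V → Prop}

theorem ne₂ (hT : IsRotationSystem T) {a b c : V} (h : T a b c) : b ≠ c := hT.ne (hT.rot h)

theorem ne₃ (hT : IsRotationSystem T) {a b c : V} (h : T a b c) : a ≠ c :=
  (hT.ne₂ (hT.rot h)).symm

theorem injective (hT : IsRotationSystem T) {a b c d : V} (h : T a c b) (h' : T a d b) : c = d :=
  hT.unique (hT.rot (hT.rot h)) (hT.rot (hT.rot h'))

/-- The rotation system of the surface with the opposite orientation. -/
theorem reverse [Finite V] (hT : IsRotationSystem T) : IsRotationSystem fun a b c => T b a c where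
  ne h := (hT.ne h).symm
  rot h := hT.rot (hT.rot h)
  unique h h' := hT.unique h h'
  opp h := hT.opp h
  asymm h := hT.asymm h
  link_trans {a b c} P h hb hP {x y} hxy := by
    obtain ⟨c', hc'⟩ := hT.opp h
    obtain ⟨y', hy'⟩ := hT.opp hxy
    let N := {w : V // ∃ z, T a w z}
    have hF : ∀ w : N, ∃ z : N, T a w.1 z.1 := by
      rintro ⟨w, z, hz⟩
      obtain ⟨u, hu⟩ := hT.opp (hT.rot (hT.rot hz))
      exact ⟨⟨z, u, hu⟩, hz⟩
    choose F hF using hF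
    have hinj : Function.Injective F := by
      intro u v huv
      have h1 := hF u
      rw [huv] at h1
      exact Subtype.ext (hT.injective h1 (hF v))
    refine hT.link_trans P hc' hb ?_ hy'
    intro u v huv hu
    let u' : N := ⟨u, v, huv⟩
    -- The rotation is an injection of the finite set of neighbours, so `u'` returns to itself after
    -- `n` turns. Walking `n - 1` steps back from `F^[n] u' = u'` reaches `F u'`; so a property kept
    -- by the inverse rotation is kept by the rotation.
    obtain ⟨n, hn, hper⟩ := Function.Injective.mem_periodicPts hinj u'
    have hiter : ∀ k, k ≤ n → P (F^[n - k] u').1 := by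
      intro k
      induction k with
      | zero => intro _; rw [Nat.sub_zero, hper.eq]; exact hu
      | succ k ih =>
        intro hk
        have h1 := ih (by omega)
        rw [show n - k = (n - (k + 1)) + 1 by omega, Function.iterate_succ_apply'] at h1
        exact hP _ _ (hT.rot (hT.rot (hF _))) h1
    have h2 := hiter (n - 1) (by omega)
    rw [show n - (n - 1) = 1 by omega, Function.iterate_one] at h2
    rw [hT.unique huv (hF u')]
    exact h2

end IsRotationSystem

/-! ### The rotation system of a closed orientable complex -/

namespace AbstractSimplicialComplex

variable {V : Type*} {K : AbstractSimplicialComplex V}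

theorem mem_of_subset {s t : Finset V} (hs : s ∈ K) (hts : t ⊆ s) (ht : t.Nonempty) : t ∈ K :=
  (K.isRelLowerSet_faces hs).2 hts ht

theorem nonempty_of_mem {s : Finset V} (hs : s ∈ K) : s.Nonempty :=
  (K.isRelLowerSet_faces hs).1

variable [DecidableEq V]

/-- The oriented triangles `T` are those of the complex `K`. -/
structure CarriedBy (K : AbstractSimplicialComplex V) (T : V → V → V → Prop) : Prop where
  isRotationSystem : IsRotationSystem T
  mem_iff : ∀ {a b c}, a ≠ b → a ≠ c → b ≠ c → (({a, b, c} : Finset V) ∈ K ↔ T a b c ∨ T b a c)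
  exists_tri : ∀ {a b}, a ≠ b → ({a, b} : Finset V) ∈ K → ∃ c, T a b c

theorem CarriedBy.mem_of_tri {T : V → V → V → Prop} (h : K.CarriedBy T) {a b c : V}
    (ht : T a b c) : ({a, b, c} : Finset V) ∈ K :=
  (h.mem_iff (h.isRotationSystem.ne ht) (h.isRotationSystem.ne₃ ht)
    (h.isRotationSystem.ne₂ ht)).2 (Or.inl ht)

theorem CarriedBy.pair_mem_iff {T : V → V → V → Prop} (h : K.CarriedBy T) {a b : V}
    (hab : a ≠ b) : ({a, b} : Finset V) ∈ K ↔ ∃ c, T a b c := by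
  refine ⟨h.exists_tri hab, fun ⟨c, hc⟩ => mem_of_subset (h.mem_of_tri hc) ?_ (by simp)⟩
  intro x; simp; tauto

theorem CarriedBy.reverse [Finite V] {T : V → V → V → Prop} (h : K.CarriedBy T) :
    K.CarriedBy fun a b c => T b a c where
  isRotationSystem := h.isRotationSystem.reverse
  mem_iff h1 h2 h3 := by rw [h.mem_iff h1 h2 h3, or_comm]
  exists_tri {a b} hab hK := h.exists_tri hab.symm (by rwa [Finset.pair_comm])

variable [Fintype V]

theorem IsClosedSurface.exists_two (hK : K.IsClosedSurface) {a b : V} (hab : a ≠ b)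
    (h : ({a, b} : Finset V) ∈ K) : ∃ x y, x ≠ y ∧
      ∀ z, (a ≠ z ∧ b ≠ z ∧ ({a, b, z} : Finset V) ∈ K) ↔ z = x ∨ z = y := by
  have h2 := hK.link_two_regular a ⟨b, hab.symm, h⟩
  obtain ⟨x, y, hxy, hset⟩ := Set.ncard_eq_two.1 h2
  refine ⟨x.1, y.1, fun h => hxy (Subtype.ext h), fun z => ?_⟩
  constructor
  · rintro ⟨h1, h3, h4⟩
    have hz : ({a, z} : Finset V) ∈ K := mem_of_subset h4 (by intro x; simp; tauto) (by simp)
    have : (⟨z, h1.symm, hz⟩ : {w : V // w ≠ a ∧ ({a, w} : Finset V) ∈ K}) ∈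
        (K.linkGraph a).neighborSet ⟨b, hab.symm, h⟩ :=
      ⟨fun he => h3 (congrArg Subtype.val he), h4⟩
    rw [hset] at this
    rcases this with h5 | h5
    · exact Or.inl (congrArg Subtype.val h5)
    · exact Or.inr (congrArg Subtype.val h5)
  · have key : ∀ w ∈ (K.linkGraph a).neighborSet ⟨b, hab.symm, h⟩,
        a ≠ w.1 ∧ b ≠ w.1 ∧ ({a, b, w.1} : Finset V) ∈ K := by
      intro w hw
      exact ⟨w.2.1.symm, fun he => hw.1 (Subtype.ext he), hw.2⟩
    rw [hset] at key
    rintro (rfl | rfl)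
    · exact key x (by simp)
    · exact key y (by simp)

/-- The relation consists of the triangles that the orientation `O` makes positive. Of the two
triangles at an edge, coherence makes exactly one positive for each direction of the edge; this
gives existence and uniqueness of the third vertex. Connectedness of the link becomes transitivity
of the rotation. -/
theorem IsClosedSurface.exists_carriedBy (hK : K.IsClosedSurface) (hO : K.Orientable) :
    ∃ T : V → V → V → Prop, K.CarriedBy T := by
  obtain ⟨O, hrot, hor, hadj⟩ := hO
  let T : V → V → V → Prop := fun a b c =>
    (a ≠ b ∧ a ≠ c ∧ b ≠ c) ∧ ({a, b, c} : Finset V) ∈ K ∧ O a b c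
  have card : ∀ {a b c : V}, (a ≠ b ∧ a ≠ c ∧ b ≠ c) → ({a, b, c} : Finset V).card = 3 :=
    fun h => Finset.card_triple_eq_three.2 h
  have Trot : ∀ {a b c}, T a b c → T b c a := by
    rintro a b c ⟨⟨h1, h2, h3⟩, h4, h5⟩
    exact ⟨⟨h3, h1.symm, h2.symm⟩, by rwa [Finset.triple_rot], hrot _ _ _ h5⟩
  have Tuniq : ∀ {a b c d}, T a b c → T a b d → c = d := by
    rintro a b c d ⟨h1, h2, h3⟩ ⟨h4, h5, h6⟩
    by_contra hcd
    have := (hadj a b c d h2 (card h1) h5 (card h4) hcd).1 h3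
    exact (hor a b d h5 (card h4)).1 h6 this
  have Tex : ∀ {a b}, a ≠ b → ({a, b} : Finset V) ∈ K → ∃ c, T a b c := by
    intro a b hab h
    obtain ⟨x, y, hxy, hz⟩ := hK.exists_two hab h
    obtain ⟨x1, x2, x3⟩ := (hz x).2 (Or.inl rfl)
    obtain ⟨y1, y2, y3⟩ := (hz y).2 (Or.inr rfl)
    by_cases hx : O a b x
    · exact ⟨x, ⟨hab, x1, x2⟩, x3, hx⟩
    · refine ⟨y, ⟨hab, y1, y2⟩, y3, ?_⟩
      rw [hadj a b x y x3 (card ⟨hab, x1, x2⟩) y3 (card ⟨hab, y1, y2⟩) hxy] at hx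
      exact (hor a b y y3 (card ⟨hab, y1, y2⟩)).2 hx
  have Tmem : ∀ {a b c}, a ≠ b → a ≠ c → b ≠ c →
      (({a, b, c} : Finset V) ∈ K ↔ T a b c ∨ T b a c) := by
    intro a b c h1 h2 h3
    constructor
    · intro h
      by_cases hx : O a b c
      · exact Or.inl ⟨⟨h1, h2, h3⟩, h, hx⟩
      · right
        refine ⟨⟨h1.symm, h3, h2⟩, by rwa [Finset.triple_swap], ?_⟩
        have := hor a b c h (card ⟨h1, h2, h3⟩)
        tauto
    · rintro (h | h)
      · exact h.2.1
      · rw [Finset.triple_swap]; exact h.2.1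
  have pair : ∀ {a b c}, T a b c → ({a, b} : Finset V) ∈ K := fun h =>
    mem_of_subset h.2.1 (by intro x; simp; tauto) (by simp)
  refine ⟨T, ⟨fun h => h.1.1, Trot, Tuniq, ?_, ?_, ?_⟩, Tmem, Tex⟩
  · intro a b c h
    exact Tex h.1.1.symm (by rw [Finset.pair_comm]; exact pair h)
  · rintro a b c h h'
    exact (hor a b c h.2.1 (card h.1)).1 h.2.2 h'.2.2
  · intro v b c P h hb hP x y hxy
    let N := {w : V // w ≠ v ∧ ({v, w} : Finset V) ∈ K}
    have hF : ∀ w : N, ∃ z : N, T v w.1 z.1 := by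
      rintro ⟨w, hw1, hw2⟩
      obtain ⟨z, hz⟩ := Tex hw1.symm hw2
      exact ⟨⟨z, hz.1.2.1.symm, by rw [Finset.pair_comm]; exact pair (Trot (Trot hz))⟩, hz⟩
    choose F hF using hF
    have hinj : Function.Injective F := by
      intro u w huw
      have h1 := hF u
      rw [huw] at h1
      exact Subtype.ext (Tuniq (Trot (Trot h1)) (Trot (Trot (hF w))))
    -- A path in the link may use its edges in both directions, while `P` is known to propagate only
    -- forwards. The rotation permutes a finite set, so a step backwards is an iterate of steps
    -- forwards.
    have back : ∀ u : N, P (F u).1 → P u.1 := by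
      intro u hu
      obtain ⟨n, hn, hper⟩ := Function.Injective.mem_periodicPts hinj u
      have hiter : ∀ k, P (F^[k + 1] u).1 := by
        intro k
        induction k with
        | zero => exact hu
        | succ k ih =>
          rw [Function.iterate_succ_apply']
          exact hP _ _ (hF _) ih
      have := hiter (n - 1)
      rwa [show n - 1 + 1 = n by omega, hper.eq] at this
    have hreach := (hK.link_connected v).preconnected ⟨b, h.1.1.symm, pair h⟩
      ⟨x, hxy.1.1.symm, pair hxy⟩
    rw [SimpleGraph.reachable_iff_reflTransGen] at hreach
    have : ∀ z : N, Relation.ReflTransGen (K.linkGraph v).Adj ⟨b, h.1.1.symm, pair h⟩ z →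
        P z.1 := by
      intro z hz
      induction hz with
      | refl => exact hb
      | tail _ hadj' ih =>
        rename_i y z _
        rcases (Tmem y.2.1.symm z.2.1.symm (fun he => hadj'.1 (Subtype.ext he))).1 hadj'.2
          with h1 | h1
        · exact hP _ _ (Trot (Trot (Trot h1))) ih
        · apply back z
          rw [Tuniq (hF z) (Trot h1)]
          exact ih
    exact this _ hreach

/-! ### Counting faces -/

theorem faceCount_eq {V : Type*} [Finite V] (K : AbstractSimplicialComplex V) (k : ℕ) :
    ∃ s : Finset (Finset V),
    s.card = K.faceCount k ∧ ∀ t, t ∈ s ↔ t ∈ K ∧ t.card = k := by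
  classical
  refine ⟨(Set.toFinite {s : Finset V | s ∈ K ∧ s.card = k}).toFinset, ?_, by simp⟩
  rw [faceCount, Set.ncard_eq_toFinset_card _]

theorem faceCount_one {V : Type*} [Fintype V] (K : AbstractSimplicialComplex V) :
    K.faceCount 1 = Fintype.card V := by
  obtain ⟨s, hs, hs'⟩ := K.faceCount_eq 1
  rw [← hs, ← Finset.card_univ, ← Nat.choose_one_right (Finset.univ : Finset V).card,
    ← Finset.card_powersetCard]
  congr 1
  ext t
  rw [hs', Finset.mem_powersetCard]
  refine ⟨fun h => ⟨Finset.subset_univ _, h.2⟩, fun h => ⟨?_, h.2⟩⟩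
  obtain ⟨v, rfl⟩ := Finset.card_eq_one.1 h.2
  exact K.singleton_mem v

/-- Incident pairs of an edge and a triangle are counted in two ways: two triangles at each edge,
three edges in each triangle. -/
theorem IsClosedSurface.two_mul_faceCount_two (hK : K.IsClosedSurface) :
    K.faceCount 2 * 2 = K.faceCount 3 * 3 := by
  classical
  obtain ⟨E, hE, hE'⟩ := K.faceCount_eq 2
  obtain ⟨F, hF, hF'⟩ := K.faceCount_eq 3
  rw [← hE, ← hF]
  apply Finset.card_mul_eq_card_mul (fun e f => e ⊆ f)
  · intro e he
    obtain ⟨heK, hec⟩ := (hE' e).1 he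
    obtain ⟨a, b, hab, rfl⟩ := Finset.card_eq_two.1 hec
    obtain ⟨x, y, hxy, hz⟩ := hK.exists_two hab heK
    obtain ⟨x1, x2, x3⟩ := (hz x).2 (Or.inl rfl)
    obtain ⟨y1, y2, y3⟩ := (hz y).2 (Or.inr rfl)
    have : F.bipartiteAbove (fun e f => e ⊆ f) {a, b} = {{a, b, x}, {a, b, y}} := by
      ext f
      rw [Finset.mem_bipartiteAbove, hF']
      simp only [Finset.mem_insert, Finset.mem_singleton]
      constructor
      · rintro ⟨⟨hfK, hfc⟩, hsub⟩
        obtain ⟨z, hz1, hz2⟩ : ∃ z, z ∉ ({a, b} : Finset V) ∧ insert z {a, b} = f := by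
          have := Finset.exists_eq_insert_iff.2 ⟨hsub, by rw [hec, hfc]⟩
          obtain ⟨z, hz1, hz2⟩ := this
          exact ⟨z, hz1, hz2⟩
        have hz3 : f = {a, b, z} := by rw [← hz2]; ext; simp; tauto
        simp only [Finset.mem_insert, Finset.mem_singleton, not_or] at hz1
        subst hz3
        rcases (hz z).1 ⟨fun h => hz1.1 h.symm, fun h => hz1.2 h.symm, hfK⟩ with rfl | rfl
        · exact Or.inl rfl
        · exact Or.inr rfl
      · rintro (rfl | rfl)
        · exact ⟨⟨x3, Finset.card_triple_eq_three.2 ⟨hab, x1, x2⟩⟩, by intro x; simp; tauto⟩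
        · exact ⟨⟨y3, Finset.card_triple_eq_three.2 ⟨hab, y1, y2⟩⟩, by intro x; simp; tauto⟩
    rw [this, Finset.card_pair]
    intro h
    have : x ∈ ({a, b, y} : Finset V) := h ▸ (by simp)
    simp only [Finset.mem_insert, Finset.mem_singleton] at this
    rcases this with h | h | h
    · exact x1 h.symm
    · exact x2 h.symm
    · exact hxy h
  · intro f hf
    obtain ⟨hfK, hfc⟩ := (hF' f).1 hf
    have : E.bipartiteBelow (fun e f => e ⊆ f) f = f.powersetCard 2 := by
      ext e
      rw [Finset.mem_bipartiteBelow, hE', Finset.mem_powersetCard]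
      constructor
      · rintro ⟨⟨_, h1⟩, h2⟩; exact ⟨h2, h1⟩
      · rintro ⟨h1, h2⟩
        exact ⟨⟨mem_of_subset hfK h1 (Finset.card_pos.1 (by omega)), h2⟩, h1⟩
    rw [this, Finset.card_powersetCard, hfc]
    rfl

/-- The number of triangles is eliminated between the double count and the Euler characteristic. -/
theorem Triangulates.faceCount_two {g : ℕ} (hK : K.Triangulates g) :
    (K.faceCount 2 : ℤ) = 3 * (Fintype.card V + 2 * g - 2) := by
  have h1 := hK.isClosedSurface.two_mul_faceCount_two
  have h2 := hK.eulerChar_eq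
  rw [eulerChar, faceCount_one] at h2
  omega

/-- The number of pairs of vertices that are not edges. -/
theorem exists_nonEdges {V : Type*} [Fintype V] (K : AbstractSimplicialComplex V) :
    ∃ s : Finset (Finset V),
    s.card + K.faceCount 2 = (Fintype.card V).choose 2 ∧
      ∀ t, t ∈ s ↔ t ∉ K ∧ t.card = 2 := by
  classical
  obtain ⟨E, hE, hE'⟩ := K.faceCount_eq 2
  refine ⟨Finset.univ.powersetCard 2 \ E, ?_, ?_⟩
  · rw [← hE, Finset.card_sdiff_add_card_eq_card, Finset.card_powersetCard, Finset.card_univ]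
    intro t ht
    simp [((hE' t).1 ht).2]
  · intro t
    rw [Finset.mem_sdiff, hE']
    simp
    tauto

/-- The `3 (n + 4)` edges must fit among the `n (n - 1) / 2` pairs; already for `n = 9` this would
need `39 ≤ 36`. -/
theorem Triangulates.ten_le_card (hK : K.Triangulates 3) : 10 ≤ Fintype.card V := by
  obtain ⟨s, hs, _⟩ := K.exists_nonEdges
  have h1 := hK.faceCount_two
  have h2 : (Fintype.card V).choose 2 * 2 = Fintype.card V * (Fintype.card V - 1) := by
    rw [Nat.choose_two_right]
    exact Nat.div_mul_cancel (Nat.even_mul_pred_self _).two_dvd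
  by_contra hlt
  have : Fintype.card V < 10 := by omega
  interval_cases Fintype.card V <;> omega

end AbstractSimplicialComplex

/-! ### Labellings with a vertex that is adjacent to all others -/

namespace AbstractSimplicialComplex

variable {V : Type*} [Fintype V] [DecidableEq V] {K : AbstractSimplicialComplex V}

/-- The labelling `e` of the vertices of a surface with oriented triangles `R` gives the label
zero to a vertex whose link is the cycle of the other labels in their natural order. -/
structure IsLabelling (K : AbstractSimplicialComplex V) (R : V → V → V → Prop)
    (e : Fin 10 ≃ V) : Prop where
  carriedBy : K.CarriedBy R
  base : ∀ i : Fin 9, R (e 0) (e i.succ) (e (i + 1).succ)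

/-- There are 45 pairs and `3 (10 + 4) = 42` edges. -/
theorem Triangulates.nonEdges_card_eq_three (hK : K.Triangulates 3) (hV : Fintype.card V = 10) :
    ∃ s : Finset (Finset V), s.card = 3 ∧ ∀ t, t ∈ s ↔ t ∉ K ∧ t.card = 2 := by
  obtain ⟨s, hs, hs'⟩ := K.exists_nonEdges
  have h1 := hK.faceCount_two
  rw [hV] at h1 hs
  rw [show Nat.choose 10 2 = 45 from rfl] at hs
  exact ⟨s, by omega, hs'⟩

/-- Otherwise the three non-edges would cover all ten vertices, but they cover at most six. -/
theorem Triangulates.exists_universal_vertex (hK : K.Triangulates 3) (hV : Fintype.card V = 10) :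
    ∃ v, ∀ w, w ≠ v → ({v, w} : Finset V) ∈ K := by
  obtain ⟨s, hs, hs'⟩ := hK.nonEdges_card_eq_three hV
  by_contra! h
  have hsub : (Finset.univ : Finset V) ⊆ s.biUnion id := by
    intro v _
    obtain ⟨w, hw, hvw⟩ := h v
    exact Finset.mem_biUnion.2 ⟨{v, w}, (hs' _).2 ⟨hvw, Finset.card_pair hw.symm⟩, by simp⟩
  have h1 := Finset.card_le_card hsub
  have h2 : (s.biUnion id).card ≤ s.card * 2 :=
    Finset.card_biUnion_le_card_mul _ _ _ fun t ht => ((hs' t).1 ht).2.le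
  rw [Finset.card_univ, hV] at h1
  omega

/-- The rotation at a universal vertex is a single 9-cycle; its iterates, applied to any starting
neighbour, label the link. -/
theorem Triangulates.exists_isLabelling (hK : K.Triangulates 3) (hV : Fintype.card V = 10) :
    ∃ R e, K.IsLabelling R e := by
  obtain ⟨R, hR⟩ := hK.isClosedSurface.exists_carriedBy hK.orientable
  have hrot := hR.isRotationSystem
  obtain ⟨v, hv⟩ := hK.exists_universal_vertex hV
  let N := {w : V // w ≠ v}
  have hcard : Fintype.card N = 9 := by
    rw [Fintype.card_subtype_compl, hV, Fintype.card_subtype_eq]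
  have hF : ∀ w : N, ∃ z : N, R v w.1 z.1 := by
    rintro ⟨w, hw⟩
    obtain ⟨z, hz⟩ := hR.exists_tri hw.symm (hv w hw)
    exact ⟨⟨z, (hrot.ne₃ hz).symm⟩, hz⟩
  choose F hF using hF
  have hinj : Function.Injective F := by
    intro u w huw
    have h1 := hF u
    rw [huw] at h1
    exact Subtype.ext (hrot.injective h1 (hF w))
  let σ : Equiv.Perm N := Equiv.ofBijective F (Finite.injective_iff_bijective.1 hinj)
  have hσ : ∀ w : N, R v w.1 (σ w).1 := hF
  have hcyc : σ.IsCycleOn (Finset.univ : Finset N) := by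
    refine ⟨by simp [Set.bijOn_univ], fun x _ y _ => ?_⟩
    -- Transitivity is obtained by taking for the property "in the same cycle of `σ` as `x`".
    have := hrot.link_trans (fun z => ∃ w : N, w.1 = z ∧ σ.SameCycle x w) (hσ x) ⟨x, rfl, .refl _ _⟩
      ?_ (hσ y)
    · obtain ⟨w, hw, hxw⟩ := this
      rwa [Subtype.ext hw] at hxw
    · rintro a b hab ⟨w, rfl, hw⟩
      exact ⟨σ w, hrot.unique (hσ w) hab, hw.apply_right⟩
  obtain ⟨w0⟩ : Nonempty N := Fintype.card_pos_iff.1 (by omega)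
  let f : Fin 10 → V := Fin.cons v fun i : Fin 9 => ((σ ^ (i : ℕ)) w0).1
  have hsurj : Function.Surjective f := by
    intro x
    by_cases hx : x = v
    · exact ⟨0, hx.symm⟩
    · obtain ⟨n, hn, hn'⟩ := hcyc.exists_pow_eq (Finset.mem_univ w0) (Finset.mem_univ ⟨x, hx⟩)
      rw [Finset.card_univ, hcard] at hn
      exact ⟨Fin.succ ⟨n, hn⟩, congrArg Subtype.val hn'⟩
  have hbij : Function.Bijective f :=
    (Fintype.bijective_iff_surjective_and_card f).2 ⟨hsurj, by rw [hV, Fintype.card_fin]⟩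
  refine ⟨R, Equiv.ofBijective f hbij, hR, fun i => ?_⟩
  -- This closes the link: for `i = 8` the sum `i + 1` in `Fin 9` wraps around to zero.
  have h9 : (σ ^ 9) w0 = w0 := by
    rw [hcyc.pow_apply_eq (Finset.mem_univ _), Finset.card_univ, hcard]
  have hi : (σ ^ ((i + 1 : Fin 9) : ℕ)) w0 = σ ((σ ^ (i : ℕ)) w0) := by
    rw [← Equiv.Perm.mul_apply, ← pow_succ', Fin.val_add]
    by_cases h8 : (i : ℕ) = 8
    · rw [h8]; exact h9.symm
    · rw [Nat.mod_eq_of_lt (by have := i.isLt; simp; omega)]; rfl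
  change R v ((σ ^ (i : ℕ)) w0).1 ((σ ^ ((i + 1 : Fin 9) : ℕ)) w0).1
  rw [hi]
  exact hσ _

/-- Relabelling of the link of the vertex with label zero. -/
def linkPerm (π : Equiv.Perm (Fin 9)) : Equiv.Perm (Fin 10) :=
  (finSuccEquiv 9).trans ((Equiv.optionCongr π).trans (finSuccEquiv 9).symm)

theorem linkPerm_zero (π : Equiv.Perm (Fin 9)) : linkPerm π 0 = 0 := by simp [linkPerm]

theorem linkPerm_succ (π : Equiv.Perm (Fin 9)) (i : Fin 9) :
    linkPerm π i.succ = (π i).succ := by simp [linkPerm]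

omit [Fintype V] in
theorem IsLabelling.rotate {R : V → V → V → Prop} {e : Fin 10 ≃ V} (h : K.IsLabelling R e)
    (r : Fin 9) : K.IsLabelling R ((linkPerm (Equiv.addRight r)).trans e) where
  carriedBy := h.carriedBy
  base i := by
    simp only [Equiv.trans_apply, linkPerm_zero, linkPerm_succ, Equiv.coe_addRight]
    rw [add_right_comm]
    exact h.base _

/-- Reading the link backwards reverses the orientation, so the reflected labels belong to the
opposite rotation system, which the same complex also carries. -/
theorem IsLabelling.reflect {R : V → V → V → Prop} {e : Fin 10 ≃ V} (h : K.IsLabelling R e)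
    (r : Fin 9) :
    K.IsLabelling (fun a b c => R b a c) ((linkPerm (Equiv.subLeft r)).trans e) where
  carriedBy := h.carriedBy.reverse
  base i := by
    simp only [Equiv.trans_apply, linkPerm_zero, linkPerm_succ, Equiv.subLeft_apply]
    have := h.base (r - (i + 1))
    rw [show r - (i + 1) + 1 = r - i by abel] at this
    exact h.carriedBy.isRotationSystem.rot (h.carriedBy.isRotationSystem.rot this)

/-- The relation on labels given by a labelling. -/
def labelRel (R : V → V → V → Prop) (e : Fin 10 ≃ V) (a b c : ℕ) : Prop :=
  ∃ x y z : Fin 10, (x : ℕ) = a ∧ (y : ℕ) = b ∧ (z : ℕ) = c ∧ R (e x) (e y) (e z)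

omit [Fintype V] [DecidableEq V] in
theorem labelRel_val (R : V → V → V → Prop) (e : Fin 10 ≃ V) (x y z : Fin 10) :
    labelRel R e x y z ↔ R (e x) (e y) (e z) := by
  constructor
  · rintro ⟨x', y', z', h1, h2, h3, h⟩
    rwa [Fin.ext h1, Fin.ext h2, Fin.ext h3] at h
  · intro h; exact ⟨x, y, z, rfl, rfl, rfl, h⟩

omit [Fintype V] [DecidableEq V] in
theorem orientedRel_labelRel {R : V → V → V → Prop} (hR : IsRotationSystem R) (e : Fin 10 ≃ V) :
    OrientedRel (labelRel R e) where
  lt := by rintro a b c ⟨x, y, z, rfl, rfl, rfl, h⟩; exact x.isLt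
  rot := by
    rintro a b c ⟨x, y, z, rfl, rfl, rfl, h⟩
    exact (labelRel_val ..).2 (hR.rot h)
  unique := by
    rintro a b c d ⟨x, y, z, rfl, rfl, rfl, h⟩ ⟨x', y', z', h1, h2, rfl, h'⟩
    rw [Fin.ext h1, Fin.ext h2] at h'
    rw [e.injective (hR.unique h h')]
  link_trans := by
    rintro a b c P ⟨x, y, z, rfl, rfl, rfl, h⟩ hb hP u v ⟨x', u, v, h1, rfl, rfl, h'⟩
    rw [Fin.ext h1] at h'
    have := hR.link_trans (fun w => P (e.symm w)) h (by simpa using hb) ?_ h'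
    · simpa using this
    · intro s t hst hs
      refine hP (e.symm s) (e.symm t) ((labelRel_val ..).2 ?_) hs
      simpa using hst

end AbstractSimplicialComplex

/-! ### Enumeration of the labelled surfaces -/

/-- The possible missing edges of a labelled surface. -/
def chords : List (ℕ × ℕ) :=
  [(1, 3), (1, 4), (1, 5), (1, 6), (1, 7), (1, 8), (2, 4), (2, 5), (2, 6), (2, 7), (2, 8), (2, 9),
   (3, 5), (3, 6), (3, 7), (3, 8), (3, 9), (4, 6), (4, 7), (4, 8), (4, 9), (5, 7), (5, 8), (5, 9),
   (6, 8), (6, 9), (7, 9)]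

/-- The bit set of the edges in the image of a list under `f`, in both directions. -/
def maskImage (f : ℕ → ℕ) (l : List (ℕ × ℕ)) : ℕ :=
  l.foldr (fun e m => force (f e.1) fun a => force (f e.2) fun b =>
    m ||| (2 ^ (10 * a + b) ||| 2 ^ (10 * b + a))) 0

/-- Rotation of the labels `1, …, 9` by `r`. -/
def rotateLabel (r x : ℕ) : ℕ := (x + r + 8) % 9 + 1

/-- A reflection of the labels `1, …, 9`. -/
def reflectLabel (r x : ℕ) : ℕ := (r + 10 - x) % 9 + 1

/-- Some rotation or reflection of the set of missing edges gives a bit set less than `M`. -/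
def reducible (l : List (ℕ × ℕ)) (M : ℕ) : Bool :=
  [0, 1, 2, 3, 4, 5, 6, 7, 8].any fun r =>
    Nat.blt (maskImage (rotateLabel r) l) M || Nat.blt (maskImage (reflectLabel r) l) M

/-- All pairs of different labels. -/
def allPairs : ℕ := 0x7feffdffbff7feffdffbff7fe

/-- The pairs of different nonzero labels `a`, `b` with `b` not the successor of `a`. -/
def openPairs : ℕ := 0x7f0fe9fb3ee7bcef9bf2fe000

/-- The reversals of `openPairs`. -/
def openPairsRev : ℕ := 0x3fa7ecfb9ef3be6fcbf87f000

/-- The triangles at the vertex with label zero. -/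
def coneTable : ℕ :=
  0x191000000008010000000700100000060001000005000010000400000100030000001002000000010a2a98765430

/-- Check that the surfaces with the set `M` of missing edges are listed in `leafData`. -/
def searchMissing (M ct : ℕ) : Bool :=
  force (allPairs ^^^ M) fun N => force (openPairs ^^^ M) fun U => force (openPairsRev ^^^ M) fun V =>
    (search (leafData.map Prod.fst) N 100 coneTable U V ct).beq 1

/-- There are 2925 triples of chords. Comparing a triple with its images under the dihedral group
leaves only triples with the least bit set in their orbit, and only these need a certificate. -/
theorem missing_cases : ((chords.sublistsLen 3).all fun l => force (maskImage id l) fun M =>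
    reducible l M || certificates.any fun r => r.1.beq M) = true := by
  decide +kernel

/-- Replay of all search trees. Each certificate is consumed from its low end and carries an extra
leading digit 1, which must be all that is left; this also keeps the remainder nonzero as long as
the replay succeeds. -/
theorem searchMissing_certificates :
    (certificates.all fun r => force r.1 fun M => searchMissing M r.2) = true := by
  decide +kernel

/-! ### Missing edges and their behaviour under relabelling -/

namespace AbstractSimplicialComplex

variable {V : Type*}

theorem testBit_maskImage (f : ℕ → ℕ) (l : List (ℕ × ℕ)) (i : ℕ) :
    (maskImage f l).testBit i = true ↔
      ∃ e ∈ l, i = 10 * f e.1 + f e.2 ∨ i = 10 * f e.2 + f e.1 := by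
  induction l with
  | nil => simp [maskImage]
  | cons e l ih =>
    have : maskImage f (e :: l) = maskImage f l |||
        (2 ^ (10 * f e.1 + f e.2) ||| 2 ^ (10 * f e.2 + f e.1)) := by
      simp only [maskImage, List.foldr_cons, force_eq]
    rw [this, Nat.testBit_or, Nat.testBit_or, Nat.testBit_two_pow, Nat.testBit_two_pow,
      Bool.or_eq_true, Bool.or_eq_true, ih, decide_eq_true_eq, decide_eq_true_eq,
      List.exists_mem_cons_iff]
    constructor
    · rintro (h | h | h)
      · exact Or.inr h
      · exact Or.inl (Or.inl h.symm)
      · exact Or.inl (Or.inr h.symm)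
    · rintro ((h | h) | h)
      · exact Or.inr (Or.inl h.symm)
      · exact Or.inr (Or.inr h.symm)
      · exact Or.inl h

/-- The labels `a` and `b` are different, but not adjacent. -/
def NonEdge (R : V → V → V → Prop) (e : Fin 10 ≃ V) (a b : ℕ) : Prop :=
  a < 10 ∧ b < 10 ∧ a ≠ b ∧ ∀ c, ¬ labelRel R e a b c

open Classical in
/-- The pairs of labels that are not edges. -/
noncomputable def missingPairs (R : V → V → V → Prop) (e : Fin 10 ≃ V) : List (ℕ × ℕ) :=
  chords.filter fun p => NonEdge R e p.1 p.2

theorem nonEdge_val {R : V → V → V → Prop} {e : Fin 10 ≃ V} {x y : Fin 10} :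
    NonEdge R e x y ↔ x ≠ y ∧ ∀ z, ¬ R (e x) (e y) z := by
  constructor
  · rintro ⟨_, _, h1, h2⟩
    refine ⟨fun h => h1 (congrArg _ h), fun z hz => h2 (e.symm z) ((labelRel_val ..).2 ?_)⟩
    simpa using hz
  · rintro ⟨h1, h2⟩
    refine ⟨x.isLt, y.isLt, fun h => h1 (Fin.ext h), ?_⟩
    rintro c ⟨x', y', z, hx, hy, rfl, h⟩
    rw [Fin.ext hx, Fin.ext hy] at h
    exact h2 _ h

theorem chords_spec : ∀ a < 10, ∀ b < 10, a < b →
    ((a, b) ∈ chords ∨ a = 0 ∨ b = a + 1 ∨ (a = 1 ∧ b = 9)) := by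
  have : ∀ a b : Fin 10, a < b →
      (((a : ℕ), (b : ℕ)) ∈ chords ∨ a = 0 ∨ (b : ℕ) = a + 1 ∨ (a = 1 ∧ b = 9)) := by
    decide
  intro a ha b hb hab
  simpa [Fin.ext_iff] using this ⟨a, ha⟩ ⟨b, hb⟩ hab

theorem chords_bound : ∀ p ∈ chords, 1 ≤ p.1 ∧ p.1 < p.2 ∧ p.2 < 10 := by
  decide

variable [DecidableEq V] {K : AbstractSimplicialComplex V} {R : V → V → V → Prop} {e : Fin 10 ≃ V}

theorem IsLabelling.base_nat (h : K.IsLabelling R e) {a : ℕ} (h0 : 1 ≤ a) (h9 : a ≤ 9) :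
    labelRel R e 0 a (a % 9 + 1) := by
  refine ⟨0, Fin.succ ⟨a - 1, by omega⟩, _, rfl, by simp; omega, ?_, h.base ⟨a - 1, by omega⟩⟩
  rw [Fin.val_succ, Fin.val_add]
  simp
  omega

theorem NonEdge.symm (h : K.IsLabelling R e) {a b : ℕ} (hab : NonEdge R e a b) :
    NonEdge R e b a := by
  obtain ⟨ha, hb, hne, hn⟩ := hab
  refine ⟨hb, ha, hne.symm, ?_⟩
  rintro c ⟨x, y, z, rfl, rfl, rfl, hc⟩
  obtain ⟨d, hd⟩ := h.carriedBy.isRotationSystem.opp hc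
  exact hn (e.symm d) ((labelRel_val ..).2 (by simpa using hd))

/-- The pairs left out of `chords` are the spokes at label zero and the nine edges of its link, all
of which lie in triangles at label zero. -/
theorem IsLabelling.mem_chords (h : K.IsLabelling R e) {a b : ℕ} (hab : a < b)
    (hn : NonEdge R e a b) : (a, b) ∈ chords := by
  have hR := orientedRel_labelRel h.carriedBy.isRotationSystem e
  obtain ⟨ha, hb, hne, hn⟩ := hn
  rcases chords_spec a ha b hb hab with h1 | h1 | h1 | h1
  · exact h1
  · subst h1
    exact absurd (h.base_nat (by omega) (by omega)) (hn _)
  · by_cases h0 : a = 0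
    · subst h0; exact absurd (h.base_nat (by omega) (by omega)) (hn _)
    · have := hR.rot (h.base_nat (a := a) (by omega) (by omega))
      rw [show a % 9 + 1 = b by omega] at this
      exact absurd this (hn _)
  · have := hR.rot (h.base_nat (a := 9) (by omega) (by omega))
    obtain ⟨rfl, rfl⟩ := h1
    exact absurd this ((NonEdge.symm h ⟨ha, hb, hne, hn⟩).2.2.2 _)

theorem IsLabelling.testBit_image (h : K.IsLabelling R e) (f : ℕ → ℕ) (i : ℕ) :
    (maskImage f (missingPairs R e)).testBit i = true ↔
      ∃ a b, NonEdge R e a b ∧ i = 10 * f a + f b := by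
  classical
  rw [testBit_maskImage]
  simp only [missingPairs, List.mem_filter, decide_eq_true_eq]
  constructor
  · rintro ⟨⟨a, b⟩, ⟨_, h1⟩, h2 | h2⟩
    · exact ⟨a, b, h1, h2⟩
    · exact ⟨b, a, h1.symm h, h2⟩
  · rintro ⟨a, b, h1, rfl⟩
    rcases lt_or_gt_of_ne h1.2.2.1 with h2 | h2
    · exact ⟨(a, b), ⟨h.mem_chords h2 h1, h1⟩, Or.inl rfl⟩
    · exact ⟨(b, a), ⟨h.mem_chords h2 (h1.symm h), h1.symm h⟩, Or.inr rfl⟩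

theorem IsLabelling.testBit_missing (h : K.IsLabelling R e) {a b : ℕ} (hb : b < 10) :
    (maskImage id (missingPairs R e)).testBit (10 * a + b) = true ↔ NonEdge R e a b := by
  rw [h.testBit_image]
  constructor
  · rintro ⟨c, d, h1, h2⟩
    obtain ⟨rfl, rfl⟩ := (index_inj hb h1.2.1).1 h2
    exact h1
  · intro h1; exact ⟨a, b, h1, rfl⟩

/-- Relabelling by `σ` carries the missing pairs along by the inverse of `σ`, which `f` computes. It
need do so only on nonzero labels, because label zero is in no missing pair. Only the edges of `R`
and `R'` have to agree, so that reversal of the orientation is allowed. -/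
theorem IsLabelling.maskImage_eq (h : K.IsLabelling R e) {R' : V → V → V → Prop}
    {σ : Equiv.Perm (Fin 10)} (h' : K.IsLabelling R' (σ.trans e))
    (hR : ∀ x y, (∃ z, R' x y z) ↔ ∃ z, R x y z) {f : ℕ → ℕ}
    (hf : ∀ x : Fin 10, x ≠ 0 → f (σ x) = x) :
    maskImage id (missingPairs R' (σ.trans e)) = maskImage f (missingPairs R e) := by
  have key : ∀ x y : Fin 10, NonEdge R' (σ.trans e) x y ↔ NonEdge R e (σ x) (σ y) := by
    intro x y
    rw [nonEdge_val, nonEdge_val, σ.injective.ne_iff, ← not_exists, ← not_exists, hR]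
    rfl
  have nonzero : ∀ {x y : Fin 10}, NonEdge R' (σ.trans e) x y → x ≠ 0 := by
    rintro x y hxy rfl
    have hne := hxy.2.2.1
    have := h'.base_nat (a := y) (Nat.pos_of_ne_zero hne.symm) (by omega)
    exact hxy.2.2.2 _ this
  apply Nat.eq_of_testBit_eq
  intro i
  rw [Bool.eq_iff_iff, h'.testBit_image, h.testBit_image]
  constructor
  · rintro ⟨a, b, hab, rfl⟩
    lift a to Fin 10 using hab.1
    lift b to Fin 10 using hab.2.1
    refine ⟨σ a, σ b, (key a b).1 hab, ?_⟩
    rw [hf a (nonzero hab), hf b (nonzero (hab.symm h'))]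
    rfl
  · rintro ⟨a, b, hab, rfl⟩
    lift a to Fin 10 using hab.1
    lift b to Fin 10 using hab.2.1
    obtain ⟨a, rfl⟩ := σ.surjective a
    obtain ⟨b, rfl⟩ := σ.surjective b
    have hab' := (key a b).2 hab
    refine ⟨a, b, hab', ?_⟩
    rw [hf a (nonzero hab'), hf b (nonzero (hab'.symm h'))]
    rfl

/-- Labels exceed positions in `Fin 9` by one, and `+ 8` in `rotateLabel` is this `- 1` modulo nine.
The function inverts the rotation of positions by `-r`. -/
theorem rotateLabel_linkPerm (r : Fin 9) (x : Fin 10) (hx : x ≠ 0) :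
    rotateLabel r (linkPerm (Equiv.addRight (-r)) x) = x := by
  obtain ⟨i, rfl⟩ := Fin.exists_succ_eq.2 hx
  rw [linkPerm_succ, Equiv.coe_addRight, rotateLabel]
  have : ((i + -r + r : Fin 9) : ℕ) = i := by rw [neg_add_cancel_right]
  rw [Fin.val_add] at this
  simp only [Fin.val_succ]
  omega

/-- Here `r + 10 - x` is `r - (x - 1)` modulo nine, and a reflection is its own inverse. -/
theorem reflectLabel_linkPerm (r : Fin 9) (x : Fin 10) (hx : x ≠ 0) :
    reflectLabel r (linkPerm (Equiv.subLeft r) x) = x := by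
  obtain ⟨i, rfl⟩ := Fin.exists_succ_eq.2 hx
  rw [linkPerm_succ, Equiv.subLeft_apply, reflectLabel]
  have : ((r - (r - i) : Fin 9) : ℕ) = i := by rw [sub_sub_cancel]
  rw [Fin.val_sub] at this
  simp only [Fin.val_succ]
  have h1 := (r - i).isLt
  have h2 := i.isLt
  omega

/-- A non-edge of the complex corresponds to one pair of labels in increasing order, which is the
form in which `chords` lists it. -/
theorem IsLabelling.length_missingPairs [Fintype V] (hK : K.Triangulates 3)
    (h : K.IsLabelling R e) : (missingPairs R e).length = 3 := by
  classical
  have hV : Fintype.card V = 10 := by simpa using (Fintype.card_congr e).symm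
  obtain ⟨s, hs, hs'⟩ := hK.nonEdges_card_eq_three hV
  have hnd : (missingPairs R e).Nodup := List.Nodup.filter _ (by decide)
  rw [← hs, ← List.toFinset_card_of_nodup hnd]
  have hmem : ∀ p : ℕ × ℕ, p ∈ (missingPairs R e).toFinset ↔
      p.1 < p.2 ∧ NonEdge R e p.1 p.2 := by
    rintro ⟨a, b⟩
    simp only [missingPairs, List.mem_toFinset, List.mem_filter, decide_eq_true_eq]
    exact ⟨fun hp => ⟨(chords_bound _ hp.1).2.1, hp.2⟩, fun hp => ⟨h.mem_chords hp.1 hp.2, hp.2⟩⟩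
  have hpair : ∀ x y : Fin 10, x ≠ y →
      (NonEdge R e x y ↔ ({e x, e y} : Finset V) ∉ K) := by
    intro x y hxy
    rw [nonEdge_val, h.carriedBy.pair_mem_iff (e.injective.ne hxy), not_exists]
    simp [hxy]
  apply Finset.card_bij (fun p _ => ({e (Fin.ofNat 10 p.1), e (Fin.ofNat 10 p.2)} : Finset V))
  · rintro ⟨a, b⟩ hp
    obtain ⟨h1, h2⟩ := (hmem _).1 hp
    lift a to Fin 10 using h2.1
    lift b to Fin 10 using h2.2.1
    have hne : a ≠ b := fun h => absurd h1 (by simp [h])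
    simp only [Fin.ofNat_eq_cast, Fin.cast_val_eq_self]
    exact (hs' _).2 ⟨(hpair a b hne).1 h2, Finset.card_pair (e.injective.ne hne)⟩
  · rintro ⟨a, b⟩ hp ⟨c, d⟩ hq heq
    obtain ⟨h1, h2⟩ := (hmem _).1 hp
    obtain ⟨h3, h4⟩ := (hmem _).1 hq
    lift a to Fin 10 using h2.1
    lift b to Fin 10 using h2.2.1
    lift c to Fin 10 using h4.1
    lift d to Fin 10 using h4.2.1
    simp only [Fin.ofNat_eq_cast, Fin.cast_val_eq_self] at heq
    have heq' : ({e a, e b} : Set V) = {e c, e d} := by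
      simpa using congrArg (fun t : Finset V => (t : Set V)) heq
    rcases Set.pair_eq_pair_iff.1 heq' with ⟨h5, h6⟩ | ⟨h5, h6⟩
    · rw [e.injective h5, e.injective h6]
    · rw [e.injective h5, e.injective h6] at h1
      exact absurd h1 (by simpa using h3.le)
  · intro t ht
    obtain ⟨h1, h2⟩ := (hs' t).1 ht
    obtain ⟨u, v, huv, rfl⟩ := Finset.card_eq_two.1 h2
    obtain ⟨x, rfl⟩ := e.surjective u
    obtain ⟨y, rfl⟩ := e.surjective v
    have hxy : x ≠ y := fun h => huv (congrArg e h)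
    rcases lt_or_gt_of_ne hxy with hlt | hlt
    · refine ⟨((x : ℕ), (y : ℕ)), (hmem _).2 ⟨hlt, (hpair x y hxy).2 h1⟩, by simp⟩
    · refine ⟨((y : ℕ), (x : ℕ)), (hmem _).2 ⟨hlt, (hpair y x hxy.symm).2 ?_⟩, ?_⟩
      · rwa [Finset.pair_comm]
      · simp [Finset.pair_comm]

/-! ### The start of the search -/

/-- The three alternatives are the directed edges leaving label zero, those entering it, and the rim
edges of the nine known triangles. -/
theorem coneTable_spec : ∀ a < 10, ∀ b < 10, entry coneTable (10 * a + b) ≠ 0 →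
    (a = 0 ∧ 1 ≤ b ∧ entry coneTable (10 * a + b) = b % 9 + 1 + 1) ∨
    (b = 0 ∧ 2 ≤ entry coneTable (10 * a + b) ∧ entry coneTable (10 * a + b) ≤ 10 ∧
      a = (entry coneTable (10 * a + b) - 1) % 9 + 1) ∨
    (1 ≤ a ∧ b = a % 9 + 1 ∧ entry coneTable (10 * a + b) = 1) := by
  have : ∀ a b : Fin 10, entry coneTable (10 * a + b) ≠ 0 →
      ((a : ℕ) = 0 ∧ 1 ≤ (b : ℕ) ∧ entry coneTable (10 * a + b) = b % 9 + 1 + 1) ∨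
      ((b : ℕ) = 0 ∧ 2 ≤ entry coneTable (10 * a + b) ∧ entry coneTable (10 * a + b) ≤ 10 ∧
        a = (entry coneTable (10 * a + b) - 1) % 9 + 1) ∨
      (1 ≤ (a : ℕ) ∧ (b : ℕ) = a % 9 + 1 ∧ entry coneTable (10 * a + b) = 1) := by
    decide +kernel
  exact fun a ha b hb => this ⟨a, ha⟩ ⟨b, hb⟩

theorem coneTable_cyc : ∀ a < 10, ∀ b < 10, entry coneTable (10 * a + b) ≠ 0 →
    entry coneTable (10 * b + (entry coneTable (10 * a + b) - 1)) = a + 1 := by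
  decide +kernel

theorem openPairs_spec : ∀ a < 10, ∀ b < 10,
    (openPairs.testBit (10 * a + b) = true → entry coneTable (10 * a + b) = 0 ∧ a ≠ b) ∧
    (a ≠ b → openPairs.testBit (10 * a + b) = false → entry coneTable (10 * a + b) ≠ 0) ∧
    openPairsRev.testBit (10 * a + b) = openPairs.testBit (10 * b + a) ∧
    allPairs.testBit (10 * a + b) = decide (a ≠ b) := by
  decide +kernel

theorem IsLabelling.tri_of_coneTable (h : K.IsLabelling R e) {a b c : ℕ} (ha : a < 10)
    (hb : b < 10) (hc : entry coneTable (10 * a + b) = c + 1) : labelRel R e a b c := by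
  have hR := orientedRel_labelRel h.carriedBy.isRotationSystem e
  have := coneTable_spec a ha b hb (by omega)
  rw [hc] at this
  rcases this with ⟨rfl, h1, h2⟩ | ⟨rfl, h1, h2, h3⟩ | ⟨h1, h2, h3⟩
  · obtain rfl : c = b % 9 + 1 := by omega
    exact h.base_nat h1 (by omega)
  · have := h.base_nat (a := c) (by omega) (by omega)
    rw [show c % 9 + 1 = a by rw [h3]; simp] at this
    exact hR.rot (hR.rot this)
  · obtain rfl : c = 0 := by omega
    rw [h2]
    exact hR.rot (h.base_nat h1 (by omega))

/-- A missing pair is in no known triangle, so both its directions are among the open pairs, and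
exclusive or removes them. What remains are the directed edges that lie in a triangle yet to be
found. -/
theorem IsLabelling.partOf_start (h : K.IsLabelling R e) :
    PartOf (labelRel R e) coneTable (openPairs ^^^ maskImage id (missingPairs R e))
      (openPairsRev ^^^ maskImage id (missingPairs R e)) := by
  have hR := orientedRel_labelRel h.carriedBy.isRotationSystem e
  have hne : ∀ {a b c}, labelRel R e a b c → a ≠ b := by
    rintro a b c ⟨x, y, z, rfl, rfl, rfl, hxyz⟩ hxy
    exact h.carriedBy.isRotationSystem.ne hxyz (by rw [Fin.ext hxy])
  have known : ∀ {a b}, a < 10 → b < 10 → entry coneTable (10 * a + b) ≠ 0 →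
      labelRel R e a b (entry coneTable (10 * a + b) - 1) := fun ha hb h0 =>
    h.tri_of_coneTable ha hb (by omega)
  have bits : ∀ {a b}, a < 10 → b < 10 →
      (openPairs ^^^ maskImage id (missingPairs R e)).testBit (10 * a + b) = true →
      openPairs.testBit (10 * a + b) = true ∧ ¬ NonEdge R e a b := by
    intro a b ha hb hab
    rw [Nat.testBit_xor] at hab
    by_cases hn : NonEdge R e a b
    · rw [(h.testBit_missing hb).2 hn] at hab
      have h0 : openPairs.testBit (10 * a + b) = false := by simpa using hab
      exact absurd (known ha hb ((openPairs_spec a ha b hb).2.1 hn.2.2.1 h0)) (hn.2.2.2 _)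
    · have : (maskImage id (missingPairs R e)).testBit (10 * a + b) = false := by
        rw [← Bool.not_eq_true, h.testBit_missing hb]; exact hn
      rw [this, Bool.xor_false] at hab
      exact ⟨hab, hn⟩
  refine ⟨fun ha hb => h.tri_of_coneTable ha hb, ?_, ?_, ?_, ?_, ?_⟩
  · intro a b c habc hbit
    have ha := hR.lt habc
    have hb := hR.lt₂ habc
    have hn : ¬ NonEdge R e a b := fun hn => hn.2.2.2 _ habc
    have : (maskImage id (missingPairs R e)).testBit (10 * a + b) = false := by
      rw [← Bool.not_eq_true, h.testBit_missing hb]; exact hn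
    rw [Nat.testBit_xor, this, Bool.xor_false] at hbit
    have h0 := (openPairs_spec a ha b hb).2.1 (hne habc) hbit
    rw [hR.unique habc (known ha hb h0)]
    omega
  · intro a b ha hb hbit
    exact ((openPairs_spec a ha b hb).1 (bits ha hb hbit).1).1
  · intro a b ha hb hbit
    obtain ⟨h1, h2⟩ := bits ha hb hbit
    by_contra! h3
    exact h2 ⟨ha, hb, ((openPairs_spec a ha b hb).1 h1).2, h3⟩
  · intro a b c ha hb hc
    have := coneTable_cyc a ha b hb (by omega)
    rwa [hc] at this
  · intro a b ha hb
    rw [Nat.testBit_xor, Nat.testBit_xor, (openPairs_spec a ha b hb).2.2.1]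
    congr 1
    rw [Bool.eq_iff_iff, h.testBit_missing hb, h.testBit_missing ha]
    exact ⟨fun h1 => h1.symm h, fun h1 => h1.symm h⟩

theorem IsLabelling.exists_leaf_of_certificate (h : K.IsLabelling R e) {ct : ℕ}
    (hs : searchMissing (maskImage id (missingPairs R e)) ct = true) :
    ∃ L ∈ leafData.map Prod.fst, ∀ a b c,
      labelRel R e a b c ↔ a < 10 ∧ b < 10 ∧ entry L (10 * a + b) = c + 1 := by
  have hne : ∀ {a b c}, labelRel R e a b c → a ≠ b := by
    rintro a b c ⟨x, y, z, rfl, rfl, rfl, hxyz⟩ hxy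
    exact h.carriedBy.isRotationSystem.ne hxyz (by rw [Fin.ext hxy])
  rw [searchMissing] at hs
  simp only [force_eq] at hs
  refine search_sound (orientedRel_labelRel h.carriedBy.isRotationSystem e) hne
    (N := allPairs ^^^ maskImage id (missingPairs R e)) ?_ (ct := ct) (n := 100) ?_ h.partOf_start
  · intro a x ha hx
    rw [Nat.testBit_xor, (openPairs_spec a ha x hx).2.2.2]
    by_cases hn : NonEdge R e a x
    · rw [(h.testBit_missing hx).2 hn, decide_eq_true hn.2.2.1]
      simpa using hn.2.2.2
    · have : (maskImage id (missingPairs R e)).testBit (10 * a + x) = false := by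
        rw [← Bool.not_eq_true, h.testBit_missing hx]; exact hn
      rw [this, Bool.xor_false, decide_eq_true_eq]
      constructor
      · intro hax
        by_contra! h3
        exact hn ⟨ha, hx, hax, h3⟩
      · rintro ⟨c, hc⟩; exact hne hc
  · intro h0
    rw [h0] at hs
    exact absurd hs (by decide)

variable [Fintype V]

/-- Some labelling of the surface is one of the listed ones. -/
theorem Triangulates.exists_leaf (hK : K.Triangulates 3) (hV : Fintype.card V = 10) :
    ∃ R e, K.IsLabelling R e ∧ ∃ L ∈ leafData.map Prod.fst, ∀ a b c,
      labelRel R e a b c ↔ a < 10 ∧ b < 10 ∧ entry L (10 * a + b) = c + 1 := by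
  classical
  -- Among all labellings one with the least bit set of missing pairs is chosen. No rotation or
  -- reflection can then lower it, which excludes the first alternative of `missing_cases`.
  have hex : ∃ M R e, K.IsLabelling R e ∧ maskImage id (missingPairs R e) = M := by
    obtain ⟨R, e, h⟩ := hK.exists_isLabelling hV
    exact ⟨_, R, e, h, rfl⟩
  obtain ⟨R, e, h, hM⟩ := Nat.find_spec hex
  refine ⟨R, e, h, ?_⟩
  have hmin : ∀ R' e', K.IsLabelling R' e' →
      maskImage id (missingPairs R e) ≤ maskImage id (missingPairs R' e') := by
    intro R' e' h'
    rw [hM]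
    exact Nat.find_min' hex ⟨R', e', h', rfl⟩
  have hsub : missingPairs R e ∈ chords.sublistsLen 3 :=
    List.mem_sublistsLen.2 ⟨List.filter_sublist, h.length_missingPairs hK⟩
  have hcase := List.all_eq_true.1 missing_cases _ hsub
  rw [force_eq, Bool.or_eq_true] at hcase
  rcases hcase with hred | hcert
  · exfalso
    rw [reducible, List.any_eq_true] at hred
    obtain ⟨r, hr, hred⟩ := hred
    have hr9 : r < 9 := by
      have : ∀ r ∈ [0, 1, 2, 3, 4, 5, 6, 7, 8], r < 9 := by decide
      exact this r hr
    rw [Bool.or_eq_true, Nat.blt_eq, Nat.blt_eq] at hred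
    rcases hred with hlt | hlt
    · have h' := h.rotate (-⟨r, hr9⟩)
      have := hmin _ _ h'
      rw [h.maskImage_eq h' (fun _ _ => Iff.rfl) (rotateLabel_linkPerm ⟨r, hr9⟩)] at this
      exact absurd hlt (not_lt.2 this)
    · have h' := h.reflect ⟨r, hr9⟩
      have := hmin _ _ h'
      rw [h.maskImage_eq h' (fun x y => ⟨fun ⟨z, hz⟩ => h.carriedBy.isRotationSystem.opp hz,
        fun ⟨z, hz⟩ => h.carriedBy.isRotationSystem.opp hz⟩) (reflectLabel_linkPerm ⟨r, hr9⟩)] at this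
      exact absurd hlt (not_lt.2 this)
  · obtain ⟨⟨M, ct⟩, hmem, hM'⟩ := List.any_eq_true.1 hcert
    have hs := List.all_eq_true.1 searchMissing_certificates _ hmem
    rw [force_eq] at hs
    rw [Nat.eq_of_beq_eq_true hM'] at hs
    exact h.exists_leaf_of_certificate hs

end AbstractSimplicialComplex

/-! ### Surfaces given by rotation systems -/

namespace AbstractSimplicialComplex

variable {V : Type*} [DecidableEq V]

/-- The complex whose triangles are the oriented triangles of `T`. -/
def ofRel (T : V → V → V → Prop) : AbstractSimplicialComplex V where
  faces := {s | s.Nonempty ∧ (s.card = 1 ∨ ∃ a b c, T a b c ∧ s ⊆ {a, b, c})}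
  isRelLowerSet_faces := by
    rintro s ⟨hs, hs'⟩
    refine ⟨hs, fun t hts ht => ⟨ht, ?_⟩⟩
    rcases hs' with h | ⟨a, b, c, h, hsub⟩
    · left
      have := Finset.card_le_card hts
      have := Finset.card_pos.2 ht
      omega
    · exact Or.inr ⟨a, b, c, h, hts.trans hsub⟩
  singleton_mem v := ⟨by simp, by simp⟩

theorem mem_ofRel {T : V → V → V → Prop} {s : Finset V} :
    s ∈ ofRel T ↔ s.Nonempty ∧ (s.card = 1 ∨ ∃ a b c, T a b c ∧ s ⊆ {a, b, c}) := Iff.rfl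

theorem ofRel_carriedBy {T : V → V → V → Prop} (hT : IsRotationSystem T) :
    (ofRel T).CarriedBy T where
  isRotationSystem := hT
  mem_iff {a b c} hab hac hbc := by
    rw [mem_ofRel, Finset.card_triple_eq_three.2 ⟨hab, hac, hbc⟩]
    constructor
    · rintro ⟨_, h | ⟨x, y, z, h, hsub⟩⟩
      · omega
      · have ha : a ∈ ({x, y, z} : Finset V) := hsub (by simp)
        have hb : b ∈ ({x, y, z} : Finset V) := hsub (by simp)
        have hc : c ∈ ({x, y, z} : Finset V) := hsub (by simp)
        simp only [Finset.mem_insert, Finset.mem_singleton] at ha hb hc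
        have h1 := hT.rot h
        have h2 := hT.rot h1
        rcases ha with rfl | rfl | rfl <;> rcases hb with rfl | rfl | rfl <;>
          rcases hc with rfl | rfl | rfl <;> first
          | exact absurd rfl hab
          | exact absurd rfl hac
          | exact absurd rfl hbc
          | exact Or.inl ‹_›
          | exact Or.inr ‹_›
    · rintro (h | h)
      · exact ⟨by simp, Or.inr ⟨a, b, c, h, subset_rfl⟩⟩
      · exact ⟨by simp, Or.inr ⟨b, a, c, h, by rw [Finset.triple_swap]⟩⟩
  exists_tri {a b} hab h := by
    rcases h.2 with h | ⟨x, y, z, h, hsub⟩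
    · rw [Finset.card_pair hab] at h; omega
    · have ha : a ∈ ({x, y, z} : Finset V) := hsub (by simp)
      have hb : b ∈ ({x, y, z} : Finset V) := hsub (by simp)
      simp only [Finset.mem_insert, Finset.mem_singleton] at ha hb
      have h1 := hT.rot h
      have h2 := hT.rot h1
      rcases ha with rfl | rfl | rfl <;> rcases hb with rfl | rfl | rfl <;> first
        | exact absurd rfl hab
        | exact ⟨_, ‹_›⟩
        | exact hT.opp ‹_›

/-- The universal vertex makes the edge graph connected. Each link is connected since the rotation
is transitive, and 2-regular since the two third vertices at an edge, one for each direction, are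
distinct by `asymm`. -/
theorem ofRel_isClosedSurface [Fintype V] [Nontrivial V] {T : V → V → V → Prop}
    (hT : IsRotationSystem T) {v₀ : V} (hv : ∀ w, w ≠ v₀ → ∃ c, T v₀ w c) :
    (ofRel T).IsClosedSurface := by
  have hc := ofRel_carriedBy hT
  have htri : ∀ v, ∃ a b, T v a b := by
    intro v
    by_cases h : v = v₀
    · obtain ⟨w, hw⟩ := exists_ne v₀
      obtain ⟨c, hcw⟩ := hv w hw
      exact ⟨w, c, h ▸ hcw⟩
    · obtain ⟨c, hcw⟩ := hv v h
      exact ⟨c, v₀, hT.rot hcw⟩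
  refine ⟨?_, ?_, ?_, ?_, ?_⟩
  · rintro s ⟨_, h | ⟨a, b, c, _, h⟩⟩
    · omega
    · exact (Finset.card_le_card h).trans Finset.card_le_three
  · have key : ∀ {a b c}, T a b c → ({a, b, c} : Finset V) ∈ ofRel T ∧
        ({a, b, c} : Finset V).card = 3 := fun h =>
      ⟨hc.mem_of_tri h, Finset.card_triple_eq_three.2 ⟨hT.ne h, hT.ne₃ h, hT.ne₂ h⟩⟩
    rintro s ⟨_, h | ⟨a, b, c, h, hsub⟩⟩
    · obtain ⟨v, rfl⟩ := Finset.card_eq_one.1 h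
      obtain ⟨a, b, hab⟩ := htri v
      exact ⟨_, (key hab).1, by simp, (key hab).2⟩
    · exact ⟨_, (key h).1, hsub, (key h).2⟩
  · rw [SimpleGraph.connected_iff_exists_forall_reachable]
    refine ⟨v₀, fun w => ?_⟩
    by_cases h : w = v₀
    · rw [h]
    · exact SimpleGraph.Adj.reachable ⟨Ne.symm h, (hc.pair_mem_iff (Ne.symm h)).2 (hv w h)⟩
  · intro v
    have mem : ∀ {a b}, T v a b → a ≠ v ∧ ({v, a} : Finset V) ∈ ofRel T := fun h =>
      ⟨(hT.ne h).symm, (hc.pair_mem_iff (hT.ne h)).2 ⟨_, h⟩⟩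
    obtain ⟨a, b, hab⟩ := htri v
    rw [SimpleGraph.connected_iff_exists_forall_reachable]
    refine ⟨⟨a, mem hab⟩, fun ⟨x, hx⟩ => ?_⟩
    obtain ⟨y, hxy⟩ := (hc.pair_mem_iff hx.1.symm).1 hx.2
    obtain ⟨_, h⟩ := hT.link_trans
      (fun w => ∃ h, ((ofRel T).linkGraph v).Reachable ⟨a, mem hab⟩ ⟨w, h⟩) hab
      ⟨mem hab, SimpleGraph.Reachable.refl _⟩ (by
        rintro u w huw ⟨hu, hreach⟩
        obtain ⟨z, hz⟩ := hT.opp (hT.rot (hT.rot huw))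
        refine ⟨mem hz, hreach.trans (SimpleGraph.Adj.reachable ⟨?_, hc.mem_of_tri huw⟩)⟩
        intro he
        exact hT.ne₂ huw (congrArg Subtype.val he)) hxy
    exact h
  · rintro v ⟨w, hw⟩
    obtain ⟨c, hc1⟩ := (hc.pair_mem_iff hw.1.symm).1 hw.2
    obtain ⟨d, hd1⟩ := hT.opp hc1
    have mem : ∀ {a b}, T v a b → a ≠ v ∧ ({v, a} : Finset V) ∈ ofRel T := fun h =>
      ⟨(hT.ne h).symm, (hc.pair_mem_iff (hT.ne h)).2 ⟨_, h⟩⟩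
    obtain ⟨c', hc'⟩ := hT.opp (hT.rot (hT.rot hc1))
    have hcd : c ≠ d := by
      rintro rfl
      exact hT.asymm hc1 hd1
    have : ((ofRel T).linkGraph v).neighborSet ⟨w, hw⟩ =
        {⟨c, mem hc'⟩, ⟨d, mem (hT.rot hd1)⟩} := by
      ext ⟨x, hx⟩
      simp only [SimpleGraph.mem_neighborSet, Set.mem_insert_iff, Set.mem_singleton_iff,
        Subtype.mk.injEq]
      constructor
      · rintro ⟨h1, h2⟩
        have hwx : w ≠ x := fun he => h1 (Subtype.ext he)
        rcases (hc.mem_iff hw.1.symm hx.1.symm hwx).1 h2 with h | h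
        · exact Or.inl (hT.unique h hc1)
        · exact Or.inr (hT.unique h hd1)
      · rintro (rfl | rfl)
        · exact ⟨fun he => hT.ne₂ hc1 (congrArg Subtype.val he), hc.mem_of_tri hc1⟩
        · refine ⟨fun he => hT.ne₃ hd1 (congrArg Subtype.val he), ?_⟩
          change ({v, w, x} : Finset V) ∈ ofRel T
          rw [← Finset.triple_swap]
          exact hc.mem_of_tri hd1
    rw [this, Set.ncard_pair (fun he => hcd (congrArg Subtype.val he))]

/-- The rotation system itself serves as the orientation. -/
theorem CarriedBy.orientable {K : AbstractSimplicialComplex V} {T : V → V → V → Prop}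
    (h : K.CarriedBy T) : K.Orientable := by
  have hT := h.isRotationSystem
  have mem : ∀ {a b c}, ({a, b, c} : Finset V) ∈ K → ({a, b, c} : Finset V).card = 3 →
      T a b c ∨ T b a c := fun hK hc => by
    obtain ⟨h1, h2, h3⟩ := Finset.card_triple_eq_three.1 hc
    exact (h.mem_iff h1 h2 h3).1 hK
  refine ⟨T, fun a b c h => hT.rot h, fun a b c hK hc => ?_, fun a b c d hK hc hK' hc' hcd => ?_⟩
  · have := mem hK hc
    have := fun h1 => hT.asymm (a := a) (b := b) (c := c) h1
    tauto
  · constructor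
    · intro h1
      exact (mem hK' hc').resolve_left fun h2 => hcd (hT.unique h1 h2)
    · intro h1
      exact (mem hK hc).resolve_right fun h2 => hcd (hT.unique h2 h1)

open Classical in
theorem faceCount_two_eq {n : ℕ} (K : AbstractSimplicialComplex (Fin n)) :
    K.faceCount 2 =
      (Finset.univ.filter fun p : Fin n × Fin n => p.1 < p.2 ∧ {p.1, p.2} ∈ K).card := by
  obtain ⟨s, hs, hs'⟩ := K.faceCount_eq 2
  rw [← hs]
  symm
  apply Finset.card_bij (fun p _ => {p.1, p.2})
  · rintro ⟨a, b⟩ h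
    obtain ⟨h1, h2⟩ := (Finset.mem_filter.1 h).2
    exact (hs' _).2 ⟨h2, Finset.card_pair h1.ne⟩
  · rintro ⟨a, b⟩ h ⟨c, d⟩ h' heq
    have h1 := (Finset.mem_filter.1 h).2.1
    have h2 := (Finset.mem_filter.1 h').2.1
    have heq' : ({a, b} : Set (Fin n)) = {c, d} := by
      simpa using congrArg (fun t : Finset (Fin n) => (t : Set (Fin n))) heq
    rcases Set.pair_eq_pair_iff.1 heq' with ⟨rfl, rfl⟩ | ⟨rfl, rfl⟩
    · rfl
    · exact absurd h1 h2.not_gt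
  · intro t ht
    obtain ⟨h1, h2⟩ := (hs' t).1 ht
    obtain ⟨a, b, hab, rfl⟩ := Finset.card_eq_two.1 h2
    rcases lt_or_gt_of_ne hab with h | h
    · exact ⟨(a, b), by simp [h, h1], rfl⟩
    · exact ⟨(b, a), by simp [h, Finset.pair_comm b a, h1], Finset.pair_comm _ _⟩

/-! ### Surfaces given by tables -/

/-- The relation given by a table. -/
def tableRel (S : ℕ) (a b c : Fin 10) : Prop := entry S (10 * a + b) = c + 1

instance (S : ℕ) (a b c : Fin 10) : Decidable (tableRel S a b c) :=
  inferInstanceAs (Decidable (_ = _))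

/-- The labels. -/
def labels : List ℕ := [0, 1, 2, 3, 4, 5, 6, 7, 8, 9]

/-- Check that the table `S` is a rotation system. -/
def tableCheck (S : ℕ) : Bool :=
  labels.all fun a => labels.all fun b => force (entry S (10 * a + b)) fun c =>
    c.beq 0 || (c.ble 10 && !a.beq b && (entry S (10 * b + (c - 1))).beq (a + 1) &&
      !(entry S (10 * b + a)).beq 0 && !(entry S (10 * b + a)).beq c &&
      force (orbit S a b 10 b (2 ^ b)) fun O =>
        labels.all fun x => (entry S (10 * a + x)).beq 0 || O.testBit x)

theorem mem_labels {a : ℕ} (h : a < 10) : a ∈ labels := by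
  interval_cases a <;> simp [labels]

theorem tableCheck_spec {S : ℕ} (h : tableCheck S = true) (a b : Fin 10)
    (hab : entry S (10 * a + b) ≠ 0) :
    entry S (10 * a + b) ≤ 10 ∧ a ≠ b ∧
      entry S (10 * b + (entry S (10 * a + b) - 1)) = a + 1 ∧ entry S (10 * b + a) ≠ 0 ∧
      entry S (10 * b + a) ≠ entry S (10 * a + b) ∧
      ∀ x : Fin 10, entry S (10 * a + x) ≠ 0 → (orbit S a b 10 b (2 ^ (b : ℕ))).testBit x = true := by
  have h1 := List.all_eq_true.1 (List.all_eq_true.1 h a (mem_labels a.isLt)) b (mem_labels b.isLt)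
  simp only [force_eq, Bool.or_eq_true, Bool.and_eq_true, Nat.beq_eq, Nat.ble_eq,
    Bool.not_eq_true', ← Bool.not_eq_true, List.all_eq_true] at h1
  obtain ⟨⟨⟨⟨⟨h2, h3⟩, h4⟩, h5⟩, h6⟩, h7⟩ := h1.resolve_left hab
  exact ⟨h2, fun he => h3 (congrArg _ he), h4, h5, h6, fun x hx =>
    (h7 x (mem_labels x.isLt)).resolve_left hx⟩

/-- Each label collected in the orbit is reached by the rotation, hence inherits every property the
rotation preserves. Combined with the check that the orbit contains all neighbours, this yields
`link_trans` for a table. -/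
theorem orbit_induction {S a b : ℕ} (P : ℕ → Prop)
    (hP : ∀ x y, entry S (10 * a + x) = y + 1 → P x → P y) :
    ∀ {n x O}, P x → (∀ u, O.testBit u = true → P u) →
      ∀ u, (orbit S a b n x O).testBit u = true → P u := by
  intro n
  induction n with
  | zero => intro x O _ _ u hu; simp [orbit] at hu
  | succ n ih =>
    intro x O hx hO u
    rw [orbit]
    split
    · simp
    · rename_i y hy
      cases hyb : y.beq b
      · rw [cond_false]
        apply ih (hP x y hy hx)
        intro v hv
        rw [Nat.testBit_or, Nat.testBit_two_pow, Bool.or_eq_true, decide_eq_true_eq] at hv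
        rcases hv with hv | rfl
        · exact hO v hv
        · exact hP x _ hy hx
      · rw [cond_true]
        exact hO u

theorem isRotationSystem_tableRel {S : ℕ} (h : tableCheck S = true) :
    IsRotationSystem (tableRel S) := by
  have spec := tableCheck_spec h
  have nz : ∀ {a b c}, tableRel S a b c → entry S (10 * a + b) ≠ 0 := by
    intro a b c h1; rw [tableRel] at h1; omega
  have ex : ∀ {a b : Fin 10}, entry S (10 * a + b) ≠ 0 → ∃ c, tableRel S a b c := by
    intro a b h1
    obtain ⟨h2, _⟩ := spec a b h1
    exact ⟨⟨entry S (10 * a + b) - 1, by omega⟩, by rw [tableRel]; simp only; omega⟩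
  refine ⟨fun h1 => (spec _ _ (nz h1)).2.1, ?_, ?_, fun h1 => ex (spec _ _ (nz h1)).2.2.2.1, ?_, ?_⟩
  · intro a b c h1
    have := (spec _ _ (nz h1)).2.2.1
    rw [tableRel] at h1
    rwa [h1] at this
  · intro a b c d h1 h2
    rw [tableRel] at h1 h2
    exact Fin.ext (by omega)
  · intro a b c h1 h2
    have := (spec _ _ (nz h1)).2.2.2.2.1
    rw [tableRel] at h1 h2
    omega
  · intro a b c P h1 hb hP x y hxy
    have hbit := (spec _ _ (nz h1)).2.2.2.2.2 x (nz hxy)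
    -- The orbit lives on natural numbers, so the property has to carry the bound `z < 10` with it.
    obtain ⟨h2, h3⟩ := orbit_induction (a := a) (b := b) (S := S) (n := 10) (x := b)
      (O := 2 ^ (b : ℕ)) (fun z => ∃ hz : z < 10, P ⟨z, hz⟩) (by
        rintro u v huv ⟨hu, hPu⟩
        obtain ⟨w, hw⟩ := ex (a := a) (b := ⟨u, hu⟩) (by simp only; omega)
        have : v = w := by rw [tableRel] at hw; simp only at hw; omega
        subst this
        exact ⟨w.isLt, hP _ _ hw hPu⟩) ⟨b.isLt, hb⟩ (by
        intro u hu
        rw [Nat.testBit_two_pow, decide_eq_true_eq] at hu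
        subst hu
        exact ⟨b.isLt, hb⟩) x hbit
    exact h3

/-- The table of one of the twenty surfaces. -/
def surfaceTable (i : Fin 20) : ℕ := surfaceTables.getD i 0

/-- The twenty surfaces. -/
def surface (i : Fin 20) : AbstractSimplicialComplex (Fin 10) := ofRel (tableRel (surfaceTable i))

theorem tableCheck_surfaceTable : ∀ i, tableCheck (surfaceTable i) = true := by
  decide +kernel

theorem surfaceTable_zero : ∀ i, ∀ b : Fin 10, b ≠ 0 → entry (surfaceTable i) b ≠ 0 := by
  decide +kernel

theorem card_edges_surfaceTable : ∀ i, (Finset.univ.filter fun p : Fin 10 × Fin 10 =>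
    p.1 < p.2 ∧ entry (surfaceTable i) (10 * p.1 + p.2) ≠ 0).card = 42 := by
  decide +kernel

theorem isRotationSystem_surface (i : Fin 20) : IsRotationSystem (tableRel (surfaceTable i)) :=
  isRotationSystem_tableRel (tableCheck_surfaceTable i)

theorem surface_carriedBy (i : Fin 20) : (surface i).CarriedBy (tableRel (surfaceTable i)) :=
  ofRel_carriedBy (isRotationSystem_surface i)

theorem exists_tableRel_iff (i : Fin 20) (a b : Fin 10) :
    (∃ c, tableRel (surfaceTable i) a b c) ↔ entry (surfaceTable i) (10 * a + b) ≠ 0 := by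
  constructor
  · rintro ⟨c, hc⟩; rw [tableRel] at hc; omega
  · intro h
    obtain ⟨h2, _⟩ := tableCheck_spec (tableCheck_surfaceTable i) a b h
    exact ⟨⟨entry (surfaceTable i) (10 * a + b) - 1, by omega⟩, by rw [tableRel]; simp only; omega⟩

theorem surface_isClosedSurface (i : Fin 20) : (surface i).IsClosedSurface := by
  apply ofRel_isClosedSurface (isRotationSystem_surface i) (v₀ := 0)
  intro w hw
  rw [exists_tableRel_iff]
  simpa using surfaceTable_zero i w hw

/-- With 42 edges there are 28 triangles, and `10 - 42 + 28 = 2 - 2 * 3`. -/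
theorem surface_triangulates (i : Fin 20) : (surface i).Triangulates 3 := by
  classical
  refine ⟨surface_isClosedSurface i, (surface_carriedBy i).orientable, ?_⟩
  have h1 := (surface_isClosedSurface i).two_mul_faceCount_two
  have h2 : (surface i).faceCount 2 = 42 := by
    rw [faceCount_two_eq, ← card_edges_surfaceTable i]
    congr 1
    ext ⟨a, b⟩
    simp only [Finset.mem_filter, Finset.mem_univ, true_and]
    refine and_congr_right fun hab => ?_
    rw [(surface_carriedBy i).pair_mem_iff hab.ne, exists_tableRel_iff]
  rw [eulerChar, faceCount_one, h2, Fintype.card_fin]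
  omega

theorem surface_isVertexMinimal (i : Fin 20) : (surface i).IsVertexMinimal 3 :=
  ⟨surface_triangulates i, fun m L hL => by simpa using hL.ten_le_card⟩

theorem IsVertexMinimal.card_eq {V : Type*} [Fintype V] [DecidableEq V]
    {K : AbstractSimplicialComplex V} (hK : K.IsVertexMinimal 3) : Fintype.card V = 10 :=
  le_antisymm (hK.2 10 _ (surface_triangulates 0)) hK.1.ten_le_card

end AbstractSimplicialComplex

/-! ### Combinatorial types -/

namespace AbstractSimplicialComplex

/-- By purity every face lies in a triangle, so a vertex map has to be tested on triangles only. -/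
theorem IsClosedSurface.map_mem {V W : Type*} [Fintype V] [DecidableEq V]
    {K : AbstractSimplicialComplex V} {L : AbstractSimplicialComplex W} (hK : K.IsClosedSurface)
    {f : V ↪ W} (h : ∀ t ∈ K, t.card = 3 → t.map f ∈ L) {s : Finset V} (hs : s ∈ K) :
    s.map f ∈ L := by
  obtain ⟨t, ht, hst, hc⟩ := hK.pure s hs
  exact mem_of_subset (h t ht hc) (Finset.map_subset_map.2 hst)
    (Finset.map_nonempty.2 (nonempty_of_mem hs))

theorem CarriedBy.map_mem {V W : Type*} [DecidableEq V] [DecidableEq W]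
    {K : AbstractSimplicialComplex V} {L : AbstractSimplicialComplex W} {R : V → V → V → Prop}
    {R' : W → W → W → Prop} (hK : K.CarriedBy R) (hL : L.CarriedBy R') {f : V ↪ W}
    (h : ∀ a b c, R a b c → R' (f a) (f b) (f c) ∨ R' (f b) (f a) (f c)) {t : Finset V}
    (ht : t ∈ K) (hc : t.card = 3) : t.map f ∈ L := by
  obtain ⟨a, b, c, hab, hac, hbc, rfl⟩ := Finset.card_eq_three.1 hc
  have key : ∀ {a b c}, R a b c → ({f a, f b, f c} : Finset W) ∈ L := by
    intro a b c habc
    rcases h a b c habc with h1 | h1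
    · exact hL.mem_of_tri h1
    · rw [← Finset.triple_swap]; exact hL.mem_of_tri h1
  have : ({a, b, c} : Finset V).map f = {f a, f b, f c} := by simp [Finset.map_insert]
  rw [this]
  rcases (hK.mem_iff hab hac hbc).1 ht with h1 | h1
  · exact key h1
  · rw [← Finset.triple_swap]; exact key h1

theorem CarriedBy.isomorphic {V W : Type*} [Fintype V] [DecidableEq V] [Fintype W] [DecidableEq W]
    {K : AbstractSimplicialComplex V} {L : AbstractSimplicialComplex W} {R : V → V → V → Prop}
    {R' : W → W → W → Prop} (hK : K.CarriedBy R) (hL : L.CarriedBy R') (hK' : K.IsClosedSurface)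
    (hL' : L.IsClosedSurface) (f : V ≃ W)
    (h : ∀ a b c, R a b c → R' (f a) (f b) (f c) ∨ R' (f b) (f a) (f c))
    (h' : ∀ a b c, R' (f a) (f b) (f c) → R a b c ∨ R b a c) : K.Isomorphic L := by
  refine ⟨f, fun s => ⟨fun hs => hK'.map_mem (fun t ht hc => hK.map_mem hL h ht hc) hs,
    fun hs => ?_⟩⟩
  have := hL'.map_mem (f := f.symm.toEmbedding) (L := K) (fun t ht hc =>
    hL.map_mem hK (fun a b c habc => h' _ _ _ (by simpa using habc)) ht hc) hs
  rw [Finset.map_map] at this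
  simpa using this

/-- The `x`-th decimal digit of `p`. -/
def digit (p x : ℕ) : ℕ := p / 10 ^ x % 10

/-- Check that the digits of `r.2.2` give an isomorphism from the table `r.1` to the surface number
`r.2.1`, which may reverse the orientation. -/
def leafCheck (r : ℕ × ℕ × ℕ) : Bool :=
  Nat.blt r.2.1 20 &&
  (labels.all fun x => labels.all fun y => x.beq y || !(digit r.2.2 x).beq (digit r.2.2 y)) &&
  force (surfaceTables.getD r.2.1 0) fun S =>
    (labels.all fun x => labels.all fun y => force (entry r.1 (10 * x + y)) fun c =>
      force (entry S (10 * digit r.2.2 x + digit r.2.2 y)) fun d =>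
      (c.beq 0 && d.beq 0) || (c.ble 10 && !c.beq 0 && d.beq (digit r.2.2 (c - 1) + 1))) ||
    (labels.all fun x => labels.all fun y => force (entry r.1 (10 * x + y)) fun c =>
      force (entry S (10 * digit r.2.2 y + digit r.2.2 x)) fun d =>
      (c.beq 0 && d.beq 0) || (c.ble 10 && !c.beq 0 && d.beq (digit r.2.2 (c - 1) + 1)))

theorem leafCheck_leafData : (leafData.all leafCheck) = true := by
  decide +kernel

/-- `leafCheck` compares all hundred digits of both tables, including the empty ones, so the
oriented triangles correspond in both directions. The two alternatives are the isomorphisms that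
preserve and that reverse the orientation. -/
theorem exists_perm_of_leaf {L : ℕ} (hL : L ∈ leafData.map Prod.fst) :
    ∃ (i : Fin 20) (π : Equiv.Perm (Fin 10)),
      (∀ x y z, tableRel L x y z ↔ tableRel (surfaceTable i) (π x) (π y) (π z)) ∨
      (∀ x y z, tableRel L x y z ↔ tableRel (surfaceTable i) (π y) (π x) (π z)) := by
  obtain ⟨⟨L, i, p⟩, hr, rfl⟩ := List.mem_map.1 hL
  have h := List.all_eq_true.1 leafCheck_leafData _ hr
  simp only [leafCheck, force_eq, Bool.or_eq_true, Bool.and_eq_true, Nat.beq_eq, Nat.ble_eq,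
    Bool.not_eq_true', ← Bool.not_eq_true, List.all_eq_true, Nat.blt_eq] at h
  obtain ⟨⟨hi, hinj⟩, h⟩ := h
  let f : Fin 10 → Fin 10 := fun x => ⟨digit p x, Nat.mod_lt _ (by omega)⟩
  have hf : Function.Injective f := by
    intro x y hxy
    apply Fin.ext
    refine (hinj x (mem_labels x.isLt) y (mem_labels y.isLt)).resolve_right fun hne => hne ?_
    exact congrArg Fin.val hxy
  let π : Equiv.Perm (Fin 10) := Equiv.ofBijective f (Finite.injective_iff_bijective.1 hf)
  have hπ : ∀ x, ((π x : Fin 10) : ℕ) = digit p x := fun x => rfl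
  refine ⟨⟨i, hi⟩, π, ?_⟩
  have key : ∀ {c d : ℕ} {z : Fin 10},
      ((c = 0 ∧ d = 0) ∨ (c ≤ 10 ∧ ¬ c = 0) ∧ d = digit p (c - 1) + 1) →
      (c = z + 1 ↔ d = digit p z + 1) := by
    rintro c d z (⟨rfl, rfl⟩ | ⟨⟨h1, h2⟩, h3⟩)
    · constructor <;> intro h <;> omega
    · constructor
      · rintro rfl; simpa using h3
      · intro h4
        have h5 : f ⟨c - 1, by omega⟩ = f z := Fin.ext (by simp only [f]; omega)
        have := congrArg Fin.val (hf h5)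
        simp only at this
        omega
  refine h.imp (fun h x y z => ?_) fun h x y z => ?_
  · exact key (h x (mem_labels x.isLt) y (mem_labels y.isLt))
  · exact key (h x (mem_labels x.isLt) y (mem_labels y.isLt))

/-- Every triangulation of the surface of genus three with ten vertices is one of the twenty. -/
theorem Triangulates.exists_isomorphic {V : Type*} [Fintype V] [DecidableEq V]
    {K : AbstractSimplicialComplex V} (hK : K.Triangulates 3) (hV : Fintype.card V = 10) :
    ∃ i, K.Isomorphic (surface i) := by
  obtain ⟨R, e, h, L, hL, hRL⟩ := hK.exists_leaf hV
  have hRL' : ∀ x y z, R x y z ↔ tableRel L (e.symm x) (e.symm y) (e.symm z) := by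
    intro x y z
    have := labelRel_val R e (e.symm x) (e.symm y) (e.symm z)
    rw [hRL] at this
    simp only [Equiv.apply_symm_apply] at this
    rw [← this, tableRel]
    simp
  obtain ⟨i, π, hπ⟩ := exists_perm_of_leaf hL
  refine ⟨i, h.carriedBy.isomorphic (surface_carriedBy i) hK.isClosedSurface
    (surface_isClosedSurface i) (e.symm.trans π) ?_ ?_⟩
  · intro a b c habc
    rw [hRL'] at habc
    rcases hπ with hπ | hπ
    · exact Or.inl ((hπ _ _ _).1 habc)
    · exact Or.inr ((hπ _ _ _).1 habc)
  · intro a b c habc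
    rw [hRL', hRL']
    rcases hπ with hπ | hπ
    · exact Or.inl ((hπ _ _ _).2 habc)
    · exact Or.inr ((hπ _ _ _).2 habc)

/-! ### An invariant -/

/-- The vertices `c` and `d` are opposite across the edge `ab`. -/
def Opposite {V : Type*} [DecidableEq V] (K : AbstractSimplicialComplex V) (a b c d : V) : Prop :=
  c ≠ d ∧ (a ≠ b ∧ a ≠ c ∧ b ≠ c ∧ ({a, b, c} : Finset V) ∈ K) ∧
    (a ≠ b ∧ a ≠ d ∧ b ≠ d ∧ ({a, b, d} : Finset V) ∈ K)

open Classical in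
/-- A numerical invariant of the combinatorial type, computed from the numbers of edges across
which two vertices are opposite. -/
noncomputable def oppositeMoment {V : Type*} [Fintype V] [DecidableEq V]
    (K : AbstractSimplicialComplex V) : ℕ :=
  ∑ c, (∑ d, (∑ a, ∑ b, if K.Opposite a b c d then 1 else 0) ^ 2) ^ 3

/-- Being opposite depends only on the triangles, and each of the four sums runs over all vertices,
so it may be reindexed by the bijection. -/
theorem Isomorphic.oppositeMoment_eq {V W : Type*} [Fintype V] [DecidableEq V] [Fintype W]
    [DecidableEq W] {K : AbstractSimplicialComplex V} {L : AbstractSimplicialComplex W}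
    (h : K.Isomorphic L) : K.oppositeMoment = L.oppositeMoment := by
  obtain ⟨e, he⟩ := h
  have hopp : ∀ a b c d, L.Opposite (e a) (e b) (e c) (e d) ↔ K.Opposite a b c d := by
    intro a b c d
    have key : ∀ a b c, ({e a, e b, e c} : Finset W) ∈ L ↔ ({a, b, c} : Finset V) ∈ K := by
      intro a b c
      rw [he]
      simp [Finset.map_insert]
    simp only [Opposite, key, e.injective.ne_iff]
  rw [oppositeMoment, oppositeMoment, ← e.sum_comp]
  refine Finset.sum_congr rfl fun c _ => ?_
  rw [← e.sum_comp]
  congr 1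
  refine Finset.sum_congr rfl fun d _ => ?_
  rw [← e.sum_comp]
  congr 1
  refine Finset.sum_congr rfl fun a _ => ?_
  rw [← e.sum_comp]
  refine Finset.sum_congr rfl fun b _ => ?_
  by_cases h : K.Opposite a b c d
  · rw [if_pos h, if_pos ((hopp a b c d).2 h)]
  · rw [if_neg h, if_neg (mt (hopp a b c d).1 h)]

/-- The sum of the values of `f` at the ten labels. -/
def sumLabels (f : ℕ → ℕ) : ℕ :=
  f 0 + f 1 + f 2 + f 3 + f 4 + f 5 + f 6 + f 7 + f 8 + f 9

theorem sum_eq_sumLabels (f : ℕ → ℕ) : ∑ x : Fin 10, f x = sumLabels f := by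
  simp [Fin.sum_univ_succ, sumLabels, add_assoc]

/-- Computation of `oppositeMoment` from a table. -/
def tableMoment (S : ℕ) : ℕ :=
  sumLabels fun c => (sumLabels fun d => (sumLabels fun a => sumLabels fun b =>
    bif (entry S (10 * a + b)).beq (c + 1) then
      bif (entry S (10 * b + a)).beq (d + 1) then 2 else 0 else 0) ^ 2) ^ 3

/-- The values of `tableMoment` for the twenty surfaces. -/
def moments : List ℕ := [1981568, 1391104, 1607168, 2114688, 1339264, 1761280, 2028800, 2330368, 1353856, 1478144, 1218432, 1350784, 992128, 959232, 1302016, 883200, 1610496, 1070336, 1917696, 392448]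

theorem tableMoment_surfaceTables : surfaceTables.map tableMoment = moments := by
  decide +kernel

theorem triangle_mem_surface_iff {i : Fin 20} {a b c : Fin 10} :
    (a ≠ b ∧ a ≠ c ∧ b ≠ c ∧ ({a, b, c} : Finset (Fin 10)) ∈ surface i) ↔
      tableRel (surfaceTable i) a b c ∨ tableRel (surfaceTable i) b a c := by
  have hT := isRotationSystem_surface i
  constructor
  · rintro ⟨h1, h2, h3, h⟩
    exact ((surface_carriedBy i).mem_iff h1 h2 h3).1 h
  · rintro (h | h)
    · exact ⟨hT.ne h, hT.ne₃ h, hT.ne₂ h, ((surface_carriedBy i).mem_iff (hT.ne h) (hT.ne₃ h)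
        (hT.ne₂ h)).2 (Or.inl h)⟩
    · exact ⟨(hT.ne h).symm, hT.ne₂ h, hT.ne₃ h, ((surface_carriedBy i).mem_iff (hT.ne h).symm
        (hT.ne₂ h) (hT.ne₃ h)).2 (Or.inr h)⟩

theorem opposite_surface_iff {i : Fin 20} {a b c d : Fin 10} :
    (surface i).Opposite a b c d ↔
      (tableRel (surfaceTable i) a b c ∧ tableRel (surfaceTable i) b a d) ∨
      (tableRel (surfaceTable i) b a c ∧ tableRel (surfaceTable i) a b d) := by
  have hT := isRotationSystem_surface i
  rw [Opposite, triangle_mem_surface_iff, triangle_mem_surface_iff]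
  constructor
  · rintro ⟨hcd, h1 | h1, h2 | h2⟩
    · exact absurd (hT.unique h1 h2) hcd
    · exact Or.inl ⟨h1, h2⟩
    · exact Or.inr ⟨h1, h2⟩
    · exact absurd (hT.unique h1 h2) hcd
  · rintro (⟨h1, h2⟩ | ⟨h1, h2⟩)
    · refine ⟨?_, Or.inl h1, Or.inr h2⟩
      rintro rfl
      exact hT.asymm h1 h2
    · refine ⟨?_, Or.inr h1, Or.inl h2⟩
      rintro rfl
      exact hT.asymm h1 h2

/-- The sum over ordered pairs `(a, b)` meets every edge twice. For given `c` and `d` exactly one of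
the two orders has the triangle of `c` on the positive side, so `tableMoment` looks only for this
order and counts it with weight two. -/
theorem oppositeMoment_surface (i : Fin 20) :
    (surface i).oppositeMoment = tableMoment (surfaceTable i) := by
  classical
  have hT := isRotationSystem_surface i
  have hopp := @opposite_surface_iff i
  generalize surfaceTable i = S at hT hopp ⊢
  let f : ℕ → ℕ → ℕ → ℕ → ℕ := fun c d a b => bif (entry S (10 * a + b)).beq (c + 1)
    then bif (entry S (10 * b + a)).beq (d + 1) then 2 else 0 else 0
  have key : ∀ c d : Fin 10, (∑ a, ∑ b, if (surface i).Opposite a b c d then 1 else 0) =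
      ∑ a : Fin 10, ∑ b : Fin 10, f c d a b := by
    intro c d
    let g : Fin 10 → Fin 10 → ℕ := fun a b =>
      if tableRel S a b c ∧ tableRel S b a d then 1 else 0
    have h1 : ∀ a b : Fin 10, (if (surface i).Opposite a b c d then 1 else 0) = g a b + g b a := by
      intro a b
      simp only [hopp, g]
      by_cases h1 : tableRel S a b c ∧ tableRel S b a d
      · have h2 : ¬ (tableRel S b a c ∧ tableRel S a b d) :=
          fun h2 => hT.asymm h1.1 h2.1
        simp [h1, h2]
      · simp [h1]
    have h2 : ∀ a b : Fin 10, f c d a b = g a b + g a b := by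
      intro a b
      simp only [f, g, tableRel]
      by_cases h1 : entry S (10 * a + b) = c + 1
      · by_cases h2 : entry S (10 * b + a) = d + 1
        · simp [h1, h2]
        · have : (entry S (10 * b + a)).beq (d + 1) = false := by
            rw [← Bool.not_eq_true, Nat.beq_eq]; exact h2
          simp [this, h2]
      · have : (entry S (10 * a + b)).beq (c + 1) = false := by
          rw [← Bool.not_eq_true, Nat.beq_eq]; exact h1
        simp [this, h1]
    simp only [h1, h2, Finset.sum_add_distrib]
    -- The two alternatives differ by exchanging `a` and `b`, hence have equal sums.
    rw [show ∑ a, ∑ b, g b a = ∑ a, ∑ b, g a b from Finset.sum_comm]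
  have hsum : ∀ c d, ∑ a : Fin 10, ∑ b : Fin 10, f c d a b =
      sumLabels fun a => sumLabels fun b => f c d a b := by
    intro c d
    rw [← sum_eq_sumLabels]
    exact Finset.sum_congr rfl fun a _ => sum_eq_sumLabels _
  rw [oppositeMoment, tableMoment, ← sum_eq_sumLabels]
  refine Finset.sum_congr rfl fun c _ => ?_
  rw [← sum_eq_sumLabels]
  refine congrArg (· ^ 3) (Finset.sum_congr rfl fun d _ => ?_)
  exact congrArg (· ^ 2) ((key c d).trans (hsum c d))

/-- The twenty entries of `moments` are pairwise different. -/
theorem surface_isomorphic_imp_eq {i j : Fin 20} (h : (surface i).Isomorphic (surface j)) :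
    i = j := by
  have h1 : ∀ k, (surface k).oppositeMoment = moments.getD k 0 := by
    intro k
    rw [oppositeMoment_surface, ← tableMoment_surfaceTables, surfaceTable,
      List.getD_eq_getElem _ _ (show (k : ℕ) < surfaceTables.length from k.isLt),
      List.getD_eq_getElem _ _ (show (k : ℕ) < (surfaceTables.map tableMoment).length by
        rw [List.length_map]; exact k.isLt), List.getElem_map]
  have h2 : ∀ i j : Fin 20, moments.getD i 0 = moments.getD j 0 → i = j := by
    decide
  apply h2
  rw [← h1, ← h1, h.oppositeMoment_eq]

end AbstractSimplicialComplex

/-! ### Geometric realizations -/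

namespace AbstractSimplicialComplex

/-- Application of `k` to `z` that evaluates `z` first. -/
def forceInt {α : Type} (z : ℤ) (k : ℤ → α) : α :=
  match z with
  | .ofNat n => force n fun m => k (Int.ofNat m)
  | .negSucc n => force n fun m => k (Int.negSucc m)

theorem forceInt_eq {α : Type} (z : ℤ) (k : ℤ → α) : forceInt z k = k z := by
  cases z <;> simp [forceInt, force_eq]

/-- The sign of an integer is positive. -/
def isPos : ℤ → Bool
  | .ofNat n => Nat.blt 0 n
  | .negSucc _ => false

theorem isPos_iff {z : ℤ} : isPos z = true ↔ 0 < z := by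
  cases z with
  | ofNat n => simp [isPos]
  | negSucc n => simp [isPos]

/-- The `k`-th byte of `Q` as an integer. -/
def coord (Q k : ℕ) : ℤ := Int.ofNat ((Q >>> (8 * k)) &&& 255)

/-- Apply `k` to the affine function that vanishes on the plane through the points with labels `p`,
`q`, `r`. -/
def withPlane {α : Type} (Q p q r : ℕ) (k : (ℕ → ℤ) → α) : α :=
  forceInt (coord Q (3 * p)) fun x => forceInt (coord Q (3 * p + 1)) fun y =>
  forceInt (coord Q (3 * p + 2)) fun z =>
  forceInt (coord Q (3 * q) - x) fun u₀ => forceInt (coord Q (3 * q + 1) - y) fun u₁ =>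
  forceInt (coord Q (3 * q + 2) - z) fun u₂ =>
  forceInt (coord Q (3 * r) - x) fun w₀ => forceInt (coord Q (3 * r + 1) - y) fun w₁ =>
  forceInt (coord Q (3 * r + 2) - z) fun w₂ =>
  forceInt (u₁ * w₂ - u₂ * w₁) fun n₀ => forceInt (u₂ * w₀ - u₀ * w₂) fun n₁ =>
  forceInt (u₀ * w₁ - u₁ * w₀) fun n₂ => forceInt (n₀ * x + n₁ * y + n₂ * z) fun c =>
  k fun v => n₀ * coord Q (3 * v) + n₁ * coord Q (3 * v + 1) + n₂ * coord Q (3 * v + 2) - c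

/-- The plane through `p`, `q`, `r` separates the other points of `s` from those of `t`. -/
def planeCheck (Q : ℕ) (s t : List ℕ) (p q r : ℕ) : Bool :=
  withPlane Q p q r fun f =>
    ((s.all fun v => v.beq p || v.beq q || v.beq r || isPos (f v)) &&
      (t.all fun v => v.beq p || v.beq q || v.beq r || isPos (-f v))) ||
    ((s.all fun v => v.beq p || v.beq q || v.beq r || isPos (-f v)) &&
      (t.all fun v => v.beq p || v.beq q || v.beq r || isPos (f v)))

/-- Some plane separates the triangles `abc` and `def`. -/
def separated (Q : ℕ) (s t : ℕ × ℕ × ℕ) : Bool :=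
  match s, t with
  | (a, b, c), (d, e, f) =>
    -- The candidates are the planes of the two triangles and the eighteen planes through an edge of
    -- one triangle and a vertex of the other.
    let P := planeCheck Q [a, b, c] [d, e, f]
    P a b c || P d e f ||
    P a b d || P a b e || P a b f || P b c d || P b c e || P b c f || P c a d || P c a e || P c a f ||
    P d e a || P d e b || P d e c || P e f a || P e f b || P e f c || P f d a || P f d b || P f d c

/-- The triangles of a table. -/
def trianglesOf (S : ℕ) : List (ℕ × ℕ × ℕ) :=
  labels.flatMap fun a => labels.flatMap fun b => force (entry S (10 * a + b)) fun c =>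
    bif Nat.blt a b && Nat.blt (a + 1) c then [(a, b, c - 1)] else []

/-- Check `R` for all pairs of elements at different positions. -/
def allPairwise {α : Type} (R : α → α → Bool) : List α → Bool
  | [] => true
  | x :: l => l.all (R x) && allPairwise R l

/-- No four of the points are on a plane. -/
def generalCheck (Q : ℕ) : Bool :=
  labels.all fun a => labels.all fun b => Nat.ble b a || labels.all fun c => Nat.ble c b ||
    withPlane Q a b c fun f => labels.all fun d => Nat.ble d c || isPos (f d) || isPos (-f d)

theorem generalCheck_surfacePoints : (surfacePoints.all generalCheck) = true := by
  decide +kernel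

/-- Each surface has 28 triangles, so 378 pairs are tested; for every pair, including those that
share a vertex or an edge, one of the candidate planes works. -/
theorem separated_surfaces : ((surfaceTables.zip surfacePoints).all fun r =>
    allPairwise (separated r.2) (trianglesOf r.1)) = true := by
  decide +kernel

end AbstractSimplicialComplex

/-! ### Affine geometry behind the determinant and separation checks -/

namespace AbstractSimplicialComplex

/-- The determinant of `q - p`, `r - p`, `v - p`. -/
def orient (p q r v : Fin 3 → ℤ) : ℤ :=
  ((q 1 - p 1) * (r 2 - p 2) - (q 2 - p 2) * (r 1 - p 1)) * (v 0 - p 0) +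
  ((q 2 - p 2) * (r 0 - p 0) - (q 0 - p 0) * (r 2 - p 2)) * (v 1 - p 1) +
  ((q 0 - p 0) * (r 1 - p 1) - (q 1 - p 1) * (r 0 - p 0)) * (v 2 - p 2)

theorem integerPoint_apply (z : Fin 3 → ℤ) (i : Fin 3) : integerPoint z i = z i := rfl

/-- Cramer's rule: a linear relation among the three difference vectors, combined with the
cofactors, gives determinant times coefficient equal to zero. -/
theorem affineIndependent_of_orient_ne_zero {p q r v : Fin 3 → ℤ} (h : orient p q r v ≠ 0) :
    AffineIndependent ℝ ![integerPoint p, integerPoint q, integerPoint r, integerPoint v] := by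
  have hD : ((orient p q r v : ℤ) : ℝ) ≠ 0 := by exact_mod_cast h
  rw [affineIndependent_iff_linearIndependent_vsub ℝ _ (0 : Fin 4)]
  let e : Fin 3 ≃ {x : Fin 4 // x ≠ 0} := finSuccAboveEquiv (0 : Fin 4)
  rw [← linearIndependent_equiv e, Fintype.linearIndependent_iff]
  intro g hg
  have hcoord : ∀ j : Fin 3, g 0 * ((q j : ℝ) - p j) + g 1 * (r j - p j) + g 2 * (v j - p j) = 0 := by
    intro j
    have := congrArg (fun y : EuclideanSpace ℝ (Fin 3) => y j) hg
    simpa [e, Fin.sum_univ_three, finSuccAboveEquiv, integerPoint_apply, Fin.succAbove] using this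
  have h0 := hcoord 0
  have h1 := hcoord 1
  have h2 := hcoord 2
  rw [orient] at hD
  push_cast at hD
  have g0 : g 0 = 0 := by
    apply (mul_eq_zero.1 ?_).resolve_left hD
    linear_combination (((r 1 : ℝ) - p 1) * (v 2 - p 2) - (r 2 - p 2) * (v 1 - p 1)) * h0 +
      (((r 2 : ℝ) - p 2) * (v 0 - p 0) - (r 0 - p 0) * (v 2 - p 2)) * h1 +
      (((r 0 : ℝ) - p 0) * (v 1 - p 1) - (r 1 - p 1) * (v 0 - p 0)) * h2
  have g1 : g 1 = 0 := by
    apply (mul_eq_zero.1 ?_).resolve_left hD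
    linear_combination (((v 1 : ℝ) - p 1) * (q 2 - p 2) - (v 2 - p 2) * (q 1 - p 1)) * h0 +
      (((v 2 : ℝ) - p 2) * (q 0 - p 0) - (v 0 - p 0) * (q 2 - p 2)) * h1 +
      (((v 0 : ℝ) - p 0) * (q 1 - p 1) - (v 1 - p 1) * (q 0 - p 0)) * h2
  have g2 : g 2 = 0 := by
    apply (mul_eq_zero.1 ?_).resolve_left hD
    linear_combination (((q 1 : ℝ) - p 1) * (r 2 - p 2) - (q 2 - p 2) * (r 1 - p 1)) * h0 +
      (((q 2 : ℝ) - p 2) * (r 0 - p 0) - (q 0 - p 0) * (r 2 - p 2)) * h1 +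
      (((q 0 : ℝ) - p 0) * (r 1 - p 1) - (q 1 - p 1) * (r 0 - p 0)) * h2
  intro i
  fin_cases i
  exacts [g0, g1, g2]

/-- If a linear function is at least `c` on `A`, then the points of the convex hull of `A` where
it has the value `c` are in the convex hull of the points of `A` with this property. -/
theorem mem_convexHull_of_eq {E : Type*} [AddCommGroup E] [Module ℝ E] {A : Set E}
    (F : E →ₗ[ℝ] ℝ) {c : ℝ} (hA : ∀ y ∈ A, c ≤ F y) {y : E} (hy : y ∈ convexHull ℝ A)
    (hF : F y = c) : y ∈ convexHull ℝ {w ∈ A | F w = c} := by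
  -- The points strictly above level `c`, together with the hull of the points of `A` at level `c`,
  -- form a convex set that contains `A`. It therefore contains the hull of `A`, and at level `c`
  -- only the second kind is left.
  have hconv : Convex ℝ {y : E | c < F y ∨ F y = c ∧ y ∈ convexHull ℝ {w ∈ A | F w = c}} := by
    intro u hu w hw a b ha hb hab
    have hu' : c ≤ F u := by rcases hu with h | h; exacts [h.le, h.1.ge]
    have hw' : c ≤ F w := by rcases hw with h | h; exacts [h.le, h.1.ge]
    have hval : F (a • u + b • w) - c = a * (F u - c) + b * (F w - c) := by
      simp only [map_add, map_smul, smul_eq_mul]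
      linear_combination c * hab
    have h1 : 0 ≤ a * (F u - c) := mul_nonneg ha (by linarith)
    have h2 : 0 ≤ b * (F w - c) := mul_nonneg hb (by linarith)
    rcases (add_nonneg h1 h2).lt_or_eq with hlt | heq
    · left; linarith
    · right
      refine ⟨by linarith, ?_⟩
      have h3 : a * (F u - c) = 0 := by linarith
      have h4 : b * (F w - c) = 0 := by linarith
      rcases mul_eq_zero.1 h3 with rfl | h5
      · obtain rfl : b = 1 := by linarith
        have h6 : F w - c = 0 := by linarith
        have hw2 := hw.resolve_left (by linarith)
        simpa using hw2.2
      · rcases mul_eq_zero.1 h4 with rfl | h6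
        · obtain rfl : a = 1 := by linarith
          have hu2 := hu.resolve_left (by linarith)
          simpa using hu2.2
        · have hu2 := hu.resolve_left (by linarith)
          have hw2 := hw.resolve_left (by linarith)
          exact convex_convexHull ℝ _ hu2.2 hw2.2 ha hb hab
  have hsub : A ⊆ {y : E | c < F y ∨ F y = c ∧ y ∈ convexHull ℝ {w ∈ A | F w = c}} := by
    intro w hw
    rcases (hA w hw).lt_or_eq with h | h
    · exact Or.inl h
    · exact Or.inr ⟨h.symm, subset_convexHull ℝ _ ⟨hw, h.symm⟩⟩
  exact ((convexHull_min hsub hconv hy).resolve_left (by rw [hF]; exact lt_irrefl c)).2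

section

variable {V : Type*} [DecidableEq V] {x : V → EuclideanSpace ℝ (Fin 3)}

/-- At most four of the points are affinely independent. -/
def FourIndependent (x : V → EuclideanSpace ℝ (Fin 3)) : Prop :=
  ∀ u : Finset V, u.card ≤ 4 → AffineIndependent ℝ (fun v : u => x v)

theorem FourIndependent.injective (h : FourIndependent x) : Function.Injective x := by
  intro a b hab
  have := h {a, b} (Finset.card_le_two.trans (by omega))
  have h2 : (⟨a, by simp⟩ : ({a, b} : Finset V)) = ⟨b, by simp⟩ := this.injective hab
  exact congrArg Subtype.val h2

omit [DecidableEq V] in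
theorem image_eq_range (u : Finset V) : x '' (u : Set V) = Set.range fun v : u => x v := by
  ext y; simp

omit [DecidableEq V] in
theorem FourIndependent.finrank_vectorSpan (h : FourIndependent x) {u : Finset V} {n : ℕ}
    (hn : n ≤ 3) (hu : u.card = n + 1) :
    Module.finrank ℝ (vectorSpan ℝ (x '' (u : Set V))) = n := by
  rw [image_eq_range]
  exact (h u (by omega)).finrank_vectorSpan (by rw [Fintype.card_coe, hu])

omit [DecidableEq V] in
theorem FourIndependent.not_coplanar (h : FourIndependent x) {u : Finset V} (hu : u.card = 4) :
    ¬ Coplanar ℝ (x '' (u : Set V)) := by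
  have hfin : Module.Finite ℝ (vectorSpan ℝ (x '' (u : Set V))) := inferInstance
  rw [coplanar_iff_finrank_le_two, h.finrank_vectorSpan (n := 3) le_rfl hu]
  omega

theorem FourIndependent.inGeneralPosition (h : FourIndependent x) : InGeneralPosition x := by
  refine ⟨h.injective, fun u hu => ?_, fun u hu => h.not_coplanar hu⟩
  rw [collinear_iff_finrank_le_one, h.finrank_vectorSpan (n := 2) (by omega) hu]
  omega

/-- Both hulls are faces of the simplex spanned by `u`, and faces of a simplex meet in the face of
their common vertices. -/
theorem FourIndependent.convexHull_inter (h : FourIndependent x) {u s t : Finset V}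
    (hu : u.card ≤ 4) (hs : s ⊆ u) (ht : t ⊆ u) :
    convexHull ℝ (x '' (s : Set V)) ∩ convexHull ℝ (x '' (t : Set V)) =
      convexHull ℝ (x '' ((s : Set V) ∩ (t : Set V))) := by
  classical
  have hi : AffineIndependent ℝ
      ((↑) : ↥(u.image x) → EuclideanSpace ℝ (Fin 3)) := by
    have h1 := (h u hu).range
    have h2 : (Set.range fun v : u => x v) = ((u.image x : Finset _) : Set _) := by
      rw [← image_eq_range, Finset.coe_image]
    rw [h2] at h1
    exact h1
  have h3 := hi.convexHull_inter (t₁ := s.image x) (t₂ := t.image x)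
    (Finset.image_subset_image hs) (Finset.image_subset_image ht)
  rw [Set.image_inter h.injective, ← Finset.coe_image, ← Finset.coe_image, h3]

/-- The two hulls lie on opposite sides of the plane `F = c`, so they meet only inside it. There
each hull is spanned by its vertices in `u`, and two faces of the simplex on `u` meet properly. -/
theorem FourIndependent.inter_subset_of_separated (h : FourIndependent x)
    (F : EuclideanSpace ℝ (Fin 3) →ₗ[ℝ] ℝ) {c : ℝ} {u s t : Finset V} (hu : u.card ≤ 4)
    (hFu : ∀ v ∈ u, F (x v) = c) (hs : ∀ v ∈ s, v ∈ u ∨ c < F (x v))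
    (ht : ∀ v ∈ t, v ∈ u ∨ F (x v) < c) :
    convexHull ℝ (x '' (s : Set V)) ∩ convexHull ℝ (x '' (t : Set V)) ⊆
      convexHull ℝ (x '' ((s : Set V) ∩ (t : Set V))) := by
  rintro y ⟨hys, hyt⟩
  have hs' : ∀ w ∈ x '' (s : Set V), c ≤ F w := by
    rintro _ ⟨v, hv, rfl⟩
    rcases hs v hv with h1 | h1
    exacts [(hFu v h1).ge, h1.le]
  have ht' : ∀ w ∈ x '' (t : Set V), -c ≤ (-F) w := by
    rintro _ ⟨v, hv, rfl⟩
    rw [LinearMap.neg_apply, neg_le_neg_iff]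
    rcases ht v hv with h1 | h1
    exacts [(hFu v h1).le, h1.le]
  have h1 : c ≤ F y :=
    convexHull_min hs' (convex_halfSpace_ge F.isLinear c) hys
  have h2 : -c ≤ (-F) y :=
    convexHull_min ht' (convex_halfSpace_ge (-F).isLinear (-c)) hyt
  rw [LinearMap.neg_apply, neg_le_neg_iff] at h2
  have hy : F y = c := le_antisymm h2 h1
  have h3 := mem_convexHull_of_eq F hs' hys hy
  have h4 := mem_convexHull_of_eq (-F) ht' hyt (by rw [LinearMap.neg_apply, hy])
  have h5 : {w ∈ x '' (s : Set V) | F w = c} ⊆ x '' ((s ∩ u : Finset V) : Set V) := by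
    rintro _ ⟨⟨v, hv, rfl⟩, hF⟩
    exact ⟨v, by simpa using ⟨hv, (hs v hv).resolve_right (by rw [hF]; exact lt_irrefl c)⟩, rfl⟩
  have h6 : {w ∈ x '' (t : Set V) | (-F) w = -c} ⊆ x '' ((t ∩ u : Finset V) : Set V) := by
    rintro _ ⟨⟨v, hv, rfl⟩, hF⟩
    rw [LinearMap.neg_apply, neg_inj] at hF
    exact ⟨v, by simpa using ⟨hv, (ht v hv).resolve_right (by rw [hF]; exact lt_irrefl c)⟩, rfl⟩
  have h7 : y ∈ convexHull ℝ (x '' ((s ∩ u : Finset V) : Set V)) ∩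
      convexHull ℝ (x '' ((t ∩ u : Finset V) : Set V)) :=
    ⟨convexHull_mono h5 h3, convexHull_mono h6 h4⟩
  rw [h.convexHull_inter hu Finset.inter_subset_right Finset.inter_subset_right] at h7
  refine convexHull_mono (Set.image_mono ?_) h7
  intro v
  simp
  tauto

end

/-- Triangles with a common edge have four vertices together, and four independent points are not
coplanar. General position thus settles everything except that the triangles meet in no more than
their common face. -/
theorem isGeometricRealization_of_fourIndependent {V : Type*} [DecidableEq V]
    {K : AbstractSimplicialComplex V} {x : V → EuclideanSpace ℝ (Fin 3)} (h : FourIndependent x)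
    (hK : ∀ s ∈ K, ∀ t ∈ K, s.card = 3 → t.card = 3 → s ≠ t →
      convexHull ℝ (x '' (s : Set V)) ∩ convexHull ℝ (x '' (t : Set V)) ⊆
        convexHull ℝ (x '' ((s : Set V) ∩ (t : Set V)))) :
    K.IsGeometricRealization x where
  nondegenerate s _ hs := h s (by omega)
  inter_eq s hs t ht hs3 ht3 hst := (hK s hs t ht hs3 ht3 hst).antisymm
    (Set.subset_inter (convexHull_mono (Set.image_mono Set.inter_subset_left))
      (convexHull_mono (Set.image_mono Set.inter_subset_right)))
  not_coplanar s _ t _ hs ht hst := by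
    rw [← Finset.coe_union]
    apply h.not_coplanar
    have := Finset.card_union_add_card_inter s t
    omega

theorem isGeometricRealization_comp {V W : Type*} [DecidableEq V] [DecidableEq W]
    {K : AbstractSimplicialComplex V} {L : AbstractSimplicialComplex W} (e : V ≃ W)
    (he : ∀ s : Finset V, s ∈ K → s.map e.toEmbedding ∈ L) {x : W → EuclideanSpace ℝ (Fin 3)}
    (h : L.IsGeometricRealization x) : K.IsGeometricRealization (x ∘ e) := by
  have himg : ∀ s : Finset V, (x ∘ e) '' (s : Set V) = x '' (s.map e.toEmbedding : Finset W) := by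
    intro s
    rw [Set.image_comp, Finset.coe_map]
    rfl
  refine ⟨fun s hs hc => ?_, fun s hs t ht hsc htc hst => ?_, fun s hs t ht hsc htc hst => ?_⟩
  · have h1 := h.nondegenerate _ (he s hs) (by rwa [Finset.card_map])
    exact h1.comp_embedding
      ⟨fun v : s => (⟨e v, Finset.mem_map_of_mem e.toEmbedding v.2⟩ :
        (s.map e.toEmbedding : Finset W)), fun a b hab => Subtype.ext (e.injective
          (congrArg Subtype.val hab))⟩
  · have h1 := h.inter_eq _ (he s hs) _ (he t ht) (by rwa [Finset.card_map])
      (by rwa [Finset.card_map]) (fun heq => hst (Finset.map_injective _ heq))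
    rw [himg, himg, h1, ← Finset.coe_inter, ← Finset.coe_inter, himg, Finset.map_inter]
  · have h1 := h.not_coplanar _ (he s hs) _ (he t ht) (by rwa [Finset.card_map])
      (by rwa [Finset.card_map]) (by rwa [← Finset.map_inter, Finset.card_map])
    rwa [← Finset.coe_union, himg, Finset.map_union, Finset.coe_union]

/-! ### The realizations of the twenty surfaces -/

/-- The point with label `v`. -/
def tablePoint (Q v : ℕ) : Fin 3 → ℤ := ![coord Q (3 * v), coord Q (3 * v + 1), coord Q (3 * v + 2)]

/-- The computed function is `n · v - n · p` with normal `n = (q - p) × (r - p)`, which is the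
determinant `orient`. -/
theorem withPlane_eq {α : Type} (Q p q r : ℕ) (k : (ℕ → ℤ) → α) :
    withPlane Q p q r k =
      k fun v => orient (tablePoint Q p) (tablePoint Q q) (tablePoint Q r) (tablePoint Q v) := by
  simp only [withPlane, forceInt_eq]
  congr 1
  funext v
  simp only [orient, tablePoint, Matrix.cons_val_zero, Matrix.cons_val_one, Matrix.cons_val]
  ring

theorem orient_ne_zero_of_generalCheck {Q : ℕ} (h : generalCheck Q = true) {a b c d : Fin 10}
    (hab : a < b) (hbc : b < c) (hcd : c < d) :
    orient (tablePoint Q a) (tablePoint Q b) (tablePoint Q c) (tablePoint Q d) ≠ 0 := by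
  rw [generalCheck] at h
  have h1 := List.all_eq_true.1 (List.all_eq_true.1 h a (mem_labels a.isLt)) b (mem_labels b.isLt)
  simp only [withPlane_eq, Bool.or_eq_true, Nat.ble_eq, List.all_eq_true, isPos_iff] at h1
  rcases (h1.resolve_left (by omega)) c (mem_labels c.isLt) with h2 | h2
  · omega
  · rcases h2 d (mem_labels d.isLt) with (h3 | h3) | h3 <;> omega

theorem affineIndependent_of_forall_orient_ne_zero {n : ℕ} {z : Fin n → Fin 3 → ℤ}
    (h : ∀ a b c d : Fin n, a < b → b < c → c < d → orient (z a) (z b) (z c) (z d) ≠ 0)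
    {u : Finset (Fin n)} (hu : u.card = 4) :
    AffineIndependent ℝ (fun v : u => integerPoint (z v)) := by
  -- The determinants are known to be nonzero for increasing quadruples only, so the four labels are
  -- listed in increasing order.
  have e := u.orderIsoOfFin hu
  have hlt : ∀ i j : Fin 4, i < j → (e i : Fin n) < e j := fun i j hij => e.strictMono hij
  have h1 := affineIndependent_of_orient_ne_zero
    (h (e 0) (e 1) (e 2) (e 3) (hlt _ _ (by decide)) (hlt _ _ (by decide)) (hlt _ _ (by decide)))
  have h2 : (fun v : u => integerPoint (z v)) ∘ e.toEquiv =
      ![integerPoint (z (e 0)), integerPoint (z (e 1)), integerPoint (z (e 2)),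
        integerPoint (z (e 3))] := by
    funext i
    revert i
    simp [Fin.forall_fin_succ]
  rw [← h2] at h1
  exact (affineIndependent_equiv e.toEquiv).1 h1

/-- A smaller set of labels is first enlarged to four, and subfamilies of affinely independent
families are independent. -/
theorem fourIndependent_of_orient_ne_zero {n : ℕ} (hn : 4 ≤ n) {z : Fin n → Fin 3 → ℤ}
    (h : ∀ a b c d : Fin n, a < b → b < c → c < d → orient (z a) (z b) (z c) (z d) ≠ 0) :
    FourIndependent fun v : Fin n => integerPoint (z v) := by
  intro u hu
  obtain ⟨w, huw, hw⟩ := Finset.exists_superset_card_eq (n := 4) hu (by rwa [Fintype.card_fin])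
  have h1 := affineIndependent_of_forall_orient_ne_zero h hw
  let g : u ↪ w := ⟨fun v => ⟨v.1, huw v.2⟩, fun a b hab =>
    Subtype.ext (congrArg (fun y : w => (y : Fin n)) hab)⟩
  exact h1.comp_embedding g

theorem fourIndependent_of_generalCheck {Q : ℕ} (h : generalCheck Q = true) :
    FourIndependent fun v : Fin 10 => integerPoint (tablePoint Q v) :=
  fourIndependent_of_orient_ne_zero (z := fun v : Fin 10 => tablePoint Q v) (by omega)
    fun _ _ _ _ => orient_ne_zero_of_generalCheck h

/-- `trianglesOf` lists each triangle once, with its least label first; a cyclic rotation of a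
positive triangle brings it into this form. -/
theorem exists_mem_trianglesOf {i : Fin 20} {t : Finset (Fin 10)} (ht : t ∈ surface i)
    (hc : t.card = 3) : ∃ a b c : Fin 10, t = {a, b, c} ∧
      ((a : ℕ), (b : ℕ), (c : ℕ)) ∈ trianglesOf (surfaceTable i) := by
  have hT := isRotationSystem_surface i
  have mem : ∀ {a b c : Fin 10}, tableRel (surfaceTable i) a b c → a < b → a < c →
      ((a : ℕ), (b : ℕ), (c : ℕ)) ∈ trianglesOf (surfaceTable i) := by
    intro a b c h hab hac
    rw [trianglesOf, List.mem_flatMap]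
    refine ⟨a, mem_labels a.isLt, List.mem_flatMap.2 ⟨b, mem_labels b.isLt, ?_⟩⟩
    rw [tableRel] at h
    have h1 : Nat.blt a b = true := Nat.blt_eq.mpr hab
    have h2 : Nat.blt (a + 1) (c + 1) = true := Nat.blt_eq.mpr (Nat.succ_lt_succ hac)
    rw [force_eq, h, h1, h2]
    simp
  have main : ∀ {a b c : Fin 10}, tableRel (surfaceTable i) a b c → ∃ a' b' c' : Fin 10,
      ({a, b, c} : Finset (Fin 10)) = {a', b', c'} ∧
        ((a' : ℕ), (b' : ℕ), (c' : ℕ)) ∈ trianglesOf (surfaceTable i) := by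
    intro a b c h
    have h1 := hT.ne h
    have h2 := hT.ne₂ h
    have h3 := hT.ne₃ h
    by_cases hab : a < b
    · by_cases hac : a < c
      · exact ⟨a, b, c, rfl, mem h hab hac⟩
      · exact ⟨c, a, b, (Finset.triple_rot c a b), mem (hT.rot (hT.rot h)) (by omega) (by omega)⟩
    · by_cases hbc : b < c
      · exact ⟨b, c, a, (Finset.triple_rot a b c).symm, mem (hT.rot h) hbc (by omega)⟩
      · exact ⟨c, a, b, (Finset.triple_rot c a b), mem (hT.rot (hT.rot h)) (by omega) (by omega)⟩
  obtain ⟨a, b, c, hab, hac, hbc, rfl⟩ := Finset.card_eq_three.1 hc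
  rcases ((surface_carriedBy i).mem_iff hab hac hbc).1 ht with h | h
  · exact main h
  · rw [← Finset.triple_swap]; exact main h

/-- The linear part of `orient p q r`. -/
noncomputable def planeForm (p q r : Fin 3 → ℤ) : EuclideanSpace ℝ (Fin 3) →ₗ[ℝ] ℝ :=
  (((q 1 - p 1) * (r 2 - p 2) - (q 2 - p 2) * (r 1 - p 1) : ℤ) : ℝ) • EuclideanSpace.projₗ 0 +
  (((q 2 - p 2) * (r 0 - p 0) - (q 0 - p 0) * (r 2 - p 2) : ℤ) : ℝ) • EuclideanSpace.projₗ 1 +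
  (((q 0 - p 0) * (r 1 - p 1) - (q 1 - p 1) * (r 0 - p 0) : ℤ) : ℝ) • EuclideanSpace.projₗ 2

theorem planeForm_sub (p q r v : Fin 3 → ℤ) :
    planeForm p q r (integerPoint v) - planeForm p q r (integerPoint p) =
      ((orient p q r v : ℤ) : ℝ) := by
  simp [planeForm, orient, integerPoint_apply]
  ring

/-- The triangles `s` and `t` meet in their common face. -/
def MeetProperly (Q : ℕ) (s t : Finset (Fin 10)) : Prop :=
  convexHull ℝ ((fun v : Fin 10 => integerPoint (tablePoint Q v)) '' (s : Set (Fin 10))) ∩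
      convexHull ℝ ((fun v : Fin 10 => integerPoint (tablePoint Q v)) '' (t : Set (Fin 10))) ⊆
    convexHull ℝ ((fun v : Fin 10 => integerPoint (tablePoint Q v)) ''
      ((s : Set (Fin 10)) ∩ (t : Set (Fin 10))))

theorem MeetProperly.symm {Q : ℕ} {s t : Finset (Fin 10)} (h : MeetProperly Q s t) :
    MeetProperly Q t s := by
  rw [MeetProperly, Set.inter_comm, Set.inter_comm (t : Set (Fin 10))]
  exact h

theorem meetProperly_of_planeCheck {Q : ℕ} (hQ : generalCheck Q = true) {a b c d e f p q r : Fin 10}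
    (h : planeCheck Q [a, b, c] [d, e, f] p q r = true) :
    MeetProperly Q {a, b, c} {d, e, f} := by
  have hI := fourIndependent_of_generalCheck hQ
  rw [planeCheck, withPlane_eq] at h
  simp only [Bool.or_eq_true, Bool.and_eq_true, List.all_eq_true, Nat.beq_eq, isPos_iff] at h
  have hu : ({p, q, r} : Finset (Fin 10)).card ≤ 4 := Finset.card_le_three.trans (by omega)
  have hsub := planeForm_sub (tablePoint Q p) (tablePoint Q q) (tablePoint Q r)
  have hFu : ∀ v ∈ ({p, q, r} : Finset (Fin 10)),
      planeForm (tablePoint Q p) (tablePoint Q q) (tablePoint Q r)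
        (integerPoint (tablePoint Q v)) =
      planeForm (tablePoint Q p) (tablePoint Q q) (tablePoint Q r)
        (integerPoint (tablePoint Q p)) := by
    intro v hv
    rw [← sub_eq_zero, hsub, Int.cast_eq_zero]
    simp only [Finset.mem_insert, Finset.mem_singleton] at hv
    -- The determinant vanishes at the three points that define the plane, which is why the check
    -- may skip them whatever their computed sign.
    rcases hv with rfl | rfl | rfl <;> simp only [orient] <;> ring
  have mem3 : ∀ {v x y z : Fin 10}, v ∈ ({x, y, z} : Finset (Fin 10)) →
      (v : ℕ) ∈ [(x : ℕ), (y : ℕ), (z : ℕ)] := by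
    intro v x y z hv
    simp only [Finset.mem_insert, Finset.mem_singleton] at hv
    rcases hv with rfl | rfl | rfl <;> simp
  have conv : ∀ {v : Fin 10} {P : Prop}, (((v : ℕ) = p ∨ (v : ℕ) = q) ∨ (v : ℕ) = r) ∨ P →
      v ∈ ({p, q, r} : Finset (Fin 10)) ∨ P := by
    intro v P hv
    simp only [Finset.mem_insert, Finset.mem_singleton, Fin.ext_iff]
    tauto
  have pos : ∀ {v : Fin 10}, 0 < orient (tablePoint Q p) (tablePoint Q q) (tablePoint Q r)
      (tablePoint Q v) → planeForm (tablePoint Q p) (tablePoint Q q) (tablePoint Q r)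
        (integerPoint (tablePoint Q p)) < planeForm (tablePoint Q p) (tablePoint Q q)
          (tablePoint Q r) (integerPoint (tablePoint Q v)) := by
    intro v hv
    rw [← sub_pos, hsub]
    exact_mod_cast hv
  have neg : ∀ {v : Fin 10}, 0 < -orient (tablePoint Q p) (tablePoint Q q) (tablePoint Q r)
      (tablePoint Q v) → planeForm (tablePoint Q p) (tablePoint Q q) (tablePoint Q r)
        (integerPoint (tablePoint Q v)) < planeForm (tablePoint Q p) (tablePoint Q q)
          (tablePoint Q r) (integerPoint (tablePoint Q p)) := by
    intro v hv
    rw [← sub_neg, hsub]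
    exact_mod_cast (by omega : orient (tablePoint Q p) (tablePoint Q q) (tablePoint Q r)
      (tablePoint Q v) < 0)
  rcases h with ⟨h1, h2⟩ | ⟨h1, h2⟩
  · exact hI.inter_subset_of_separated (planeForm _ _ _) hu hFu
      (fun v hv => (conv (h1 v (mem3 hv))).imp_right pos)
      (fun v hv => (conv (h2 v (mem3 hv))).imp_right neg)
  -- The triangles are on the other sides of the plane; exchanging them leads back to the first
  -- case.
  · apply MeetProperly.symm
    exact hI.inter_subset_of_separated (planeForm _ _ _) hu hFu
      (fun v hv => (conv (h2 v (mem3 hv))).imp_right pos)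
      (fun v hv => (conv (h1 v (mem3 hv))).imp_right neg)

theorem meetProperly_of_separated {Q : ℕ} (hQ : generalCheck Q = true) {a b c d e f : Fin 10}
    (h : separated Q (a, b, c) (d, e, f) = true) : MeetProperly Q {a, b, c} {d, e, f} := by
  simp only [separated, Bool.or_eq_true] at h
  have key := fun p q r : Fin 10 => meetProperly_of_planeCheck (Q := Q) hQ (a := a) (b := b) (c := c)
    (d := d) (e := e) (f := f) (p := p) (q := q) (r := r)
  repeat' rcases h with h | h
  all_goals exact key _ _ _ h

theorem pairwise_of_allPairwise {α : Type} {R : α → α → Bool} :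
    ∀ {l : List α}, allPairwise R l = true → l.Pairwise fun x y => R x y = true
  | [], _ => List.Pairwise.nil
  | x :: l, h => by
    rw [allPairwise, Bool.and_eq_true, List.all_eq_true] at h
    exact List.Pairwise.cons h.1 (pairwise_of_allPairwise h.2)

/-- The positions of the vertices of the `i`-th surface. -/
def surfacePosition (i : Fin 20) (v : Fin 10) : Fin 3 → ℤ := tablePoint (surfacePoints.getD i 0) v

theorem fourIndependent_surface (i : Fin 20) :
    FourIndependent fun v => integerPoint (surfacePosition i v) := by
  apply fourIndependent_of_generalCheck
  apply List.all_eq_true.1 generalCheck_surfacePoints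
  rw [List.getD_eq_getElem _ _ (show (i : ℕ) < surfacePoints.length from i.isLt)]
  exact List.getElem_mem _

theorem surface_isGeometricRealization (i : Fin 20) :
    (surface i).IsGeometricRealization fun v => integerPoint (surfacePosition i v) := by
  apply isGeometricRealization_of_fourIndependent (fourIndependent_surface i)
  intro s hs t ht hs3 ht3 hst
  have h1 : (i : ℕ) < surfacePoints.length := i.isLt
  have h2 : (i : ℕ) < surfaceTables.length := i.isLt
  have hmem : (surfaceTable i, surfacePoints.getD i 0) ∈ surfaceTables.zip surfacePoints := by
    rw [surfaceTable, List.getD_eq_getElem _ _ h1, List.getD_eq_getElem _ _ h2, ← List.getElem_zip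
      (h := by rw [List.length_zip]; exact lt_min h2 h1)]
    exact List.getElem_mem _
  have hQ : generalCheck (surfacePoints.getD i 0) = true := by
    apply List.all_eq_true.1 generalCheck_surfacePoints
    rw [List.getD_eq_getElem _ _ h1]
    exact List.getElem_mem _
  have hpair := pairwise_of_allPairwise (List.all_eq_true.1 separated_surfaces _ hmem)
  obtain ⟨a, b, c, rfl, hs'⟩ := exists_mem_trianglesOf hs hs3
  obtain ⟨d, e, f, rfl, ht'⟩ := exists_mem_trianglesOf ht ht3
  have hne : ((a : ℕ), (b : ℕ), (c : ℕ)) ≠ ((d : ℕ), (e : ℕ), (f : ℕ)) := by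
    intro h
    simp only [Prod.mk.injEq] at h
    apply hst
    rw [Fin.ext h.1, Fin.ext h.2.1, Fin.ext h.2.2]
  change MeetProperly (surfacePoints.getD i 0) {a, b, c} {d, e, f}
  -- Each pair is tested in the order of the list only; symmetrizing the relation makes it available
  -- for any two different triangles.
  have hpair' : (trianglesOf (surfaceTable i)).Pairwise fun x y =>
      separated (surfacePoints.getD i 0) x y = true ∨
        separated (surfacePoints.getD i 0) y x = true := hpair.imp Or.inl
  have hsymm : Std.Symm fun x y => separated (surfacePoints.getD i 0) x y = true ∨
      separated (surfacePoints.getD i 0) y x = true := ⟨fun _ _ => Or.symm⟩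
  rcases hpair'.forall hs' ht' hne with h | h
  · exact meetProperly_of_separated hQ h
  · exact (meetProperly_of_separated hQ h).symm


theorem FourIndependent.comp_equiv {V W : Type*} {x : W → EuclideanSpace ℝ (Fin 3)}
    (h : FourIndependent x) (e : V ≃ W) : FourIndependent (x ∘ e) := by
  intro u hu
  have h1 := h (u.map e.toEmbedding) (by rwa [Finset.card_map])
  let g : u ↪ (u.map e.toEmbedding : Finset W) :=
    ⟨fun v => ⟨e v, Finset.mem_map_of_mem e.toEmbedding v.2⟩,
      fun a b hab => Subtype.ext (e.injective
        (congrArg (fun y : (u.map e.toEmbedding : Finset W) => (y : W)) hab))⟩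
  exact h1.comp_embedding g

end AbstractSimplicialComplex

/-! ### The theorem -/

theorem mainTheorem2 :
    -- the smallest number of vertices of a triangulation of the genus 3 surface is 10
    IsLeast {n : ℕ | ∃ K : AbstractSimplicialComplex (Fin n), K.Triangulates 3} 10 ∧
    -- there are exactly 20 combinatorial types of vertex-minimal triangulations
    (∃ T : Fin 20 → AbstractSimplicialComplex (Fin 10),
      (∀ i, (T i).IsVertexMinimal 3) ∧
      (∀ i j, (T i).Isomorphic (T j) → i = j) ∧
      (∀ (V : Type*) [Fintype V] [DecidableEq V] (K : AbstractSimplicialComplex V),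
        K.IsVertexMinimal 3 → ∃ i, K.Isomorphic (T i))) ∧
    -- each of them is geometrically realizable, even with integer points in general position
    (∀ (V : Type*) [Fintype V] [DecidableEq V] (K : AbstractSimplicialComplex V),
      K.IsVertexMinimal 3 →
        K.GeometricallyRealizable ∧
        ∃ z : V → Fin 3 → ℤ,
          InGeneralPosition (fun v => integerPoint (z v)) ∧
          K.IsGeometricRealization (fun v => integerPoint (z v))) := by
  refine ⟨⟨⟨AbstractSimplicialComplex.surface 0,
      AbstractSimplicialComplex.surface_triangulates 0⟩,
      fun n ⟨K, hK⟩ => by simpa using hK.ten_le_card⟩,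
    ⟨AbstractSimplicialComplex.surface, AbstractSimplicialComplex.surface_isVertexMinimal,
      fun i j => AbstractSimplicialComplex.surface_isomorphic_imp_eq,
      fun V _ _ K hK => hK.1.exists_isomorphic hK.card_eq⟩, fun V _ _ K hK => ?_⟩
  obtain ⟨i, e, he⟩ := hK.1.exists_isomorphic hK.card_eq
  -- The coordinates of the listed surface are pulled back along the isomorphism.
  let z (v : V) : Fin 3 → ℤ := AbstractSimplicialComplex.surfacePosition i (e v)
  have hz : K.IsGeometricRealization fun v => integerPoint (z v) :=
    AbstractSimplicialComplex.isGeometricRealization_comp e (fun s => (he s).1)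
      (AbstractSimplicialComplex.surface_isGeometricRealization i)
  exact ⟨⟨_, hz⟩, z,
    ((AbstractSimplicialComplex.fourIndependent_surface i).comp_equiv e).inGeneralPosition, hz⟩
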